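/- Let $K$ be an algebraically closed field and let $Q=(Q_0,Q_1)$ be a finite quiver. Paths are composed from left to right, and modules are right modules. The double quiver $\overline{Q}$ is obtained from $Q$ by adding, for each arrow $a:i\to j$, an arrow $a^*:j\to i$. For a path $p=a_1a_2\cdots a_\ell$ of $Q$ put $p^*:=a_\ell^*\cdots a_2^*a_1^*$ (with $e_v^*:=e_v$ for trivial paths), and extend this linearly to $KQ$. Let $\Lambda$ be one of the following finite-dimensional algebras: (a) the preprojective algebra $\Pi_Q:=K\overline{Q}/\langle \sum_{a\in Q_1}(aa^*-a^*a)\rangle$, where $Q$ is a Dynkin quiver (its underlying graph is of type $A_n$ with $n\ge 1$, $D_n$ with $n\ge 4$, $E_6$, $E_7$ or $E_8$); (b) $\Lambda(Q,I):=K\overline{Q}/\overline{I}$, where $I$ is an admissible ideal of $KQ$ and $\overline{I}$ is the ideal generated by $p$, $p^*$ ($p\in I$) and $ab^*$ ($a,b\in Q_1$). An object $T$ of $\mathcal{K}_\Lambda:=\mathsf{K}^{\mathrm b}(\mathsf{proj}\,\Lambda)$ is silting if $\operatorname{Hom}(T,T[i])=0$ for all $i>0$ and the smallest thick subcategory of $\mathcal{K}_\Lambda$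 containing $T$ is $\mathcal{K}_\Lambda$. Write $T\geq U$ if $\operatorname{Hom}(T,U[i])=0$ for all $i>0$; this is a partial order on the set of isomorphism classes of basic silting objects. Let $\mathsf{2silt}\,\Lambda$ be the set of isomorphism classes of basic silting objects $T$ with $\Lambda\geq T\geq\Lambda[1]$. For an object $T=X\oplus M$, the left mutation $\mu_X^-(T)$ is $Y\oplus M$, where $Y$ is the cone of a minimal left $\mathsf{add}\,M$-approximation $X\to M'$; dually, the right mutation $\mu_X^+(T)$ is $Y\oplus M$, where $Y$ is the cocone of a minimal right $\mathsf{add}\,M$-approximation $M'\to X$. For a finitely generated indecomposable projective $\Lambda$-module $P$ put $$\mathcal{T}_P^-:=\{T\in\mathsf{2silt}\,\Lambda \mid \mu_P^-(\Lambda)\geq T\geq \Lambda[1]\},\qquad \mathcal{T}_P^+:=\{T\in\mathsf{2silt}\,\Lambda \mid \Lambda\geq T\geq \mu_{P[1]}^+(\Lambda[1])\}.$$ Then for every finitely generated indecomposable projective $\Lambda$-module $P$ there is an order-reversing bijection between $\mathcal{T}_P^-$ and $\mathcal{T}_P^+$ (that is, an anti-isomorphism of posets), and $|\mathsf{2silt}\,\Lambda|=2\cdot|\mathcal{T}_P^-|$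 (an equality of cardinals if these sets are infinite). -/

import Mathlib

open CategoryTheory CategoryTheory.Limits CategoryTheory.Pretriangulated

universe u v w

noncomputable section

/-! ## Path algebras of finite quivers -/

/-- The path algebra `K V` of a quiver `V`: the `K`-vector space on the set of all paths
(including the trivial path at each vertex).  Paths compose from left to right: `p * q` is the
path `p` followed by the path `q`, and is `0` if `p` does not end where `q` starts. -/
def PathAlgebra (K : Type u) (V : Type v) [Quiver.{w} V] [Zero K] : Type (max u v w) :=
  ((i : V) × (j : V) × Quiver.Path i j) →₀ K

namespace PathAlgebra

section Ring

variable {K : Type u} [Field K] {V : Type v} [Quiver.{w} V]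

instance : AddCommGroup (PathAlgebra K V) :=
  inferInstanceAs (AddCommGroup (((i : V) × (j : V) × Quiver.Path i j) →₀ K))

instance : Module K (PathAlgebra K V) :=
  inferInstanceAs (Module K (((i : V) × (j : V) × Quiver.Path i j) →₀ K))

variable (K) in
/-- The basis element of the path algebra given by a path. -/
def ofPath {i j : V} (p : Quiver.Path i j) : PathAlgebra K V :=
  Finsupp.single ⟨i, j, p⟩ 1

variable (K) in
/-- The element of the path algebra given by an arrow. -/
def ofArrow {i j : V} (a : i ⟶ j) : PathAlgebra K V :=
  ofPath K a.toPath

open Classical in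
variable (K) in
/-- The product of two basis paths: their concatenation, or zero. -/
def pathMul (p q : (i : V) × (j : V) × Quiver.Path i j) : PathAlgebra K V :=
  if h : p.2.1 = q.1 then ofPath K (p.2.2.comp (q.2.2.cast h.symm rfl)) else 0

/-- The bilinear extension of the product of paths. -/
def mulHom : PathAlgebra K V →ₗ[K] PathAlgebra K V →ₗ[K] PathAlgebra K V :=
  Finsupp.linearCombination K fun p => Finsupp.linearCombination K (pathMul K p)

instance : Mul (PathAlgebra K V) := ⟨fun x y => mulHom x y⟩

instance [Fintype V] : One (PathAlgebra K V) :=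
  ⟨∑ i : V, ofPath K (Quiver.Path.nil : Quiver.Path i i)⟩

theorem mul_def (x y : PathAlgebra K V) : x * y = mulHom x y := rfl

theorem one_def [Fintype V] :
    (1 : PathAlgebra K V) = ∑ i : V, ofPath K (Quiver.Path.nil : Quiver.Path i i) := rfl

theorem mulHom_ofPath_ofPath {i j k l : V} (p : Quiver.Path i j) (q : Quiver.Path k l) :
    mulHom (ofPath K p) (ofPath K q) = pathMul K ⟨i, j, p⟩ ⟨k, l, q⟩ := by
  have h1 : mulHom (ofPath K p) = Finsupp.linearCombination K (pathMul K ⟨i, j, p⟩) :=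
    (Finsupp.linearCombination_single K 1 _).trans (one_smul K _)
  rw [h1]
  exact (Finsupp.linearCombination_single K 1 _).trans (one_smul K _)

theorem ofPath_mul_ofPath {i j l : V} (p : Quiver.Path i j) (q : Quiver.Path j l) :
    ofPath K p * ofPath K q = ofPath K (p.comp q) := by
  rw [mul_def, mulHom_ofPath_ofPath]
  simp [pathMul]

theorem ofPath_mul_ofPath_of_ne {i j k l : V} (p : Quiver.Path i j) (q : Quiver.Path k l)
    (h : j ≠ k) : ofPath K p * ofPath K q = 0 := by
  rw [mul_def, mulHom_ofPath_ofPath]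
  simp [pathMul, h]

/-- The paths span the path algebra. -/
theorem induction_path {motive : PathAlgebra K V → Prop} (x : PathAlgebra K V)
    (zero : motive 0) (add : ∀ x y, motive x → motive y → motive (x + y))
    (smul : ∀ (c : K) (i j : V) (p : Quiver.Path i j), motive (c • ofPath K p)) : motive x := by
  refine Finsupp.induction_linear (motive := motive) x zero add ?_
  rintro ⟨i, j, p⟩ c
  have h : (Finsupp.single ⟨i, j, p⟩ c : PathAlgebra K V) = c • ofPath K p :=
    (Finsupp.smul_single_one _ _).symm
  exact h ▸ smul c i j p

instance : NonUnitalNonAssocRing (PathAlgebra K V) where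
  left_distrib x y z := by simp [mul_def]
  right_distrib x y z := by simp [mul_def]
  zero_mul x := by simp [mul_def]
  mul_zero x := by simp [mul_def]

instance : IsScalarTower K (PathAlgebra K V) (PathAlgebra K V) :=
  ⟨fun c x y => by simp [mul_def]⟩

instance : SMulCommClass K (PathAlgebra K V) (PathAlgebra K V) :=
  ⟨fun c x y => by simp [mul_def]⟩

theorem ofPath_mul_assoc {i j k l m n : V} (p : Quiver.Path i j) (q : Quiver.Path k l)
    (r : Quiver.Path m n) :
    ofPath K p * ofPath K q * ofPath K r = ofPath K p * (ofPath K q * ofPath K r) := by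
  by_cases h1 : j = k
  · subst h1
    by_cases h2 : l = m
    · subst h2
      simp only [ofPath_mul_ofPath, Quiver.Path.comp_assoc]
    · rw [ofPath_mul_ofPath, ofPath_mul_ofPath_of_ne _ _ h2,
        ofPath_mul_ofPath_of_ne _ _ h2, mul_zero]
  · rw [ofPath_mul_ofPath_of_ne _ _ h1, zero_mul]
    by_cases h2 : l = m
    · subst h2
      rw [ofPath_mul_ofPath, ofPath_mul_ofPath_of_ne _ _ h1]
    · rw [ofPath_mul_ofPath_of_ne _ _ h2, mul_zero]

instance : NonUnitalRing (PathAlgebra K V) where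
  mul_assoc x y z := by
    induction x using induction_path with
    | zero => simp
    | add x x' hx hx' => simp only [add_mul, hx, hx']
    | smul c i j p =>
      induction y using induction_path with
      | zero => simp
      | add y y' hy hy' => simp only [add_mul, mul_add, hy, hy']
      | smul d k l q =>
        induction z using induction_path with
        | zero => simp
        | add z z' hz hz' => simp only [mul_add, hz, hz']
        | smul e m n r =>
          simp only [smul_mul_assoc, mul_smul_comm, ofPath_mul_assoc]

instance [Fintype V] : Ring (PathAlgebra K V) where
  __ := (inferInstance : NonUnitalRing (PathAlgebra K V))
  one_mul x := by
    induction x using induction_path with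
    | zero => simp
    | add x x' hx hx' => simp only [mul_add, hx, hx']
    | smul c i j p =>
      rw [mul_smul_comm, one_def, Finset.sum_mul, Finset.sum_eq_single i,
        ofPath_mul_ofPath, Quiver.Path.nil_comp]
      · intro b _ hb
        exact ofPath_mul_ofPath_of_ne _ _ hb
      · simp
  mul_one x := by
    induction x using induction_path with
    | zero => simp
    | add x x' hx hx' => simp only [add_mul, hx, hx']
    | smul c i j p =>
      rw [smul_mul_assoc, one_def, Finset.mul_sum, Finset.sum_eq_single j,
        ofPath_mul_ofPath, Quiver.Path.comp_nil]
      · intro b _ hb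
        exact ofPath_mul_ofPath_of_ne _ _ hb.symm
      · simp

instance [Fintype V] : Algebra K (PathAlgebra K V) :=
  Algebra.ofModule smul_mul_assoc mul_smul_comm

end Ring

end PathAlgebra

section Quivers

variable (K : Type u) [Field K] (V : Type v) [Quiver.{w} V]

/-- An ideal `I` of the path algebra is admissible if `R ^ m ⊆ I ⊆ R ^ 2` for some `m ≥ 2`, where
`R ^ m`, the `m`-th power of the arrow ideal `R`, consists of the linear combinations of paths of
length at least `m`. -/
def IsAdmissible {K : Type u} [Field K] {V : Type v} [Quiver.{w} V] [Fintype V]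
    (I : TwoSidedIdeal (PathAlgebra K V)) : Prop :=
  (∃ m : ℕ, 2 ≤ m ∧ ∀ (i j : V) (p : Quiver.Path i j), m ≤ p.length →
    PathAlgebra.ofPath K p ∈ I) ∧
  ∀ x ∈ I, x ∈ Submodule.span K {y : PathAlgebra K V |
    ∃ (i j : V) (p : Quiver.Path i j), 2 ≤ p.length ∧ y = PathAlgebra.ofPath K p}

/-- A Dynkin quiver: a finite quiver whose underlying graph is a Dynkin diagram of type `A n`
(`n ≥ 1`), `D n` (`n ≥ 4`), `E₆`, `E₇` or `E₈`.  Here a finite graph has the matrix whose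
`(i, j)` entry is `2 * δ i j` minus the number of arrows `i ⟶ j` minus the number of arrows
`j ⟶ i`, and the condition is that this is the Cartan matrix of the type up to renumbering. -/
def IsDynkin [∀ i j : V, Fintype (i ⟶ j)] : Prop :=
  (∃ n : ℕ, 1 ≤ n ∧ HasCartan n (CartanMatrix.A n)) ∨
  (∃ n : ℕ, 4 ≤ n ∧ HasCartan n (CartanMatrix.D n)) ∨
  HasCartan 6 CartanMatrix.E₆ ∨ HasCartan 7 CartanMatrix.E₇ ∨ HasCartan 8 CartanMatrix.E₈
where
  HasCartan (n : ℕ) (C : Matrix (Fin n) (Fin n) ℤ) : Prop :=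
    ∃ e : Fin n ≃ V, ∀ i j : Fin n,
      C i j = (if i = j then 2 else 0) - (Fintype.card (e i ⟶ e j) : ℤ)
        - (Fintype.card (e j ⟶ e i) : ℤ)

/-! In the double quiver `Quiver.Symmetrify V` each arrow `a : i ⟶ j` of `V` gives the arrows
`a.toPos : i ⟶ j` (that is, `a`) and `a.toNeg : j ⟶ i` (that is, `a^*`). -/

instance [Fintype V] : Fintype (Quiver.Symmetrify V) := inferInstanceAs (Fintype V)

/-- The path algebra of the double quiver. -/
abbrev DoublePathAlgebra : Type (max u v w) := PathAlgebra K (Quiver.Symmetrify V)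

section

variable {V}

/-- The arrow `a`, as an element of the path algebra of the double quiver. -/
def dblArrow {i j : V} (a : i ⟶ j) : DoublePathAlgebra K V :=
  PathAlgebra.ofArrow K (V := Quiver.Symmetrify V) a.toPos

/-- The arrow `a^*`, as an element of the path algebra of the double quiver. -/
def dblArrowStar {i j : V} (a : i ⟶ j) : DoublePathAlgebra K V :=
  PathAlgebra.ofArrow K (V := Quiver.Symmetrify V) a.toNeg

end

/-- The preprojective relation: the sum of `a * a^* - a^* * a` over all arrows `a`. -/
def preprojectiveRelation [Fintype V] [∀ i j : V, Fintype (i ⟶ j)] : DoublePathAlgebra K V :=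
  ∑ i : V, ∑ j : V, ∑ a : i ⟶ j,
    (dblArrow K a * dblArrowStar K a - dblArrowStar K a * dblArrow K a)

/-- The preprojective algebra of a finite quiver. -/
abbrev PreprojectiveAlgebra [Fintype V] [∀ i j : V, Fintype (i ⟶ j)] : Type (max u v w) :=
  (TwoSidedIdeal.span {preprojectiveRelation K V}).ringCon.Quotient

section

variable {K V}

/-- The inclusion of the path algebra of `V` into that of the double quiver, sending a path to
itself. -/
def dblPath : PathAlgebra K V →ₗ[K] DoublePathAlgebra K V :=
  Finsupp.linearCombination K fun p : (i : V) × (j : V) × Quiver.Path i j =>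
    PathAlgebra.ofPath K (Quiver.Symmetrify.of.mapPath p.2.2)

/-- The linear map sending a path `p = a₁ a₂ ⋯ aₗ` of `V` to the path `p^* = aₗ^* ⋯ a₂^* a₁^*` of
the double quiver. -/
def dblPathStar : PathAlgebra K V →ₗ[K] DoublePathAlgebra K V :=
  Finsupp.linearCombination K fun p : (i : V) × (j : V) × Quiver.Path i j =>
    PathAlgebra.ofPath K (Quiver.Symmetrify.of.mapPath p.2.2).reverse

/-- The generators of the ideal defining the algebra `Λ(V, I)`: the elements `p` and `p^*` for
`p ∈ I`, and `a * b^*` for arrows `a` and `b`. -/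
def dualExtensionRelations [Fintype V] (I : TwoSidedIdeal (PathAlgebra K V)) :
    Set (DoublePathAlgebra K V) :=
  {x | ∃ p ∈ I, x = dblPath p} ∪ {x | ∃ p ∈ I, x = dblPathStar p} ∪
    {x | ∃ (i j k l : V) (a : i ⟶ j) (b : k ⟶ l), x = dblArrow K a * dblArrowStar K b}

/-- The algebra `Λ(V, I)`. -/
abbrev DualExtensionAlgebra [Fintype V] (I : TwoSidedIdeal (PathAlgebra K V)) :
    Type (max u v w) :=
  (TwoSidedIdeal.span (dualExtensionRelations I)).ringCon.Quotient

end

end Quivers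

/-! ## Silting objects and mutation in triangulated categories -/

section Triangulated

variable {C : Type u} [Category.{v} C] [Preadditive C] [HasShift C ℤ]

/-- The relation `T ≥ U`: every morphism `T ⟶ U⟦i⟧` with `i > 0` vanishes. -/
def SiltGE (T U : C) : Prop :=
  ∀ i : ℤ, 0 < i → ∀ f : T ⟶ U⟦i⟧, f = 0

theorem SiltGE.of_iso {T T' U U' : C} (e : T ≅ T') (e' : U ≅ U') (h : SiltGE T U) :
    SiltGE T' U' := fun i hi f => by
  have h0 := h i hi (e.hom ≫ f ≫ e'.inv⟦i⟧')
  have h1 : f = e.inv ≫ (e.hom ≫ f ≫ e'.inv⟦i⟧') ≫ e'.hom⟦i⟧' := by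
    simp [← Functor.map_comp]
  rw [h1, h0]
  simp

variable [HasZeroObject C] [∀ n : ℤ, (shiftFunctor C n).Additive] [Pretriangulated C]

/-- The smallest thick (triangulated, closed under direct summands) subcategory containing `T`. -/
abbrev thick (T : C) : ObjectProperty C :=
  (ObjectProperty.singleton T).triangEnvelope

/-- `X` is in `add M`: it is a direct summand of a finite direct sum of copies of `M`. -/
def InAdd (M X : C) : Prop :=
  ∃ n : ℕ, Nonempty (Retract X (⨁ fun _ : Fin n => M))

/-- `f : X ⟶ M'` is a minimal left `add M`-approximation of `X`. -/
def IsMinLeftApprox (M : C) {X M' : C} (f : X ⟶ M') : Prop :=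
  InAdd M M' ∧
  (∀ (N : C) (h : X ⟶ N), InAdd M N → ∃ g : M' ⟶ N, f ≫ g = h) ∧
  ∀ g : M' ⟶ M', f ≫ g = f → IsIso g

/-- `f : M' ⟶ X` is a minimal right `add M`-approximation of `X`. -/
def IsMinRightApprox (M : C) {M' X : C} (f : M' ⟶ X) : Prop :=
  InAdd M M' ∧
  (∀ (N : C) (h : N ⟶ X), InAdd M N → ∃ g : N ⟶ M', g ≫ f = h) ∧
  ∀ g : M' ⟶ M', g ≫ f = f → IsIso g

/-- `U` is the left mutation of `T` with respect to `X`: there is a decomposition `T ≅ X ⊞ M`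
such that `U ≅ Y ⊞ M`, where `Y` is the cone of a minimal left `add M`-approximation of `X`. -/
def IsLeftMutation (T X U : C) : Prop :=
  ∃ (M M' Y : C) (f : X ⟶ M') (g : M' ⟶ Y) (h : Y ⟶ X⟦(1 : ℤ)⟧),
    Nonempty (T ≅ X ⊞ M) ∧ IsMinLeftApprox M f ∧ Triangle.mk f g h ∈ distTriang C ∧
      Nonempty (U ≅ Y ⊞ M)

/-- `U` is the right mutation of `T` with respect to `X`: there is a decomposition `T ≅ X ⊞ M`
such that `U ≅ Y ⊞ M`, where `Y` is the cocone of a minimal right `add M`-approximation of `X`. -/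
def IsRightMutation (T X U : C) : Prop :=
  ∃ (M M' Y : C) (g : Y ⟶ M') (f : M' ⟶ X) (h : X ⟶ Y⟦(1 : ℤ)⟧),
    Nonempty (T ≅ X ⊞ M) ∧ IsMinRightApprox M f ∧ Triangle.mk g f h ∈ distTriang C ∧
      Nonempty (U ≅ Y ⊞ M)

/-- `T` is basic: no nonzero object occurs twice as a direct summand of `T`. -/
def IsBasicObj (T : C) : Prop :=
  ∀ X : C, Nonempty (Retract (X ⊞ X) T) → IsZero X

end Triangulated

/-! ## Two-term silting objects of an algebra -/

section TwoTerm

variable (A : Type u) [Ring A]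

/-- The homotopy category of complexes of right `A`-modules. -/
abbrev HoCat : Type (u + 1) :=
  HomotopyCategory (ModuleCat.{u} Aᵐᵒᵖ) (ComplexShape.up ℤ)

variable {A}

/-- The objects of `K^b(proj A)`: the complexes homotopy equivalent to a bounded complex of
finitely generated projective right `A`-modules. -/
def IsPerfect : ObjectProperty (HoCat A) := fun X =>
  ∃ C : CochainComplex (ModuleCat.{u} Aᵐᵒᵖ) ℤ,
    (∃ a b : ℤ, ∀ i : ℤ, i < a ∨ b < i → IsZero (C.X i)) ∧
    (∀ i : ℤ, Module.Finite Aᵐᵒᵖ (C.X i) ∧ Module.Projective Aᵐᵒᵖ (C.X i)) ∧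
    Nonempty (X ≅ (HomotopyCategory.quotient _ _).obj C)

/-- A right module, as a complex concentrated in degree `0`. -/
abbrev stalk (P : ModuleCat.{u} Aᵐᵒᵖ) : HoCat A :=
  (HomotopyCategory.singleFunctor (ModuleCat.{u} Aᵐᵒᵖ) 0).obj P

variable (A) in
/-- `A` as a right module over itself, as a complex concentrated in degree `0`. -/
abbrev regularObj : HoCat A :=
  stalk (ModuleCat.of Aᵐᵒᵖ A)

/-- Silting objects of `K^b(proj A)`.  Since `thick T ⊆ K^b(proj A)` for each `T` in
`K^b(proj A)`, the last condition says that `thick T = K^b(proj A)`. -/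
structure IsSilting (T : HoCat A) : Prop where
  perfect : IsPerfect T
  ge_self : SiltGE T T
  generates : IsPerfect ≤ thick T

/-- Basic silting objects `T` with `A ≥ T ≥ A[1]`. -/
structure IsTwoSilting (T : HoCat A) : Prop where
  silting : IsSilting T
  basic : IsBasicObj T
  regular_ge : SiltGE (regularObj A) T
  ge_shift : SiltGE T ((regularObj A)⟦(1 : ℤ)⟧)

variable (A) in
/-- Isomorphism of basic two-term silting objects. -/
instance twoSiltSetoid : Setoid {T : HoCat A // IsTwoSilting T} where
  r T U := Nonempty (T.1 ≅ U.1)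
  iseqv := ⟨fun _ => ⟨Iso.refl _⟩, fun ⟨e⟩ => ⟨e.symm⟩, fun ⟨e⟩ ⟨e'⟩ => ⟨e.trans e'⟩⟩

variable (A) in
/-- The set of isomorphism classes of basic two-term silting objects. -/
def TwoSilt : Type (u + 1) := Quotient (twoSiltSetoid A)

namespace TwoSilt

/-- `U ≤ T` if `T ≥ U` in the silting order. -/
instance : LE (TwoSilt A) where
  le := Quotient.lift₂ (fun U T => SiltGE T.1 U.1) fun _ _ _ _ ⟨e⟩ ⟨e'⟩ =>
    propext ⟨fun h => h.of_iso e' e, fun h => h.of_iso e'.symm e.symm⟩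

/-- `X ≥ T` for an object `X` and a two-term silting object `T`. -/
def GEBy (X : HoCat A) : TwoSilt A → Prop :=
  Quotient.lift (fun T => SiltGE X T.1) fun _ _ ⟨e⟩ =>
    propext ⟨fun h => h.of_iso (Iso.refl _) e, fun h => h.of_iso (Iso.refl _) e.symm⟩

/-- `T ≥ X` for an object `X` and a two-term silting object `T`. -/
def GEThan (X : HoCat A) : TwoSilt A → Prop :=
  Quotient.lift (fun T => SiltGE T.1 X) fun _ _ ⟨e⟩ =>
    propext ⟨fun h => h.of_iso e (Iso.refl _), fun h => h.of_iso e.symm (Iso.refl _)⟩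

/-- The two-term silting objects `T` with `μ_P^-(A) ≥ T ≥ A[1]`. -/
def minus (P : ModuleCat.{u} Aᵐᵒᵖ) : Set (TwoSilt A) :=
  {T | ∃ U : HoCat A, IsLeftMutation (regularObj A) (stalk P) U ∧
    T.GEBy U ∧ T.GEThan ((regularObj A)⟦(1 : ℤ)⟧)}

/-- The two-term silting objects `T` with `A ≥ T ≥ μ_{P[1]}^+(A[1])`. -/
def plus (P : ModuleCat.{u} Aᵐᵒᵖ) : Set (TwoSilt A) :=
  {T | ∃ U : HoCat A,
    IsRightMutation ((regularObj A)⟦(1 : ℤ)⟧) ((stalk P)⟦(1 : ℤ)⟧) U ∧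
    T.GEBy (regularObj A) ∧ T.GEThan U}

end TwoSilt

end TwoTerm

end

/-! Both families of algebras carry an anti-involution, reversal of paths, which fixes the vertex
idempotents. For a finite-dimensional algebra `A` with such a structure, the functor `Hom(-, A)`,
twisted by the involution, is a duality on finitely generated projectives. It sends a two-term
complex `P ⟶ Q` to `Q* ⟶ P*`, hence induces an order-reversing involution of the two-term silting
objects (`TwoSilt.dual`). Silting has to be recognised inside two-term complexes for this to work: a
presilting two-term complex generates exactly when it is maximal (`isPerfect_le_thick_twoTerm_iff`).

Let `P = eA` be indecomposable, `A = P ⊕ M`, and let `S` be the one-dimensional top of `P`. A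
two-term silting `T` lies below the left mutation of `A` at `P` iff `Hom(T, S) = 0`, and above the
right mutation of `A[1]` at `P[1]` iff `Hom(T, S[1]) = 0`. At least one of these holds since `Hom(T,
T[1]) = 0` (`homVan_or_extVan`); not both, since `T` generates (`not_homVan_and_extVan`). So `minus
P` and `plus P` are complementary (`TwoSilt.compl_minus`). Both memberships also have factorization
forms, `LeftFac` and `RightFac`, phrased with `P` and `M` only; these follow from the vanishing
conditions by a Nakayama argument with the nilpotent radical of `End P`. As `e` is fixed by the
involution, `P` and `M` are self-dual, so transposition exchanges `LeftFac` with `RightFac` and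
therefore `minus P` with `plus P`. Both claims follow (`TwoSilt.sign_decomposition`).

It remains to see that all long paths vanish in the algebras. For `Λ(Q, I)` every path is zero or of
the form `q^* r` modulo the products `a b^*`, and admissibility of `I` bounds both factors. For the
preprojective algebra, the relation places a representation in the zero fibre of a moment map, so
the tangent space to its orbit is isotropic for a symplectic form. This gives `q(d) ≤ dim End` with
`q` the Tits form of the quiver. For the regular representation of a finite-dimensional quotient,
`dim End ≤ ∑ d i`. In Dynkin type a positive vector on which the Cartan matrix is positive turns
`q(d) ≤ ∑ d i` into a bound on `∑ d i` (`sum_le_of_quadratic_form_le`). The truncations by path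
length thus have bounded dimension, and homogeneity of the relation forces long paths to vanish
(`exists_forall_ofPath_mem_of_finrank_le`). -/

noncomputable section

set_option linter.unusedSectionVars false

/-! ### Two-term complexes in the homotopy category: morphisms are commutative squares modulo
homotopy. -/

section TwoTermComplexes

variable {C : Type u} [Category.{v} C] [Preadditive C] [HasZeroObject C] [HasBinaryBiproducts C]

namespace HoSingle

/-- The functor sending an object to the complex concentrated in degree zero. -/
abbrev st (C : Type u) [Category.{v} C] [Preadditive C] [HasZeroObject C] :
    C ⥤ HomotopyCategory C (ComplexShape.up ℤ) :=
  HomotopyCategory.singleFunctor C 0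

abbrev qt (C : Type u) [Category.{v} C] [Preadditive C] :
    CochainComplex C ℤ ⥤ HomotopyCategory C (ComplexShape.up ℤ) :=
  HomotopyCategory.quotient C (ComplexShape.up ℤ)

theorem homotopy_eq_zero_of_isZero {K L : CochainComplex C ℤ}
    (h : ∀ i, IsZero (K.X i) ∨ IsZero (L.X i)) (f : K ⟶ L) : f = 0 := by
  ext i
  rcases h i with h | h
  · exact h.eq_of_src _ _
  · exact h.eq_of_tgt _ _

/-- The quotient functor is full and commutes with shifts, so the morphism lifts to a chain map,
each component of which has zero source or zero target. -/
theorem quotient_hom_shift_eq_zero {K L : CochainComplex C ℤ} {n : ℤ}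
    (h : ∀ i, IsZero (K.X i) ∨ IsZero (L.X (i + n)))
    (f : (qt C).obj K ⟶ ((qt C).obj L)⟦n⟧) : f = 0 := by
  obtain ⟨g, hg⟩ : ∃ g : K ⟶ L⟦n⟧, (qt C).map g ≫ ((qt C).commShiftIso n).hom.app L = f := by
    obtain ⟨g, hg⟩ := (qt C).map_surjective (f ≫ ((qt C).commShiftIso n).inv.app L)
    refine ⟨g, ?_⟩
    rw [hg, Category.assoc, Iso.inv_hom_id_app]
    exact Category.comp_id f
  rw [← hg, homotopy_eq_zero_of_isZero h g, Functor.map_zero, zero_comp]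

theorem hom_st_shift_eq_zero {X : C} {K : CochainComplex C ℤ} {n : ℤ} (hK : IsZero (K.X n))
    (f : (st C).obj X ⟶ ((qt C).obj K)⟦n⟧) : f = 0 := by
  refine quotient_hom_shift_eq_zero (K := (CochainComplex.singleFunctor C 0).obj X) (fun i => ?_) f
  by_cases hi : i = 0
  · right
    rwa [hi, zero_add]
  · exact .inl (HomologicalComplex.isZero_single_obj_X _ _ _ _ hi)

theorem hom_shift_st_eq_zero {X : C} {K : CochainComplex C ℤ} {n : ℤ} (hK : IsZero (K.X (-n)))
    (f : (qt C).obj K ⟶ ((st C).obj X)⟦n⟧) : f = 0 := by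
  refine quotient_hom_shift_eq_zero (L := (CochainComplex.singleFunctor C 0).obj X) (fun i => ?_) f
  by_cases hi : i = -n
  · left
    rwa [hi]
  · exact .inr (HomologicalComplex.isZero_single_obj_X _ _ _ _ (by lia))

theorem hom_st_st_shift_eq_zero {X Y : C} {n : ℤ} (hn : n ≠ 0)
    (f : (st C).obj X ⟶ ((st C).obj Y)⟦n⟧) : f = 0 :=
  hom_st_shift_eq_zero (K := (CochainComplex.singleFunctor C 0).obj Y)
    (HomologicalComplex.isZero_single_obj_X _ _ _ _ hn) f

instance : (st C).Full where
  map_surjective {X Y} f := by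
    obtain ⟨g, hg⟩ := (qt C).map_surjective (X := (CochainComplex.singleFunctor C 0).obj X)
      (Y := (CochainComplex.singleFunctor C 0).obj Y) f
    obtain ⟨h, rfl⟩ := (CochainComplex.singleFunctor C 0).map_surjective g
    exact ⟨h, hg⟩

/-- A homotopy between maps of complexes in degree zero has only components from or into degrees `1`
and `-1`, where the complexes vanish. -/
instance : (st C).Faithful where
  map_injective {X Y} f g h := by
    have h' : (qt C).map ((CochainComplex.singleFunctor C 0).map f) =
      (qt C).map ((CochainComplex.singleFunctor C 0).map g) := h
    have H := HomotopyCategory.homotopyOfEq _ _ h'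
    apply (CochainComplex.singleFunctor C 0).map_injective
    apply HomologicalComplex.from_single_hom_ext
    have h0 := H.comm 0
    have h1 : H.hom 0 (-1) = 0 :=
      (HomologicalComplex.isZero_single_obj_X _ _ _ _ (by simp)).eq_of_tgt _ _
    have h2 : H.hom 1 0 = 0 :=
      (HomologicalComplex.isZero_single_obj_X _ _ _ _ (by simp)).eq_of_src _ _
    rw [dNext_eq _ (show (ComplexShape.up ℤ).Rel 0 1 by simp),
      prevD_eq _ (show (ComplexShape.up ℤ).Rel (-1) 0 by simp), h1, h2, comp_zero, zero_comp,
      zero_add, zero_add] at h0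
    exact h0

end HoSingle

open HoSingle

/-- The complex `P ⟶ Q` with `Q` in degree zero, as an object of the homotopy category. -/
def twoTerm {P Q : C} (f : P ⟶ Q) : HomotopyCategory C (ComplexShape.up ℤ) :=
  (qt C).obj (CochainComplex.mappingCone ((CochainComplex.singleFunctor C 0).map f))

namespace twoTerm

variable {P Q : C} (f : P ⟶ Q) {P' Q' : C} {g : P' ⟶ Q'} {P'' Q'' : C} {h : P'' ⟶ Q''}

abbrev cx : CochainComplex C ℤ :=
  CochainComplex.mappingCone ((CochainComplex.singleFunctor C 0).map f)

/-- The inclusion of the degree zero term. -/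
def inr : (st C).obj Q ⟶ twoTerm f :=
  (qt C).map (CochainComplex.mappingCone.inr _)

/-- The projection to the degree `-1` term. -/
def δ : twoTerm f ⟶ ((st C).obj P)⟦(1 : ℤ)⟧ :=
  (CochainComplex.mappingCone.triangleh ((CochainComplex.singleFunctor C 0).map f)).mor₃

theorem distinguished : Triangle.mk ((st C).map f) (inr f) (δ f) ∈ distTriang _ :=
  HomotopyCategory.mappingCone_triangleh_distinguished
    ((CochainComplex.singleFunctor C 0).map f)

theorem isZero_X {i : ℤ} (h1 : i ≠ -1) (h0 : i ≠ 0) : IsZero ((cx f).X i) := by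
  rw [CochainComplex.mappingCone.isZero_X_iff]
  exact ⟨HomologicalComplex.isZero_single_obj_X _ _ _ _ (by lia),
    HomologicalComplex.isZero_single_obj_X _ _ _ _ h0⟩

variable {f}

/-- The morphism given by a commutative square. -/
def map (a : P ⟶ P') (b : Q ⟶ Q') (w : f ≫ b = a ≫ g) : twoTerm f ⟶ twoTerm g :=
  (qt C).map (CochainComplex.mappingCone.map _ _ ((CochainComplex.singleFunctor C 0).map a)
    ((CochainComplex.singleFunctor C 0).map b) (by rw [← Functor.map_comp, w, Functor.map_comp]))

theorem map_id : map (𝟙 P) (𝟙 Q) (by simp) = 𝟙 (twoTerm f) := by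
  refine (congrArg (qt C).map ?_).trans ((qt C).map_id _)
  rw [← CochainComplex.mappingCone.map_id]
  congr 1 <;> exact CategoryTheory.Functor.map_id _ _

theorem map_comp (a : P ⟶ P') (b : Q ⟶ Q') (w : f ≫ b = a ≫ g) (a' : P' ⟶ P'') (b' : Q' ⟶ Q'')
    (w' : g ≫ b' = a' ≫ h) :
    map (a ≫ a') (b ≫ b') (by rw [reassoc_of% w, w', Category.assoc]) =
      map a b w ≫ map a' b' w' := by
  refine (congrArg (qt C).map ?_).trans ((qt C).map_comp _ _)
  rw [← CochainComplex.mappingCone.map_comp]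
  congr 1 <;> exact CategoryTheory.Functor.map_comp _ _ _

theorem map_add (a : P ⟶ P') (b : Q ⟶ Q') (w : f ≫ b = a ≫ g) (a' : P ⟶ P') (b' : Q ⟶ Q')
    (w' : f ≫ b' = a' ≫ g) :
    map (a + a') (b + b') (by rw [Preadditive.comp_add, w, w', Preadditive.add_comp]) =
      map a b w + map a' b' w' := by
  refine (congrArg (qt C).map ?_).trans ((qt C).map_add)
  ext n
  simp [CochainComplex.mappingCone.ext_from_iff _ (n + 1) n rfl, CochainComplex.mappingCone.map]

open CochainComplex HomologicalComplex in
theorem conj_singleObjXSelf {X Y : C}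
    (a : ((single C (.up ℤ) 0).obj X).X 0 ⟶ ((single C (.up ℤ) 0).obj Y).X 0) :
    (singleObjXSelf (.up ℤ) 0 X).hom ≫ ((singleObjXSelf (.up ℤ) 0 X).inv ≫ a ≫
      (singleObjXSelf (.up ℤ) 0 Y).hom) ≫ (singleObjXSelf (.up ℤ) 0 Y).inv = a := by
  simp

section

open CochainComplex HomComplex

variable {K L K' L' : CochainComplex C ℤ} {F : K ⟶ L} {G : K' ⟶ L'}

theorem inr_map_snd {a : K ⟶ K'} {b : L ⟶ L'} (w : F ≫ b = a ≫ G) (n : ℤ) :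
    (mappingCone.inr F).f n ≫ (mappingCone.map F G a b w).f n ≫
      (mappingCone.snd G).v n n (add_zero n) = b.f n := by
  simp [mappingCone.map]

theorem inl_map_fst {a : K ⟶ K'} {b : L ⟶ L'} (w : F ≫ b = a ≫ G) (p q : ℤ) (h : p + (-1) = q) :
    (mappingCone.inl F).v p q h ≫ (mappingCone.map F G a b w).f q ≫
      (mappingCone.fst G).1.v q p (by lia) = a.f p := by
  simp [mappingCone.map]

/-- Such cones live in degrees `-1` and `0`, and in each of these only one of the two summands is
nonzero, so two components determine a chain map. -/
theorem mappingCone_ext (hK : ∀ i ≠ 0, IsZero (K.X i)) (hL : ∀ i ≠ 0, IsZero (L.X i))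
    (hK' : ∀ i ≠ 0, IsZero (K'.X i)) (hL' : ∀ i ≠ 0, IsZero (L'.X i))
    {φ ψ : mappingCone F ⟶ mappingCone G}
    (h0 : (mappingCone.inr F).f 0 ≫ φ.f 0 ≫ (mappingCone.snd G).v 0 0 (add_zero 0) =
      (mappingCone.inr F).f 0 ≫ ψ.f 0 ≫ (mappingCone.snd G).v 0 0 (add_zero 0))
    (h1 : (mappingCone.inl F).v 0 (-1) (by simp) ≫ φ.f (-1) ≫
      (mappingCone.fst G).1.v (-1) 0 (by simp) =
      (mappingCone.inl F).v 0 (-1) (by simp) ≫ ψ.f (-1) ≫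
      (mappingCone.fst G).1.v (-1) 0 (by simp)) : φ = ψ := by
  ext n
  by_cases h0' : n = 0
  · subst h0'
    rw [mappingCone.ext_from_iff F 1 0 rfl]
    refine ⟨(hK 1 (by simp)).eq_of_src _ _, ?_⟩
    rw [mappingCone.ext_to_iff G 0 1 rfl]
    refine ⟨(hK' 1 (by simp)).eq_of_tgt _ _, ?_⟩
    simpa only [Category.assoc] using h0
  by_cases h1' : n = -1
  · subst h1'
    rw [mappingCone.ext_from_iff F 0 (-1) (by simp)]
    refine ⟨?_, (hL (-1) (by simp)).eq_of_src _ _⟩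
    rw [mappingCone.ext_to_iff G (-1) 0 (by simp)]
    refine ⟨?_, (hL' (-1) (by simp)).eq_of_tgt _ _⟩
    simpa only [Category.assoc] using h1
  · rw [mappingCone.ext_from_iff F (n + 1) n rfl]
    exact ⟨(hK _ (by lia)).eq_of_src _ _, (hL _ h0').eq_of_src _ _⟩

/-- Only the component of the null-homotopy from degree `0` to degree `-1` can be nonzero; it is the
diagonal `s` of the square. -/
theorem homotopy_components (hK : ∀ i ≠ 0, IsZero (K.X i)) (hL : ∀ i ≠ 0, IsZero (L.X i))
    (hK' : ∀ i ≠ 0, IsZero (K'.X i)) (hL' : ∀ i ≠ 0, IsZero (L'.X i))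
    {a : K ⟶ K'} {b : L ⟶ L'} (w : F ≫ b = a ≫ G)
    (H : Homotopy (mappingCone.map F G a b w) 0) :
    ∃ s : L.X 0 ⟶ K'.X 0, a.f 0 = F.f 0 ≫ s ∧ b.f 0 = s ≫ G.f 0 := by
  have hz1 : IsZero ((mappingCone F).X 1) := by
    rw [mappingCone.isZero_X_iff]
    exact ⟨hK _ (by simp), hL _ (by simp)⟩
  have hz2 : IsZero ((mappingCone G).X (-2)) := by
    rw [mappingCone.isZero_X_iff]
    exact ⟨hK' _ (by simp), hL' _ (by simp)⟩
  have hc0 := H.comm 0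
  have hc1 := H.comm (-1)
  rw [dNext_eq _ (show (ComplexShape.up ℤ).Rel 0 1 by simp),
    prevD_eq _ (show (ComplexShape.up ℤ).Rel (-1) 0 by simp),
    hz1.eq_of_src (H.hom 1 0) 0, comp_zero, zero_add] at hc0
  rw [dNext_eq _ (show (ComplexShape.up ℤ).Rel (-1) 0 by simp),
    prevD_eq _ (show (ComplexShape.up ℤ).Rel (-2) (-1) by simp),
    hz2.eq_of_tgt (H.hom (-1) (-2)) 0, zero_comp, add_zero] at hc1
  refine ⟨(mappingCone.inr F).f 0 ≫ H.hom 0 (-1) ≫ (mappingCone.fst G).1.v (-1) 0 (by simp),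
    ?_, ?_⟩
  · rw [← inl_map_fst w 0 (-1) (by simp), hc1]
    simp [mappingCone.inl_v_d_assoc F 0 (-1) 1 (by simp) (by simp), (hK 1 (by simp)).eq_of_tgt (K.d 0 1) 0]
  · rw [← inr_map_snd w 0, hc0]
    have h3 := mappingCone.d_snd_v G (-1) 0 (by simp)
    simp [h3, (hL' (-1) (by simp)).eq_of_src (L'.d (-1) 0) 0]

theorem mappingCone_map_homotopy (s : L ⟶ K') :
    Nonempty (Homotopy (mappingCone.map F G (F ≫ s) (s ≫ G) (by simp)) 0) := by
  refine ⟨mappingCone.descHomotopy _ _ _ 0 ((Cochain.ofHom s).comp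
    (mappingCone.inl G) (zero_add _)) ?_ ?_⟩
  · simp [mappingCone.map, Cochain.ofHom_comp]
  · simp [mappingCone.map]

end

open CochainComplex HomologicalComplex in
theorem exists_chain_map (φ : cx f ⟶ cx g) : ∃ (a : P ⟶ P') (b : Q ⟶ Q') (w : f ≫ b = a ≫ g),
    φ = CochainComplex.mappingCone.map _ _ ((CochainComplex.singleFunctor C 0).map a)
    ((CochainComplex.singleFunctor C 0).map b)
      (by rw [← Functor.map_comp, w, Functor.map_comp]) := by
  set F := (CochainComplex.singleFunctor C 0).map f with hF
  set G := (CochainComplex.singleFunctor C 0).map g with hG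
  set b0 := (mappingCone.inr F).f 0 ≫ φ.f 0 ≫ (mappingCone.snd G).v 0 0 (add_zero 0) with hb0
  set a0 := (mappingCone.inl F).v 0 (-1) (by simp) ≫ φ.f (-1) ≫
    (mappingCone.fst G).1.v (-1) 0 (by simp) with ha0
  let a : P ⟶ P' := (singleObjXSelf (.up ℤ) 0 P).inv ≫ a0 ≫ (singleObjXSelf (.up ℤ) 0 P').hom
  let b : Q ⟶ Q' := (singleObjXSelf (.up ℤ) 0 Q).inv ≫ b0 ≫ (singleObjXSelf (.up ℤ) 0 Q').hom
  have ha : ((CochainComplex.singleFunctor C 0).map a).f 0 = a0 :=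
    (single_map_f_self (.up ℤ) 0 a).trans (conj_singleObjXSelf a0)
  have hb : ((CochainComplex.singleFunctor C 0).map b).f 0 = b0 :=
    (single_map_f_self (.up ℤ) 0 b).trans (conj_singleObjXSelf b0)
  -- Compatibility of `φ` with the differential from degree `-1` to degree `0`, read between the
  -- surviving summands, is commutativity of the square.
  have w0 : F.f 0 ≫ b0 = a0 ≫ G.f 0 := by
    have h1 := φ.comm (-1) 0
    have h2 := mappingCone.inl_v_d F 0 (-1) 1 (by simp) (by simp)
    have h3 := mappingCone.d_snd_v G (-1) 0 (by simp)
    have h4 := congrArg (fun x => (mappingCone.inl F).v 0 (-1) (by simp) ≫ x ≫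
      (mappingCone.snd G).v 0 0 (add_zero 0)) h1
    simp only [Category.assoc] at h4
    have h5 : F.f 0 ≫ (mappingCone.inr F).f 0 =
        (mappingCone.inl F).v 0 (-1) (by simp) ≫ (mappingCone F).d (-1) 0 := by
      rw [h2]
      simp
    rw [h3, ← reassoc_of% h5] at h4
    simp only [CochainComplex.singleFunctor_obj_d, comp_zero, add_zero] at h4
    rw [hb0, ha0]
    simpa only [Category.assoc] using h4.symm
  refine ⟨a, b, ?_, ?_⟩
  · apply (CochainComplex.singleFunctor C 0).map_injective
    apply HomologicalComplex.from_single_hom_ext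
    simp only [Functor.map_comp]
    refine Eq.trans ?_ (w0.trans ?_)
    · exact congrArg (fun x => F.f 0 ≫ x) hb
    · exact congrArg (fun x => x ≫ G.f 0) ha.symm
  · exact mappingCone_ext (fun i hi => isZero_single_obj_X _ _ _ _ hi)
      (fun i hi => isZero_single_obj_X _ _ _ _ hi) (fun i hi => isZero_single_obj_X _ _ _ _ hi)
      (fun i hi => isZero_single_obj_X _ _ _ _ hi)
      (hb.symm.trans (inr_map_snd _ _).symm) (ha.symm.trans (inl_map_fst _ _ _ _).symm)

/-- Every morphism between two-term complexes is given by a commutative square. -/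
theorem exists_map (φ : twoTerm f ⟶ twoTerm g) :
    ∃ (a : P ⟶ P') (b : Q ⟶ Q') (w : f ≫ b = a ≫ g), φ = map a b w := by
  obtain ⟨φ', h⟩ := (qt C).map_surjective (X := cx f) (Y := cx g) φ
  obtain ⟨a, b, w, rfl⟩ := exists_chain_map φ'
  exact ⟨a, b, w, h.symm⟩

open CochainComplex HomologicalComplex HomComplex in
theorem map_eq_zero_of_homotopy (a : P ⟶ P') (b : Q ⟶ Q') (w : f ≫ b = a ≫ g) (s : Q ⟶ P')
    (ha : a = f ≫ s) (hb : b = s ≫ g) : map a b w = 0 := by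
  obtain ⟨H⟩ := mappingCone_map_homotopy (F := (CochainComplex.singleFunctor C 0).map f)
    (G := (CochainComplex.singleFunctor C 0).map g) ((CochainComplex.singleFunctor C 0).map s)
  subst ha hb
  refine Eq.trans (congrArg (qt C).map ?_)
    ((HomotopyCategory.eq_of_homotopy _ _ H).trans ((qt C).map_zero _ _))
  congr 1 <;> exact CategoryTheory.Functor.map_comp _ _ _

open CochainComplex HomologicalComplex in
theorem exists_homotopy_of_map_eq_zero (a : P ⟶ P') (b : Q ⟶ Q') (w : f ≫ b = a ≫ g)
    (h : map a b w = 0) : ∃ s : Q ⟶ P', a = f ≫ s ∧ b = s ≫ g := by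
  have H := HomotopyCategory.homotopyOfEq _ _ (h.trans ((qt C).map_zero _ _).symm)
  obtain ⟨s0, h1, h2⟩ := homotopy_components (fun i hi => isZero_single_obj_X _ _ _ _ hi)
      (fun i hi => isZero_single_obj_X _ _ _ _ hi) (fun i hi => isZero_single_obj_X _ _ _ _ hi)
      (fun i hi => isZero_single_obj_X _ _ _ _ hi) _ H
  let s : Q ⟶ P' := (singleObjXSelf (.up ℤ) 0 Q).inv ≫ s0 ≫ (singleObjXSelf (.up ℤ) 0 P').hom
  have hs : ((CochainComplex.singleFunctor C 0).map s).f 0 = s0 :=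
    (single_map_f_self (.up ℤ) 0 s).trans (conj_singleObjXSelf s0)
  refine ⟨s, ?_, ?_⟩
  · apply (CochainComplex.singleFunctor C 0).map_injective
    apply HomologicalComplex.from_single_hom_ext
    rw [CategoryTheory.Functor.map_comp]
    exact h1.trans (congrArg (fun x => _ ≫ x) hs.symm)
  · apply (CochainComplex.singleFunctor C 0).map_injective
    apply HomologicalComplex.from_single_hom_ext
    rw [CategoryTheory.Functor.map_comp]
    exact h2.trans (congrArg (fun x => x ≫ _) hs.symm)

/-- With `exists_map`, this describes the morphisms completely: squares modulo those with a
diagonal. The duality is defined on representing squares and is well defined because of this. -/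
theorem map_eq_zero_iff (a : P ⟶ P') (b : Q ⟶ Q') (w : f ≫ b = a ≫ g) :
    map a b w = 0 ↔ ∃ s : Q ⟶ P', a = f ≫ s ∧ b = s ≫ g :=
  ⟨exists_homotopy_of_map_eq_zero a b w, fun ⟨s, ha, hb⟩ => map_eq_zero_of_homotopy a b w s ha hb⟩

end twoTerm
end TwoTermComplexes

/-! ### Vanishing of morphisms, thick subcategories and approximations in a triangulated category.
-/

section Triangulated

variable {C : Type u} [Category.{v} C] [Preadditive C] [HasShift C ℤ]

/-- Every morphism `X ⟶ Y⟦i⟧` vanishes. -/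
def HomVanish (X Y : C) (i : ℤ) : Prop := ∀ f : X ⟶ Y⟦i⟧, f = 0

namespace HomVanish

theorem of_retract {X X' Y Y' : C} {i : ℤ} (h : HomVanish X Y i) (e : Retract X' X)
    (e' : Retract Y' Y) : HomVanish X' Y' i := fun f => by
  have h0 := h (e.r ≫ f ≫ e'.i⟦i⟧')
  have h1 : f = e.i ≫ (e.r ≫ f ≫ e'.i⟦i⟧') ≫ e'.r⟦i⟧' := by
    simp [← Functor.map_comp]
  rw [h1, h0]
  simp

variable [HasZeroObject C] [∀ n : ℤ, (shiftFunctor C n).Additive]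

theorem zero_iff {X Y : C} : HomVanish X Y 0 ↔ ∀ f : X ⟶ Y, f = 0 := by
  have e : Y⟦(0 : ℤ)⟧ ≅ Y := (shiftFunctorZero C ℤ).app Y
  constructor
  · intro h f
    have := h (f ≫ e.inv)
    rw [← Category.comp_id f, ← e.inv_hom_id, ← Category.assoc, this, zero_comp]
  · intro h f
    have := h (f ≫ e.hom)
    rw [← Category.comp_id f, ← e.hom_inv_id, ← Category.assoc, this, zero_comp]

theorem shift_right_iff {X Y : C} {a i j : ℤ} (hj : a + i = j) :
    HomVanish X (Y⟦a⟧) i ↔ HomVanish X Y j := by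
  have e : Y⟦j⟧ ≅ (Y⟦a⟧)⟦i⟧ := (shiftFunctorAdd' C a i j hj).app Y
  constructor
  · intro h f
    have := h (f ≫ e.hom)
    rw [← Category.comp_id f, ← e.hom_inv_id, ← Category.assoc, this, zero_comp]
  · intro h f
    have := h (f ≫ e.inv)
    rw [← Category.comp_id f, ← e.inv_hom_id, ← Category.assoc, this, zero_comp]

theorem shift_left_iff {X Y : C} {a i j : ℤ} (hj : j + a = i) :
    HomVanish (X⟦a⟧) Y i ↔ HomVanish X Y j := by
  have e : Y⟦i⟧ ≅ (Y⟦j⟧)⟦a⟧ := (shiftFunctorAdd' C j a i hj).app Y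
  constructor
  · intro h f
    have := h (f⟦a⟧' ≫ e.inv)
    have h2 : f⟦a⟧' = 0 := by
      rw [← Category.comp_id (f⟦a⟧'), ← e.inv_hom_id, ← Category.assoc, this, zero_comp]
    exact (shiftFunctor C a).map_injective (by rw [h2, Functor.map_zero])
  · intro h f
    obtain ⟨g, hg⟩ := (shiftFunctor C a).map_surjective (f ≫ e.hom)
    rw [h g, Functor.map_zero] at hg
    rw [← Category.comp_id f, ← e.hom_inv_id, ← Category.assoc, ← hg, zero_comp]

variable [Pretriangulated C]

section

variable {X₁ X₂ X₃ Y : C} {f : X₁ ⟶ X₂} {g : X₂ ⟶ X₃} {h : X₃ ⟶ X₁⟦(1 : ℤ)⟧}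

/-- This and the five lemmas after it are pieces of the long exact sequences of `Hom(-, Y)` and
`Hom(Y, -)`: a term with vanishing neighbours vanishes. -/
theorem src_ext₂ (H : Triangle.mk f g h ∈ distTriang C) {i : ℤ} (h1 : HomVanish X₁ Y i)
    (h3 : HomVanish X₃ Y i) : HomVanish X₂ Y i := fun φ => by
  obtain ⟨ψ, hψ⟩ := Triangle.yoneda_exact₂ _ H φ (h1 _)
  rw [hψ, h3 ψ]
  exact comp_zero

theorem src_ext₃ (H : Triangle.mk f g h ∈ distTriang C) {i j : ℤ} (hj : j + 1 = i)
    (h1 : HomVanish X₁ Y j) (h2 : HomVanish X₂ Y i) : HomVanish X₃ Y i := fun φ => by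
  obtain ⟨ψ, hψ⟩ := Triangle.yoneda_exact₃ _ H φ (h2 _)
  rw [hψ, (shift_left_iff hj).2 h1 ψ]
  exact comp_zero

theorem src_ext₁ (H : Triangle.mk f g h ∈ distTriang C) {i j : ℤ} (hj : i + 1 = j)
    (h2 : HomVanish X₂ Y i) (h3 : HomVanish X₃ Y j) : HomVanish X₁ Y i := by
  rw [← shift_left_iff (a := 1) hj]
  exact src_ext₂ (rot_of_distTriang _ (rot_of_distTriang _ H)) h3 ((shift_left_iff hj).2 h2)

theorem tgt_ext₂ (H : Triangle.mk f g h ∈ distTriang C) {i : ℤ} (h1 : HomVanish Y X₁ i)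
    (h3 : HomVanish Y X₃ i) : HomVanish Y X₂ i := by
  rw [← shift_left_iff (a := -i) (add_neg_cancel i), zero_iff] at h1 h3 ⊢
  intro φ
  obtain ⟨ψ, hψ⟩ := Triangle.coyoneda_exact₂ _ H φ (h3 _)
  rw [hψ, h1 ψ]
  exact zero_comp

theorem tgt_ext₃ (H : Triangle.mk f g h ∈ distTriang C) {i j : ℤ} (hj : i + 1 = j)
    (h1 : HomVanish Y X₁ j) (h2 : HomVanish Y X₂ i) : HomVanish Y X₃ i :=
  tgt_ext₂ (rot_of_distTriang _ H) h2 ((shift_right_iff ((add_comm 1 i).trans hj)).2 h1)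

theorem tgt_ext₁ (H : Triangle.mk f g h ∈ distTriang C) {i j : ℤ} (hj : j + 1 = i)
    (h2 : HomVanish Y X₂ i) (h3 : HomVanish Y X₃ j) : HomVanish Y X₁ i := by
  rw [← shift_right_iff (a := 1) (i := j) (by lia)]
  exact tgt_ext₂ (rot_of_distTriang _ (rot_of_distTriang _ H)) h3
    ((shift_right_iff (by lia)).2 h2)

end

theorem tgt_biproduct {Y M : C} {i : ℤ} {n : ℕ} (h : HomVanish Y M i) :
    HomVanish Y (⨁ fun _ : Fin n => M) i := fun φ => by
  have h1 : φ = φ ≫ (𝟙 (⨁ fun _ : Fin n => M))⟦i⟧' := by simp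
  rw [h1, ← biproduct.total, Functor.map_sum, Preadditive.comp_sum]
  refine Finset.sum_eq_zero fun k _ => ?_
  rw [Functor.map_comp, ← Category.assoc, h (φ ≫ _), zero_comp]

theorem src_biproduct {Y M : C} {i : ℤ} {n : ℕ} (h : HomVanish M Y i) :
    HomVanish (⨁ fun _ : Fin n => M) Y i := fun φ => by
  rw [← Category.id_comp φ, ← biproduct.total, Preadditive.sum_comp]
  refine Finset.sum_eq_zero fun k _ => ?_
  rw [Category.assoc, h (_ ≫ φ), comp_zero]

theorem src_biprod {X X' Y : C} {i : ℤ} (h : HomVanish X Y i) (h' : HomVanish X' Y i) :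
    HomVanish (X ⊞ X') Y i := fun φ => by
  rw [← Category.id_comp φ, ← biprod.total, Preadditive.add_comp, Category.assoc, h (_ ≫ φ),
    Category.assoc, h' (_ ≫ φ), comp_zero, comp_zero, add_zero]

theorem tgt_biprod {X X' Y : C} {i : ℤ} (h : HomVanish Y X i) (h' : HomVanish Y X' i) :
    HomVanish Y (X ⊞ X') i := fun φ => by
  have h1 : φ = φ ≫ (𝟙 (X ⊞ X'))⟦i⟧' := by simp
  rw [h1, ← biprod.total, Functor.map_add, Preadditive.comp_add, Functor.map_comp,
    Functor.map_comp, ← Category.assoc, h (φ ≫ _), ← Category.assoc, h' (φ ≫ _), zero_comp,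
    zero_comp, add_zero]

end HomVanish

section

variable [HasZeroObject C] [∀ n : ℤ, (shiftFunctor C n).Additive] [Pretriangulated C]

/-- An identity between morphisms is easier to carry through additive functors, and through the
duality, than a biproduct. -/
theorem inAdd_iff {M X : C} : InAdd M X ↔ ∃ (n : ℕ) (i : Fin n → (X ⟶ M)) (p : Fin n → (M ⟶ X)),
    ∑ k, i k ≫ p k = 𝟙 X := by
  constructor
  · rintro ⟨n, ⟨e⟩⟩
    refine ⟨n, fun k => e.i ≫ biproduct.π _ k, fun k => biproduct.ι (fun _ => M) k ≫ e.r, ?_⟩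
    have h : ∀ k, (e.i ≫ biproduct.π (fun _ : Fin n => M) k) ≫ biproduct.ι (fun _ => M) k ≫ e.r =
        e.i ≫ (biproduct.π (fun _ : Fin n => M) k ≫ biproduct.ι (fun _ => M) k) ≫ e.r := by
      intro k
      simp only [Category.assoc]
    simp only [h]
    rw [← Preadditive.comp_sum, ← Preadditive.sum_comp, biproduct.total, Category.id_comp,
      e.retract]
  · rintro ⟨n, i, p, h⟩
    exact ⟨n, ⟨⟨biproduct.lift i, biproduct.desc p, by rw [biproduct.lift_desc, h]⟩⟩⟩

theorem InAdd.of_iso {M M' X X' : C} (h : InAdd M X) (e : M ≅ M') (e' : X ≅ X') : InAdd M' X' := by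
  rw [inAdd_iff] at h ⊢
  obtain ⟨n, i, p, h⟩ := h
  refine ⟨n, fun k => e'.inv ≫ i k ≫ e.hom, fun k => e.inv ≫ p k ≫ e'.hom, ?_⟩
  have h1 : ∀ k, (e'.inv ≫ i k ≫ e.hom) ≫ e.inv ≫ p k ≫ e'.hom =
      e'.inv ≫ (i k ≫ p k) ≫ e'.hom := by simp
  simp only [h1]
  rw [← Preadditive.comp_sum, ← Preadditive.sum_comp, h]
  simp

/-- Induction principle for the thick subcategory generated by an object. -/
theorem thick_induction {T : C} {p : C → Prop} (base : p T)
    (shift : ∀ (X : C) (n : ℤ), p X → p (X⟦n⟧))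
    (retract : ∀ (X Y : C), Retract X Y → p Y → p X)
    (ext : ∀ (X Y Z : C) (f : X ⟶ Y) (g : Y ⟶ Z) (h : Z ⟶ X⟦(1 : ℤ)⟧),
      Triangle.mk f g h ∈ distTriang C → p X → p Z → p Y) {X : C} (hX : thick T X) : p X := by
  let Q : ObjectProperty C := p
  have hret : Q.IsStableUnderRetracts := ⟨fun e h => retract _ _ e h⟩
  have hsh : Q.IsStableUnderShift ℤ := ⟨fun a => ⟨fun X h => shift X a h⟩⟩
  have h2 : Q.IsTriangulatedClosed₂ := ObjectProperty.IsTriangulatedClosed₂.mk' fun t ht h1 h3 =>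
    ext _ _ _ t.mor₁ t.mor₂ t.mor₃ ht h1 h3
  have h0 : Q.ContainsZero := ⟨⟨_, isZero_zero C, retract _ T ⟨0, 0, (isZero_zero C).eq_of_src _ _⟩ base⟩⟩
  have htr : Q.IsTriangulated := {}
  refine (ObjectProperty.triangEnvelope_le_iff (Q := Q) _).2 ?_ X hX
  rintro _ ⟨_⟩
  exact base

theorem thick_self (T : C) : thick T T :=
  ObjectProperty.le_triangEnvelope _ _ ⟨⟨⟩⟩

theorem thick_shift {T X : C} (n : ℤ) (h : thick T X) : thick T (X⟦n⟧) :=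
  (ObjectProperty.triangEnvelope (ObjectProperty.singleton T)).le_shift n _ h

theorem thick_retract {T X Y : C} (e : Retract X Y) (h : thick T Y) : thick T X :=
  ObjectProperty.prop_of_retract _ e h

theorem thick_isZero {T X : C} (h : IsZero X) : thick T X :=
  thick_retract ⟨0, 0, h.eq_of_src _ _⟩ (thick_self T)

section

variable [IsTriangulated C] {T X Y Z : C} {f : X ⟶ Y} {g : Y ⟶ Z} {h : Z ⟶ X⟦(1 : ℤ)⟧}

theorem thick_ext₂ (H : Triangle.mk f g h ∈ distTriang C) (h1 : thick T X) (h3 : thick T Z) : thick T Y :=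
  ObjectProperty.ext_of_isTriangulatedClosed₂ _ _ H h1 h3

theorem thick_ext₁ (H : Triangle.mk f g h ∈ distTriang C) (h2 : thick T Y) (h3 : thick T Z) : thick T X :=
  ObjectProperty.ext_of_isTriangulatedClosed₁ _ _ H h2 h3

theorem thick_ext₃ (H : Triangle.mk f g h ∈ distTriang C) (h1 : thick T X) (h2 : thick T Y) : thick T Z :=
  ObjectProperty.ext_of_isTriangulatedClosed₃ _ _ H h1 h2

end

variable [IsTriangulated C]

theorem thick_trans {S T X : C} (h : thick S T) (hX : thick T X) : thick S X :=
  thick_induction h (fun _ n hX => thick_shift n hX) (fun _ _ e h => thick_retract e h)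
    (fun _ _ _ _ _ _ H h1 h3 => thick_ext₂ H h1 h3) hX

theorem thick_biprod {T X Y : C} (hX : thick T X) (hY : thick T Y) : thick T (X ⊞ Y) :=
  thick_ext₂ (binaryBiproductTriangle_distinguished X Y) hX hY

theorem thick_biproduct {T X : C} (hX : thick T X) (n : ℕ) :
    thick T (⨁ fun _ : Fin n => X) := by
  induction n with
  | zero =>
    refine thick_isZero ?_
    rw [IsZero.iff_id_eq_zero]
    ext k
    exact k.elim0
  | succ n ih =>
    refine thick_retract ⟨biprod.lift (biproduct.lift fun k : Fin n => biproduct.π _ k.succ)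
      (biproduct.π _ 0), biprod.desc (biproduct.desc fun k : Fin n =>
        biproduct.ι (fun _ : Fin (n + 1) => X) k.succ)
      (biproduct.ι (fun _ : Fin (n + 1) => X) 0), ?_⟩ (thick_biprod ih hX)
    rw [biprod.lift_desc, biproduct.lift_desc, ← biproduct.total, Fin.sum_univ_succ]
    exact add_comm _ _

theorem thick_inAdd {T X Y : C} (hX : thick T X) (h : InAdd X Y) : thick T Y := by
  obtain ⟨n, ⟨e⟩⟩ := h
  exact thick_retract e (thick_biproduct hX n)

/-- Objects of the thick subcategory of `M` are bounded above relatively to `M`. -/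
theorem exists_bound_of_mem_thick {M X : C} (hX : thick M X) :
    ∃ N : ℤ, ∀ Y : C, SiltGE M Y → ∀ i, N ≤ i → HomVanish X Y i := by
  -- The bound is uniform in `Y`, so that one bound later serves all the iterated cocones of
  -- approximations at once.
  refine thick_induction (p := fun X => ∃ N : ℤ, ∀ Y : C, SiltGE M Y →
    ∀ i, N ≤ i → HomVanish X Y i) ⟨1, fun Y hY i hi => hY i (by lia)⟩ ?_ ?_ ?_ hX
  · rintro X n ⟨N, h⟩
    refine ⟨N + n, fun Y hY i hi => ?_⟩
    rw [HomVanish.shift_left_iff (sub_add_cancel i n)]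
    exact h Y hY _ (by lia)
  · rintro X Y e ⟨N, h⟩
    exact ⟨N, fun Z hZ i hi => (h Z hZ i hi).of_retract e (.refl _)⟩
  · rintro X Y Z f g k H ⟨N, h⟩ ⟨N', h'⟩
    exact ⟨max N N', fun W hW i hi => HomVanish.src_ext₂ H (h W hW i (by lia))
      (h' W hW i (by lia))⟩

/-- `M` has right approximations of the objects of its thick subcategory. -/
def HasApprox (M : C) : Prop :=
  ∀ Z, thick M Z → ∃ (n : ℕ) (φ : (⨁ fun _ : Fin n => M) ⟶ Z), ∀ g : M ⟶ Z, ∃ h, h ≫ φ = g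

/-- The cocone of a right approximation. -/
theorem exists_approx_triangle {M : C} {Z : C} (hM : SiltGE M M)
    (ha : ∃ (n : ℕ) (φ : (⨁ fun _ : Fin n => M) ⟶ Z), ∀ g : M ⟶ Z, ∃ h, h ≫ φ = g)
    (hge : SiltGE M Z) :
    ∃ (Z' : C) (n : ℕ) (f : Z' ⟶ (⨁ fun _ : Fin n => M)) (φ : (⨁ fun _ : Fin n => M) ⟶ Z)
      (h : Z ⟶ Z'⟦(1 : ℤ)⟧), Triangle.mk f φ h ∈ distTriang C ∧ SiltGE M Z' := by
  obtain ⟨n, φ, hφ⟩ := ha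
  obtain ⟨Z', f, h, H⟩ := distinguished_cocone_triangle₁ φ
  refine ⟨Z', n, f, φ, h, H, fun i hi => ?_⟩
  -- Only degree one uses the approximation: a morphism `M ⟶ Z'⟦1⟧` comes from some `M ⟶ Z`, which
  -- factors through `φ` and so dies in `Z'⟦1⟧`. Higher degrees follow from the long exact sequence.
  by_cases hi1 : i = 1
  · subst hi1
    intro ψ
    obtain ⟨ψ', hψ'⟩ := Triangle.coyoneda_exact₁ _ H ψ
      (HomVanish.tgt_biproduct (hM 1 (by lia)) _)
    obtain ⟨k, rfl⟩ := hφ ψ'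
    rw [hψ']
    have h0 : φ ≫ h = 0 := comp_distTriang_mor_zero₂₃ _ H
    show (k ≫ φ) ≫ h = 0
    rw [Category.assoc, h0, comp_zero]
  · exact HomVanish.tgt_ext₁ H (sub_add_cancel i 1) (HomVanish.tgt_biproduct (hM i hi))
      (hge _ (by lia))

/-- Dimension shifting: replacing a target `Z` by the cocone `Z'` of an approximation moves `Hom(U,
Z⟦i⟧)` to `Hom(U, Z'⟦i+1⟧)`, because `U ≥ M`. Past the bound of `exists_bound_of_mem_thick`
everything vanishes, so the approximation of `U` itself splits. -/
theorem inAdd_of_mem_thick {M U : C} (hM : SiltGE M M) (ha : HasApprox M) (hU : thick M U)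
    (h1 : SiltGE M U) (h2 : SiltGE U M) : InAdd M U := by
  obtain ⟨N, hN⟩ := exists_bound_of_mem_thick hU
  have key : ∀ (k : ℕ) (Z : C), thick M Z → SiltGE M Z → ∀ i : ℤ, 1 ≤ i → N - k ≤ i →
      HomVanish U Z i := by
    intro k
    induction k with
    | zero =>
      intro Z hZ hge i _ hi
      exact hN Z hge i (by simpa using hi)
    | succ k ih =>
      intro Z hZ hge i hi1 hi
      obtain ⟨Z', n, f, φ, h, H, hge'⟩ := exists_approx_triangle hM (ha Z hZ) hge
      refine HomVanish.tgt_ext₃ H rfl (ih Z' ?_ hge' _ (by lia) (by push_cast at hi; lia))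
        (HomVanish.tgt_biproduct (h2 i (by lia)))
      exact thick_ext₁ H (thick_biproduct (thick_self M) n) hZ
  obtain ⟨U', n, f, φ, h, H, hge'⟩ := exists_approx_triangle hM (ha U hU) h1
  -- With `N.toNat` shifts the range of `key` reaches down to degree one, where the connecting
  -- morphism lives.
  have h0 : h = 0 := key (N.toNat) U' (thick_ext₁ H (thick_biproduct (thick_self M) n) hU) hge' 1
    le_rfl (by lia) h
  obtain ⟨s, hs⟩ := Triangle.coyoneda_exact₃ _ H (𝟙 U) (by
    show 𝟙 U ≫ h = 0
    rw [h0, comp_zero])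
  exact ⟨n, ⟨⟨s, φ, hs.symm⟩⟩⟩

end

end Triangulated

/-! ### Finite-dimensional morphism spaces and the existence of approximations. -/

section HomFinite

theorem finiteDimensional_of_exact {K V₁ V₂ V₃ : Type*} [Field K] [AddCommGroup V₁] [Module K V₁]
    [AddCommGroup V₂] [Module K V₂] [AddCommGroup V₃] [Module K V₃] [FiniteDimensional K V₁]
    [FiniteDimensional K V₃] (f : V₁ →ₗ[K] V₂) (g : V₂ →ₗ[K] V₃)
    (h : ∀ x, g x = 0 → ∃ y, f y = x) : FiniteDimensional K V₂ := by
  have : FiniteDimensional K (LinearMap.ker g) :=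
    Submodule.finiteDimensional_of_le (S₂ := LinearMap.range f) (fun x hx => h x hx)
  have : FiniteDimensional K (V₂ ⧸ LinearMap.ker g) :=
    Module.Finite.equiv g.quotKerEquivRange.symm
  exact Module.Finite.of_submodule_quotient (LinearMap.ker g)

variable (K : Type w) [Field K] {C : Type u} [Category.{v} C] [Preadditive C] [Linear K C]
  [HasShift C ℤ] [HasZeroObject C] [∀ n : ℤ, (shiftFunctor C n).Additive]
  [∀ n : ℤ, (shiftFunctor C n).Linear K] [Pretriangulated C]

/-- All the spaces of morphisms from `X` to shifts of `Y` are finite-dimensional. -/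
def HomFin (X Y : C) : Prop := ∀ i : ℤ, FiniteDimensional K (X ⟶ Y⟦i⟧)

variable {K}

namespace HomFin

theorem of_retract {X X' Y Y' : C} (h : HomFin K X Y) (e : Retract X' X) (e' : Retract Y' Y) :
    HomFin K X' Y' := fun i => by
  have := h i
  refine Module.Finite.of_surjective
    (Linear.leftComp K (Y'⟦i⟧) e.i ∘ₗ Linear.rightComp K X (e'.r⟦i⟧')) fun f => ?_
  refine ⟨e.r ≫ f ≫ e'.i⟦i⟧', ?_⟩
  simp [← Functor.map_comp]

theorem shift_right {X Y : C} (h : HomFin K X Y) (a : ℤ) : HomFin K X (Y⟦a⟧) := fun i => by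
  have := h (a + i)
  let e : Y⟦a + i⟧ ≅ (Y⟦a⟧)⟦i⟧ := (shiftFunctorAdd' C a i _ rfl).app Y
  exact Module.Finite.of_surjective (Linear.rightComp K X e.hom) fun f => ⟨f ≫ e.inv, by simp⟩

theorem shift_left {X Y : C} (h : HomFin K X Y) (a : ℤ) : HomFin K (X⟦a⟧) Y := fun i => by
  have := h (i - a)
  let e : Y⟦i⟧ ≅ (Y⟦i - a⟧)⟦a⟧ := (shiftFunctorAdd' C (i - a) a i (by lia)).app Y
  refine Module.Finite.of_surjective
    (Linear.rightComp K (X⟦a⟧) e.inv ∘ₗ (shiftFunctor C a).mapLinearMap K) fun f => ?_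
  obtain ⟨g, hg⟩ := (shiftFunctor C a).map_surjective (f ≫ e.hom)
  refine ⟨g, ?_⟩
  simp [hg]

theorem src_ext₂ {X₁ X₂ X₃ Y : C} {f : X₁ ⟶ X₂} {g : X₂ ⟶ X₃} {h : X₃ ⟶ X₁⟦(1 : ℤ)⟧}
    (H : Triangle.mk f g h ∈ distTriang C) (h1 : HomFin K X₁ Y) (h3 : HomFin K X₃ Y) :
    HomFin K X₂ Y := fun i => by
  have := h1 i
  have := h3 i
  refine finiteDimensional_of_exact (Linear.leftComp K (Y⟦i⟧) g) (Linear.leftComp K (Y⟦i⟧) f)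
    fun x hx => ?_
  obtain ⟨y, hy⟩ := Triangle.yoneda_exact₂ _ H x hx
  exact ⟨y, hy.symm⟩

theorem tgt_ext₂ {X₁ X₂ X₃ Y : C} {f : X₁ ⟶ X₂} {g : X₂ ⟶ X₃} {h : X₃ ⟶ X₁⟦(1 : ℤ)⟧}
    (H : Triangle.mk f g h ∈ distTriang C) (h1 : HomFin K Y X₁) (h3 : HomFin K Y X₃) :
    HomFin K Y X₂ := fun i => by
  have := h1 i
  have := h3 i
  have H' := Triangle.shift_distinguished _ H i
  refine finiteDimensional_of_exact (Linear.rightComp K Y (i.negOnePow • f⟦i⟧'))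
    (Linear.rightComp K Y (i.negOnePow • g⟦i⟧')) fun x hx => ?_
  obtain ⟨y, hy⟩ := Triangle.coyoneda_exact₂ _ H' x hx
  exact ⟨y, hy.symm⟩

variable [IsTriangulated C]

theorem of_mem_thick {M X Y : C} (h : HomFin K M M) (hX : thick M X) (hY : thick M Y) :
    HomFin K X Y := by
  have h1 : HomFin K M Y := thick_induction (p := fun Y => HomFin K M Y) h
    (fun Y n hY => hY.shift_right n) (fun _ _ e h => h.of_retract (.refl _) e)
    (fun _ _ _ _ _ _ H h1 h3 => tgt_ext₂ H h1 h3) hY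
  exact thick_induction (p := fun X => HomFin K X Y) h1
    (fun Y n hY => hY.shift_left n) (fun _ _ e h => h.of_retract e (.refl _))
    (fun _ _ _ _ _ _ H h1 h3 => src_ext₂ H h1 h3) hX

end HomFin

/-- The approximation is a basis of `M ⟶ Z` assembled into one morphism; coordinates give the
factorizations. -/
theorem exists_approx_of_finite {M Z : C} (h : HomFin K M Z) :
    ∃ (n : ℕ) (φ : (⨁ fun _ : Fin n => M) ⟶ Z), ∀ g : M ⟶ Z, ∃ h, h ≫ φ = g := by
  have : FiniteDimensional K (M ⟶ Z) := by
    have := h 0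
    exact Module.Finite.of_surjective (Linear.rightComp K M ((shiftFunctorZero C ℤ).hom.app Z))
      fun f => ⟨f ≫ (shiftFunctorZero C ℤ).inv.app Z, by simp⟩
  let b := Module.finBasis K (M ⟶ Z)
  refine ⟨_, biproduct.desc fun k => b k, fun g => ⟨biproduct.lift fun k => b.repr g k • 𝟙 M, ?_⟩⟩
  rw [biproduct.lift_desc]
  conv_rhs => rw [← b.sum_repr g]
  exact Finset.sum_congr rfl fun k _ => by rw [Linear.smul_comp, Category.id_comp]

theorem exists_coapprox_of_finite {M Z : C} (h : HomFin K M Z) :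
    ∃ (n : ℕ) (φ : M ⟶ (⨁ fun _ : Fin n => Z)), ∀ g : M ⟶ Z, ∃ h, φ ≫ h = g := by
  have : FiniteDimensional K (M ⟶ Z) := by
    have := h 0
    exact Module.Finite.of_surjective (Linear.rightComp K M ((shiftFunctorZero C ℤ).hom.app Z))
      fun f => ⟨f ≫ (shiftFunctorZero C ℤ).inv.app Z, by simp⟩
  let b := Module.finBasis K (M ⟶ Z)
  refine ⟨_, biproduct.lift fun k => b k, fun g => ⟨biproduct.desc fun k => b.repr g k • 𝟙 Z, ?_⟩⟩
  rw [biproduct.lift_desc]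
  conv_rhs => rw [← b.sum_repr g]
  exact Finset.sum_congr rfl fun k _ => by rw [Linear.comp_smul, Category.comp_id]

end HomFinite

/-! ### Finitely generated projective modules. -/

section FGProj

variable {R : Type u} [Ring R]

/-- Finitely generated projective modules. -/
def FGProj (X : ModuleCat.{u} R) : Prop := Module.Finite R X ∧ Module.Projective R X

theorem FGProj.of_sum {X : ModuleCat.{u} R} {n : ℕ} (i : Fin n → (X ⟶ ModuleCat.of R R))
    (p : Fin n → (ModuleCat.of R R ⟶ X)) (h : ∑ k, i k ≫ p k = 𝟙 X) : FGProj X := by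
  let s : X →ₗ[R] (Fin n → R) := LinearMap.pi fun k => (i k).hom
  let r : (Fin n → R) →ₗ[R] X := ∑ k, (p k).hom ∘ₗ LinearMap.proj k
  have hrs : r ∘ₗ s = LinearMap.id := by
    ext x
    have := congrArg (fun φ : X ⟶ X => φ.hom x) h
    simpa [r, s, ModuleCat.hom_sum] using this
  refine ⟨Module.Finite.of_surjective r fun x => ⟨s x, congrArg (fun φ => φ x) hrs⟩,
    Module.Projective.of_split s r hrs⟩

theorem FGProj.exists_sum {X : ModuleCat.{u} R} (h : FGProj X) :
    ∃ (n : ℕ) (i : Fin n → (X ⟶ ModuleCat.of R R)) (p : Fin n → (ModuleCat.of R R ⟶ X)),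
      ∑ k, i k ≫ p k = 𝟙 X := by
  obtain ⟨h1, h2⟩ := h
  obtain ⟨n, f, hf⟩ := Module.Finite.exists_fin' R X
  obtain ⟨s, hs⟩ := Module.projective_lifting_property f LinearMap.id hf
  refine ⟨n, fun k => ModuleCat.ofHom (LinearMap.proj k ∘ₗ s),
    fun k => ModuleCat.ofHom (f ∘ₗ LinearMap.single R (fun _ => R) k), ?_⟩
  ext x
  have h3 : f (s x) = x := congrArg (fun φ => φ x) hs
  simp only [ModuleCat.hom_sum, ModuleCat.hom_comp, LinearMap.sum_apply]
  conv_rhs => rw [ModuleCat.id_apply, ← h3]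
  conv_rhs => rw [← Finset.univ_sum_single (s x), map_sum]
  rfl

theorem FGProj.retract {X Y : ModuleCat.{u} R} (h : FGProj X) (e : Retract Y X) : FGProj Y := by
  obtain ⟨n, i, p, h⟩ := h.exists_sum
  refine .of_sum (fun k => e.i ≫ i k) (fun k => p k ≫ e.r) ?_
  have h1 : ∀ k, (e.i ≫ i k) ≫ p k ≫ e.r = e.i ≫ (i k ≫ p k) ≫ e.r := by simp
  simp only [h1]
  rw [← Preadditive.comp_sum, ← Preadditive.sum_comp, h]
  simp

theorem FGProj.of_isZero {X : ModuleCat.{u} R} (h : IsZero X) : FGProj X :=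
  .of_sum (n := 0) (fun k => k.elim0) (fun k => k.elim0) (h.eq_of_src _ _)

theorem FGProj.of_total {X Y Z : ModuleCat.{u} R} (hX : FGProj X) (hY : FGProj Y) (i₁ : Z ⟶ X)
    (p₁ : X ⟶ Z) (i₂ : Z ⟶ Y) (p₂ : Y ⟶ Z) (h : i₁ ≫ p₁ + i₂ ≫ p₂ = 𝟙 Z) : FGProj Z := by
  obtain ⟨_, _⟩ := hX
  obtain ⟨_, _⟩ := hY
  have h' : (p₁.hom.coprod p₂.hom) ∘ₗ (i₁.hom.prod i₂.hom) = LinearMap.id := by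
    ext z
    exact congrArg (fun φ : Z ⟶ Z => φ.hom z) h
  exact ⟨Module.Finite.of_surjective (p₁.hom.coprod p₂.hom)
      fun z => ⟨_, congrArg (fun φ => φ z) h'⟩,
    Module.Projective.of_split _ _ h'⟩

theorem FGProj.self : FGProj (ModuleCat.of R R) :=
  .of_sum (n := 1) (fun _ => 𝟙 _) (fun _ => 𝟙 _) (by simp)

/-- Lifting along epimorphisms. -/
theorem FGProj.lift {X Y Z : ModuleCat.{u} R} (h : FGProj X) (f : X ⟶ Z) (g : Y ⟶ Z)
    (hg : Function.Surjective g.hom) : ∃ k : X ⟶ Y, k ≫ g = f := by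
  have := h.2
  obtain ⟨s, hs⟩ := Module.projective_lifting_property g.hom f.hom hg
  exact ⟨ModuleCat.ofHom s, ModuleCat.hom_ext hs⟩

end FGProj

/-! ### Perfect complexes, and the recognition of two-term ones. -/

section Perfect

open HoSingle

variable {A : Type u} [Ring A]

theorem stalk_inAdd {X : ModuleCat.{u} Aᵐᵒᵖ} (h : FGProj X) : InAdd (regularObj A) (stalk X) := by
  obtain ⟨n, i, p, h⟩ := h.exists_sum
  -- The free module of rank one over `Aᵐᵒᵖ` and the right module `A` are different objects; `e`
  -- passes between them.
  let e : ModuleCat.of Aᵐᵒᵖ Aᵐᵒᵖ ≅ ModuleCat.of Aᵐᵒᵖ A :=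
    (MulOpposite.opLinearEquiv Aᵐᵒᵖ (M := A)).symm.toModuleIso
  rw [inAdd_iff]
  refine ⟨n, fun k => (st _).map (i k ≫ e.hom), fun k => (st _).map (e.inv ≫ p k), ?_⟩
  simp only [← Functor.map_comp, Category.assoc, Iso.hom_inv_id_assoc]
  rw [← Functor.map_sum, h]
  exact (st _).map_id _

theorem stalk_mem_thick {X : ModuleCat.{u} Aᵐᵒᵖ} (h : FGProj X) :
    thick (regularObj A) (stalk X) := thick_inAdd (thick_self _) (stalk_inAdd h)

-- The term of highest degree is a subcomplex with degreewise split quotient, so brutal truncation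
-- yields a distinguished triangle.
open HomologicalComplex in
theorem exists_splitOff {R : Type u} [Ring R] (K : CochainComplex (ModuleCat.{u} R) ℤ) (b : ℤ)
    (hb : ∀ i, b < i → IsZero (K.X i)) (hK : ∀ i, FGProj (K.X i)) :
    ∃ (K' : CochainComplex (ModuleCat.{u} R) ℤ)
      (f : (qt _).obj ((single _ (.up ℤ) b).obj (K.X b)) ⟶ (qt _).obj K)
      (g : (qt _).obj K ⟶ (qt _).obj K')
      (h : (qt _).obj K' ⟶ ((qt _).obj ((single _ (.up ℤ) b).obj (K.X b)))⟦(1 : ℤ)⟧),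
      Triangle.mk f g h ∈ distTriang (HomotopyCategory (ModuleCat.{u} R) (ComplexShape.up ℤ)) ∧
      (∀ i, FGProj (K'.X i)) ∧ (∀ i, IsZero (K.X i) → IsZero (K'.X i)) ∧ IsZero (K'.X b) := by
  let p : (single _ (.up ℤ) b).obj (K.X b) ⟶ K :=
    mkHomFromSingle (𝟙 _) fun k hk => (hb k (by simp at hk; lia)).eq_of_tgt _ _
  have hpb : p.f b = (singleObjXSelf (.up ℤ) b (K.X b)).hom := by
    simp only [p, mkHomFromSingle_f]
    exact Category.comp_id _
  have hr : ∀ n, ∃ r, p.f n ≫ r = 𝟙 _ := by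
    intro n
    by_cases hn : n = b
    · subst hn
      exact ⟨(singleObjXSelf (.up ℤ) n (K.X n)).inv, by rw [hpb, Iso.hom_inv_id]⟩
    · exact ⟨0, (isZero_single_obj_X _ _ _ _ hn).eq_of_src _ _⟩
  choose r hr using hr
  have hm : ∀ n, Mono (p.f n) := fun n => mono_of_mono_fac (hr n)
  have : Mono p := mono_of_mono_f _ hm
  let S : ShortComplex (CochainComplex (ModuleCat.{u} R) ℤ) := .mk p (cokernel.π p) (by simp)
  have hS : S.ShortExact := ShortComplex.ShortExact.mk' (ShortComplex.exact_cokernel p)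
    ‹_› inferInstance
  have hS' : ∀ n, (S.map (eval _ _ n)).ShortExact := fun n => hS.map_of_exact (eval _ _ n)
  let σ : ∀ n, (S.map (eval _ _ n)).Splitting := fun n =>
    .ofExactOfRetraction _ (hS' n).exact (r n) (hr n) (hS' n).epi_g
  refine ⟨cokernel p, (qt _).map p, (qt _).map (cokernel.π p),
    (CochainComplex.trianglehOfDegreewiseSplit S σ).mor₃, ?_, ?_, ?_, ?_⟩
  · exact (HomotopyCategory.distinguished_iff_iso_trianglehOfDegreewiseSplit _).2
      ⟨S, σ, ⟨Iso.refl _⟩⟩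
  · exact fun i => (hK i).retract ⟨(σ i).s, (cokernel.π p).f i, (σ i).s_g⟩
  · intro i hi
    rw [IsZero.iff_id_eq_zero]
    refine (σ i).s_g.symm.trans ?_
    rw [hi.eq_of_tgt (σ i).s 0]
    exact zero_comp
  · rw [IsZero.iff_id_eq_zero]
    refine (σ b).s_g.symm.trans ?_
    have h1 : (S.map (eval _ _ b)).f ≫ (S.map (eval _ _ b)).g = 0 := (S.map (eval _ _ b)).zero
    have h2 : (S.map (eval _ _ b)).f = (singleObjXSelf (.up ℤ) b (K.X b)).hom := hpb
    have h3 : IsIso (S.map (eval _ _ b)).f := by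
      rw [h2]
      exact Iso.isIso_hom (singleObjXSelf (.up ℤ) b (K.X b))
    rw [(cancel_epi (S.map (eval _ _ b)).f).1 (h1.trans comp_zero.symm)]
    exact comp_zero

/-- Bounded complexes of finitely generated projective modules are built from `A`. -/
theorem complex_mem_thick (n : ℕ) (a : ℤ) (K : CochainComplex (ModuleCat.{u} Aᵐᵒᵖ) ℤ)
    (h0 : ∀ i, i < a ∨ a + n ≤ i → IsZero (K.X i)) (hK : ∀ i, FGProj (K.X i)) :
    thick (regularObj A) ((qt _).obj K) := by
  induction n generalizing K with
  | zero =>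
    refine thick_isZero ?_
    refine (qt _).map_isZero ?_
    rw [IsZero.iff_id_eq_zero]
    ext i : 1
    exact (h0 i (by push_cast; lia)).eq_of_src _ _
  | succ n ih =>
    obtain ⟨K', f, g, h, H, h1, h2, h3⟩ := exists_splitOff K (a + n)
      (fun i hi => h0 i (by push_cast; lia)) hK
    refine thick_ext₂ H ?_ (ih K' (fun i hi => ?_) h1)
    · have e := ((HomotopyCategory.singleFunctors (ModuleCat.{u} Aᵐᵒᵖ)).shiftIso
        (-(a + n)) (a + n) 0 (by lia)).app (K.X (a + n))
      exact thick_retract (.ofIso e.symm) (thick_shift _ (stalk_mem_thick (hK _)))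
    · by_cases hi' : i = a + n
      · rw [hi']
        exact h3
      · exact h2 i (h0 i (by push_cast; lia))

theorem isPerfect_le_thick : IsPerfect ≤ thick (regularObj A) := by
  rintro X ⟨K, ⟨a, b, h0⟩, hK, ⟨e⟩⟩
  refine thick_retract (.ofIso e) (complex_mem_thick (b - a + 1).toNat a K (fun i hi => ?_) hK)
  exact h0 i (by lia)

theorem FGProj.single {R : Type u} [Ring R] {X : ModuleCat.{u} R} (h : FGProj X) (i : ℤ) :
    FGProj (((CochainComplex.singleFunctor _ 0).obj X).X i) := by
  by_cases hi : i = 0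
  · subst hi
    exact h.retract (.ofIso (HomologicalComplex.singleObjXSelf (.up ℤ) 0 X))
  · exact .of_isZero (HomologicalComplex.isZero_single_obj_X _ _ _ _ hi)

theorem isPerfect_twoTerm {P Q : ModuleCat.{u} Aᵐᵒᵖ} (hP : FGProj P) (hQ : FGProj Q) (f : P ⟶ Q) :
    IsPerfect (twoTerm f : HoCat A) :=
  ⟨twoTerm.cx f, ⟨-1, 0, fun _ hi => twoTerm.isZero_X f (by lia) (by lia)⟩,
    fun i => (hP.single (i + 1)).of_total (hQ.single i) _ _ _ _
      (CochainComplex.mappingCone.id_X _ i (i + 1) rfl), ⟨Iso.refl _⟩⟩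

theorem regularObj_ge_regularObj : SiltGE (regularObj A) (regularObj A) := fun _ hi f =>
  hom_st_st_shift_eq_zero hi.ne' f

/-- The stalk functor is fully faithful, so the idempotent cutting out `L` comes from an idempotent
of `N`, which splits among modules. -/
theorem exists_iso_stalk {R : Type u} [Ring R] {N : ModuleCat.{u} R}
    {L : HomotopyCategory (ModuleCat.{u} R) (ComplexShape.up ℤ)}
    (e : Retract L ((st _).obj N)) :
    ∃ (Y : ModuleCat.{u} R) (_ : Retract Y N), Nonempty (L ≅ (st _).obj Y) := by
  obtain ⟨p, hp⟩ := (st (ModuleCat.{u} R)).map_surjective (e.r ≫ e.i)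
  have hpp : p ≫ p = p := by
    apply (st (ModuleCat.{u} R)).map_injective
    rw [Functor.map_comp, hp, Category.assoc, e.retract_assoc]
  obtain ⟨Y, i, r, h1, h2⟩ := IsIdempotentComplete.idempotents_split N p hpp
  refine ⟨Y, ⟨i, r, h1⟩, ⟨⟨e.i ≫ (st _).map r, (st _).map i ≫ e.r, ?_, ?_⟩⟩⟩
  · rw [Category.assoc, ← (st _).map_comp_assoc, h2, hp, Category.assoc, e.retract,
      Category.comp_id, e.retract]
  · have h3 : i ≫ (r ≫ i) ≫ r = 𝟙 Y := by rw [Category.assoc, h1, Category.comp_id, h1]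
    rw [Category.assoc, ← Category.assoc e.r, ← hp, ← h2, ← Functor.map_comp, ← Functor.map_comp, h3]
    exact (st _).map_id _

theorem biproduct_stalk_iso {R : Type u} [Ring R] (M : ModuleCat.{u} R) (n : ℕ) :
    Nonempty ((⨁ fun _ : Fin n => (st _).obj M) ≅ (st _).obj (⨁ fun _ : Fin n => M)) :=
  ⟨((st (ModuleCat.{u} R)).mapBiproduct fun _ : Fin n => M).symm⟩

theorem FGProj.biproduct {R : Type u} [Ring R] {M : ModuleCat.{u} R} (h : FGProj M) (n : ℕ) :
    FGProj (⨁ fun _ : Fin n => M) := by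
  induction n with
  | zero =>
    refine FGProj.of_isZero ?_
    rw [IsZero.iff_id_eq_zero]
    ext k
    exact k.elim0
  | succ n ih =>
    refine FGProj.of_total ih h (biproduct.lift fun k : Fin n => biproduct.π _ k.succ)
      (biproduct.desc fun k : Fin n => biproduct.ι (fun _ : Fin (n + 1) => M) k.succ)
      (biproduct.π _ 0) (biproduct.ι (fun _ : Fin (n + 1) => M) 0) ?_
    rw [biproduct.lift_desc, ← biproduct.total, Fin.sum_univ_succ]
    exact add_comm _ _

theorem fgProj_regular : FGProj (ModuleCat.of Aᵐᵒᵖ A) :=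
  FGProj.self.retract (.ofIso
    (MulOpposite.opLinearEquiv Aᵐᵒᵖ (M := A)).toModuleIso)

theorem finiteDimensional_of_injective {K V W : Type*} [Field K] [AddCommGroup V] [Module K V]
    [AddCommGroup W] [Module K W] [FiniteDimensional K W] (f : V →+ W)
    (hs : ∀ (c : K) (v : V), f (c • v) = c • f v) (hf : Function.Injective f) :
    FiniteDimensional K V :=
  Module.Finite.of_injective ({ f with map_smul' := hs } : V →ₗ[K] W) hf

theorem finiteDimensional_of_surjective {K V W : Type*} [Field K] [AddCommGroup V] [Module K V]
    [AddCommGroup W] [Module K W] [FiniteDimensional K V] (f : V →+ W)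
    (hs : ∀ (c : K) (v : V), f (c • v) = c • f v) (hf : Function.Surjective f) :
    FiniteDimensional K W :=
  Module.Finite.of_surjective ({ f with map_smul' := hs } : V →ₗ[K] W) hf

-- Endomorphisms of the regular module embed into `A` by evaluation at `1`, and there are no nonzero
-- morphisms into nonzero shifts.
open scoped ModuleCat.Algebra in
theorem homFin_regularObj (K : Type w) [Field K] [Algebra K A] [FiniteDimensional K A] :
    HomFin K (regularObj A) (regularObj A) := by
  have h0 : @Module.Finite K (ModuleCat.of Aᵐᵒᵖ A ⟶ ModuleCat.of Aᵐᵒᵖ A) _ _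
      (Linear.homModule _ _) := by
    refine @finiteDimensional_of_injective K (ModuleCat.of Aᵐᵒᵖ A ⟶ ModuleCat.of Aᵐᵒᵖ A) A _ _
      (Linear.homModule _ _) _ _ _
      { toFun := fun f => f.hom (1 : A), map_zero' := rfl, map_add' := fun f g => rfl } ?_ ?_
    · intro c f
      change (MulOpposite.op (algebraMap K A c)) • (f.hom (1 : A)) = c • (f.hom (1 : A) : A)
      rw [Algebra.smul_def, Algebra.commutes]
      rfl
    · intro f g hfg
      refine ModuleCat.hom_ext (LinearMap.ext fun (x : A) => ?_)
      have h1 : ∀ k : ModuleCat.of Aᵐᵒᵖ A ⟶ ModuleCat.of Aᵐᵒᵖ A,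
          k.hom x = (MulOpposite.op x) • (k.hom (1 : A)) := fun k => by
        rw [← map_smul]
        exact congrArg _ (one_mul x).symm
      rw [h1 f, h1 g]
      exact congrArg _ hfg
  intro i
  by_cases hi : i = 0
  · subst hi
    obtain ⟨e⟩ : Nonempty ((st (ModuleCat.{u} Aᵐᵒᵖ)).obj (ModuleCat.of Aᵐᵒᵖ A) ≅
        (regularObj A)⟦(0 : ℤ)⟧) := ⟨((shiftFunctorZero (HoCat A) ℤ).app _).symm⟩
    refine @finiteDimensional_of_surjective K (ModuleCat.of Aᵐᵒᵖ A ⟶ ModuleCat.of Aᵐᵒᵖ A)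
      (regularObj A ⟶ (regularObj A)⟦(0 : ℤ)⟧) _ _ (Linear.homModule _ _) _ _ h0
      { toFun := fun f => (st _).map f ≫ e.hom
        map_zero' := ?_
        map_add' := fun f g => ?_ } (fun c f => ?_) fun f => ?_
    · rw [CategoryTheory.Functor.map_zero, zero_comp]
    · rw [CategoryTheory.Functor.map_add, Preadditive.add_comp]
    · refine Eq.trans ?_ (Linear.smul_comp _ _ _ c ((st (ModuleCat.{u} Aᵐᵒᵖ)).map f) e.hom)
      exact congrArg (fun φ => φ ≫ _) ((st (ModuleCat.{u} Aᵐᵒᵖ)).map_smul c f)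
    · obtain ⟨g, hg⟩ := (st (ModuleCat.{u} Aᵐᵒᵖ)).map_surjective
        (f ≫ e.inv)
      refine ⟨g, ?_⟩
      change (st _).map g ≫ _ = _
      rw [hg, Category.assoc, Iso.inv_hom_id, Category.comp_id]
  · have : Subsingleton (regularObj A ⟶ (regularObj A)⟦i⟧) :=
      ⟨fun f g => (hom_st_st_shift_eq_zero hi f).trans (hom_st_st_shift_eq_zero hi g).symm⟩
    infer_instance

/-- Let `L` be the cocone of a right `A`-approximation of `X`. The approximation gives `A ≥ L`, and
`X ≥ A[1]` gives `L ≥ A`, so `L` is in `add A` and `X` is the cone of a morphism of stalks. -/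
theorem exists_iso_twoTerm (hA : HasApprox (regularObj A)) {X : HoCat A}
    (hX : thick (regularObj A) X) (h1 : SiltGE (regularObj A) X)
    (h2 : SiltGE X ((regularObj A)⟦(1 : ℤ)⟧)) :
    ∃ (P Q : ModuleCat.{u} Aᵐᵒᵖ) (f : P ⟶ Q), FGProj P ∧ FGProj Q ∧
      Nonempty (X ≅ twoTerm f) := by
  obtain ⟨L, n, f, φ, h, H, hL⟩ := exists_approx_triangle regularObj_ge_regularObj (hA X hX) h1
  have hLt : thick (regularObj A) L := thick_ext₁ H (thick_biproduct (thick_self _) n) hX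
  have hL' : InAdd (regularObj A) L := by
    refine inAdd_of_mem_thick regularObj_ge_regularObj hA hLt hL fun i hi => ?_
    refine HomVanish.src_ext₁ H rfl
      (HomVanish.src_biproduct (regularObj_ge_regularObj i hi)) ?_
    exact (HomVanish.shift_right_iff (add_comm 1 i)).1 (h2 i hi)
  obtain ⟨m, ⟨e⟩⟩ := hL'
  obtain ⟨P, e', ⟨eP⟩⟩ := exists_iso_stalk (e.trans (.ofIso (biproduct_stalk_iso _ m).some))
  let eQ := (biproduct_stalk_iso (ModuleCat.of Aᵐᵒᵖ A) n).some
  obtain ⟨g, hg⟩ := (st (ModuleCat.{u} Aᵐᵒᵖ)).map_surjective (eP.inv ≫ f ≫ eQ.hom)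
  refine ⟨P, _, g, (fgProj_regular.biproduct m).retract e', fgProj_regular.biproduct n, ⟨?_⟩⟩
  exact Triangle.π₃.mapIso (isoTriangleOfIso₁₂ _ _ H (twoTerm.distinguished g) eP eQ
    (by
      change f ≫ eQ.hom = eP.hom ≫ (st _).map g
      rw [hg, Iso.hom_inv_id_assoc]))

end Perfect

/-! ### Factorizations across the connecting morphism of a triangle. -/

section Triangle

variable {C : Type u} [Category.{v} C] [Preadditive C] [HasShift C ℤ] [HasZeroObject C]
  [∀ n : ℤ, (shiftFunctor C n).Additive] [Pretriangulated C] {X Y Z W : C} {f : X ⟶ Y} {g : Y ⟶ Z}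
  {h : Z ⟶ X⟦(1 : ℤ)⟧}

theorem exists_factor_of_shift_comp_eq_zero (H : Triangle.mk f g h ∈ distTriang C) (φ : X ⟶ W)
    (h0 : h ≫ φ⟦(1 : ℤ)⟧' = 0) : ∃ ψ : Y ⟶ W, φ = f ≫ ψ := by
  obtain ⟨ψ, hψ⟩ := Triangle.yoneda_exact₃ _ (rot_of_distTriang _ H) _ h0
  obtain ⟨ψ', rfl⟩ := (shiftFunctor C (1 : ℤ)).map_surjective (X := Y) ψ
  refine ⟨-ψ', (shiftFunctor C (1 : ℤ)).map_injective (hψ.trans ?_)⟩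
  rw [Functor.map_comp, Functor.map_neg, Preadditive.comp_neg]
  exact Preadditive.neg_comp _ _

theorem exists_shift_of_comp_eq_zero (H : Triangle.mk f g h ∈ distTriang C) (χ : Z ⟶ W⟦(1 : ℤ)⟧)
    (h0 : g ≫ χ = 0) : ∃ φ : X ⟶ W, χ = h ≫ φ⟦(1 : ℤ)⟧' := by
  obtain ⟨ψ, hψ⟩ := Triangle.yoneda_exact₃ _ H χ h0
  obtain ⟨ψ', rfl⟩ := (shiftFunctor C (1 : ℤ)).map_surjective (X := X) ψ
  exact ⟨ψ', hψ⟩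

theorem shift_comp_eq_zero (H : Triangle.mk f g h ∈ distTriang C) (ψ : Y ⟶ W) :
    h ≫ (f ≫ ψ)⟦(1 : ℤ)⟧' = 0 := by
  have h2 : h ≫ f⟦(1 : ℤ)⟧' = 0 := comp_distTriang_mor_zero₃₁ _ H
  rw [Functor.map_comp, reassoc_of% h2, zero_comp]

end Triangle

/-! ### The silting order on two-term complexes, and generation as maximality. -/

section SiltOrder

open HoSingle

variable {R : Type u} [Ring R] {P Q P' Q' : ModuleCat.{u} R} (f : P ⟶ Q) (g : P' ⟶ Q')

/-- The morphisms from a stalk to a two-term complex come from the degree zero term. -/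
theorem exists_comp_inr {X : ModuleCat.{u} R} (φ : (st _).obj X ⟶ twoTerm g) :
    ∃ h : X ⟶ Q', φ = (st _).map h ≫ twoTerm.inr g := by
  obtain ⟨ψ, hψ⟩ := Triangle.coyoneda_exact₃ _ (twoTerm.distinguished g) φ
    (hom_st_st_shift_eq_zero one_ne_zero _)
  obtain ⟨h, hh⟩ := (st (ModuleCat.{u} R)).map_surjective ψ
  exact ⟨h, hψ.trans (congrArg (fun x => x ≫ twoTerm.inr g) hh.symm)⟩

theorem comp_inr_eq_zero_iff {X : ModuleCat.{u} R} (h : X ⟶ Q') :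
    (st _).map h ≫ twoTerm.inr g = 0 ↔ ∃ α : X ⟶ P', h = α ≫ g := by
  constructor
  · intro h0
    obtain ⟨ψ, hψ⟩ := Triangle.coyoneda_exact₂ _ (twoTerm.distinguished g) ((st _).map h) h0
    obtain ⟨α, hα⟩ := (st (ModuleCat.{u} R)).map_surjective ψ
    refine ⟨α, (st (ModuleCat.{u} R)).map_injective ?_⟩
    rw [CategoryTheory.Functor.map_comp, hα]
    exact hψ
  · rintro ⟨α, rfl⟩
    have h0 : (st _).map g ≫ twoTerm.inr g = 0 :=
      comp_distTriang_mor_zero₁₂ _ (twoTerm.distinguished g)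
    rw [CategoryTheory.Functor.map_comp, Category.assoc, h0, comp_zero]

theorem homVanish_st_twoTerm (X : ModuleCat.{u} R) {i : ℤ} (h1 : i ≠ -1) (h0 : i ≠ 0) :
    HomVanish ((st _).obj X) (twoTerm g) i := fun φ =>
  hom_st_shift_eq_zero (twoTerm.isZero_X g h1 h0) φ

theorem homVanish_twoTerm_st (X : ModuleCat.{u} R) {i : ℤ} (h1 : i ≠ 1) (h0 : i ≠ 0) :
    HomVanish (twoTerm g) ((st _).obj X) i := fun φ =>
  hom_shift_st_eq_zero (twoTerm.isZero_X g (by lia) (by lia)) φ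

/-- The silting order on two-term complexes. -/
theorem siltGE_twoTerm_iff : SiltGE (twoTerm f) (twoTerm g) ↔
    ∀ h : P ⟶ Q', ∃ (β : Q ⟶ Q') (α : P ⟶ P'), h = f ≫ β + α ≫ g := by
  constructor
  · intro H h
    -- Every morphism `twoTerm f ⟶ (twoTerm g)⟦1⟧` arises in this way from some `h : P ⟶ Q'`; it
    -- vanishes exactly when `h` has a decomposition as required.
    have h0 := H 1 (by lia) (twoTerm.δ f ≫ ((st _).map h ≫ twoTerm.inr g)⟦(1 : ℤ)⟧')
    obtain ⟨ψ, h1⟩ := exists_factor_of_shift_comp_eq_zero (twoTerm.distinguished f) _ h0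
    obtain ⟨β, rfl⟩ := exists_comp_inr g ψ
    obtain ⟨α, hα⟩ := (comp_inr_eq_zero_iff g (h - f ≫ β)).1 (by
      rw [CategoryTheory.Functor.map_sub, CategoryTheory.Functor.map_comp, Preadditive.sub_comp,
        h1, Category.assoc, sub_self])
    exact ⟨β, α, by rw [← hα, add_sub_cancel]⟩
  · intro H i hi
    by_cases hi1 : i = 1
    · subst hi1
      intro φ
      obtain ⟨ψ', rfl⟩ := exists_shift_of_comp_eq_zero (twoTerm.distinguished f) φ
        (homVanish_st_twoTerm g Q (by lia) (by lia) _)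
      obtain ⟨h, rfl⟩ := exists_comp_inr g ψ'
      obtain ⟨β, α, rfl⟩ := H h
      have h1 : (st _).map (α ≫ g) ≫ twoTerm.inr g = 0 := (comp_inr_eq_zero_iff g _).2 ⟨α, rfl⟩
      have h3 : (st _).map (f ≫ β + α ≫ g) ≫ twoTerm.inr g =
          (st _).map f ≫ (st _).map β ≫ twoTerm.inr g := by
        rw [CategoryTheory.Functor.map_add, Preadditive.add_comp, h1, add_zero,
          CategoryTheory.Functor.map_comp, Category.assoc]
      rw [h3]
      exact shift_comp_eq_zero (twoTerm.distinguished f) _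
    · exact HomVanish.src_ext₃ (twoTerm.distinguished f) (sub_add_cancel i 1)
        (homVanish_st_twoTerm g P (by lia) (by lia)) (homVanish_st_twoTerm g Q (by lia) (by lia))

variable {A : Type u} [Ring A] {P Q : ModuleCat.{u} Aᵐᵒᵖ} (f : P ⟶ Q)

theorem regularObj_ge_twoTerm : SiltGE (regularObj A) (twoTerm f) := fun _ hi =>
  homVanish_st_twoTerm f _ (by lia) (by lia)

theorem twoTerm_ge_regularObj_shift : SiltGE (twoTerm f) ((regularObj A)⟦(1 : ℤ)⟧) := fun _ hi =>
  (HomVanish.shift_right_iff rfl).2 (homVanish_twoTerm_st f _ (by lia) (by lia))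

variable {f}

theorem twoTerm_mem_thick (hP : FGProj P) (hQ : FGProj Q) : thick (regularObj A) (twoTerm f) :=
  isPerfect_le_thick _ (isPerfect_twoTerm hP hQ f)

/-- A two-term presilting complex generates if and only if it is maximal. -/
theorem isPerfect_le_thick_twoTerm_iff (hA : HasApprox (regularObj A))
    (ha : HasApprox (twoTerm f : HoCat A)) (hP : FGProj P) (hQ : FGProj Q)
    (hf : SiltGE (twoTerm f) (twoTerm f))
    (ha' : ∃ (n : ℕ) (φ : (⨁ fun _ : Fin n => (twoTerm f : HoCat A)) ⟶ (regularObj A)⟦(1 : ℤ)⟧),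
      ∀ g : twoTerm f ⟶ (regularObj A)⟦(1 : ℤ)⟧, ∃ h, h ≫ φ = g) :
    IsPerfect ≤ thick (twoTerm f : HoCat A) ↔
      ∀ (P' Q' : ModuleCat.{u} Aᵐᵒᵖ) (g : P' ⟶ Q'), FGProj P' → FGProj Q' →
        SiltGE (twoTerm f) (twoTerm g) → SiltGE (twoTerm g) (twoTerm f) →
        InAdd (twoTerm f : HoCat A) (twoTerm g) := by
  constructor
  · intro H P' Q' g hP' hQ' h1 h2
    exact inAdd_of_mem_thick hf ha (H _ (isPerfect_twoTerm hP' hQ' g)) h1 h2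
  · intro H X hX
    -- A Bongartz-type completion: the cocone `U` of an approximation of `A[1]` is two-term and
    -- compatible with `twoTerm f` in both directions. Maximality puts `U` in `add (twoTerm f)`, and
    -- the triangle then puts `A[1]` in the thick subcategory.
    obtain ⟨U, n, φ₁, φ₂, φ₃, hT, hU⟩ := exists_approx_triangle hf ha'
      (twoTerm_ge_regularObj_shift f)
    have hΛ : thick (regularObj A) ((regularObj A)⟦(1 : ℤ)⟧) := thick_shift _ (thick_self _)
    have hU1 : thick (regularObj A) U :=
      thick_ext₁ hT (thick_biproduct (twoTerm_mem_thick hP hQ) n) hΛ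
    have hU2 : SiltGE (regularObj A) U := by
      intro i hi
      refine HomVanish.tgt_ext₁ hT (sub_add_cancel i 1)
        (HomVanish.tgt_biproduct (regularObj_ge_twoTerm f i hi)) ?_
      exact (HomVanish.shift_right_iff (add_sub_cancel _ _)).2 (regularObj_ge_regularObj i hi)
    have hU3 : SiltGE U ((regularObj A)⟦(1 : ℤ)⟧) := by
      intro i hi
      refine HomVanish.src_ext₁ hT rfl
        (HomVanish.src_biproduct (twoTerm_ge_regularObj_shift f i hi)) ?_
      rw [HomVanish.shift_left_iff rfl, HomVanish.shift_right_iff rfl]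
      exact regularObj_ge_regularObj _ (by lia)
    have hU4 : SiltGE U (twoTerm f) := by
      intro i hi
      refine HomVanish.src_ext₁ hT rfl (HomVanish.src_biproduct (hf i hi)) ?_
      rw [HomVanish.shift_left_iff rfl]
      exact regularObj_ge_twoTerm f i hi
    obtain ⟨P', Q', g, hP', hQ', ⟨e⟩⟩ := exists_iso_twoTerm hA hU1 hU2 hU3
    have hU5 : InAdd (twoTerm f : HoCat A) U := (H P' Q' g hP' hQ' (hU.of_iso (Iso.refl _) e)
      (hU4.of_iso e (Iso.refl _))).of_iso (Iso.refl _) e.symm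
    have h1 : thick (twoTerm f : HoCat A) ((regularObj A)⟦(1 : ℤ)⟧) :=
      thick_ext₃ hT (thick_inAdd (thick_self _) hU5) (thick_biproduct (thick_self _) n)
    have h2 : thick (twoTerm f : HoCat A) (regularObj A) :=
      thick_retract (.ofIso (shiftShiftNeg (regularObj A) (1 : ℤ)).symm) (thick_shift (-1) h1)
    exact thick_trans h2 (isPerfect_le_thick _ hX)

end SiltOrder

section

variable {A : Type u} [Ring A]

theorem FGProj.exists_sum_regular {X : ModuleCat.{u} Aᵐᵒᵖ} (h : FGProj X) :
    ∃ (n : ℕ) (i : Fin n → (X ⟶ ModuleCat.of Aᵐᵒᵖ A)) (p : Fin n → (ModuleCat.of Aᵐᵒᵖ A ⟶ X)),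
      ∑ k, i k ≫ p k = 𝟙 X := by
  obtain ⟨n, i, p, h⟩ := h.exists_sum
  let e : ModuleCat.of Aᵐᵒᵖ Aᵐᵒᵖ ≅ ModuleCat.of Aᵐᵒᵖ A :=
    (MulOpposite.opLinearEquiv Aᵐᵒᵖ (M := A)).symm.toModuleIso
  refine ⟨n, fun k => i k ≫ e.hom, fun k => e.inv ≫ p k, ?_⟩
  simp only [Category.assoc, Iso.hom_inv_id_assoc]
  exact h

theorem FGProj.of_sum_regular {X : ModuleCat.{u} Aᵐᵒᵖ} {n : ℕ}
    (i : Fin n → (X ⟶ ModuleCat.of Aᵐᵒᵖ A)) (p : Fin n → (ModuleCat.of Aᵐᵒᵖ A ⟶ X))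
    (h : ∑ k, i k ≫ p k = 𝟙 X) : FGProj X := by
  let e : ModuleCat.of Aᵐᵒᵖ Aᵐᵒᵖ ≅ ModuleCat.of Aᵐᵒᵖ A :=
    (MulOpposite.opLinearEquiv Aᵐᵒᵖ (M := A)).symm.toModuleIso
  refine FGProj.of_sum (fun k => i k ≫ e.inv) (fun k => e.hom ≫ p k) ?_
  simp only [Category.assoc, Iso.inv_hom_id_assoc]
  exact h

end

/-! ### The duality on right modules defined by an involution of the algebra. -/

section Duality

variable {A : Type u} [Ring A] [StarRing A]

/-- The module `Hom(X, A)`, made a right module by means of the involution of `A`. -/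
def StarDual (A : Type u) [Ring A] (X : ModuleCat.{u} Aᵐᵒᵖ) : Type u := X →ₗ[Aᵐᵒᵖ] A

namespace StarDual

instance (X : ModuleCat.{u} Aᵐᵒᵖ) : AddCommGroup (StarDual A X) :=
  inferInstanceAs (AddCommGroup (X →ₗ[Aᵐᵒᵖ] A))

/-- Evaluation of an element of the dual. -/
def app {X : ModuleCat.{u} Aᵐᵒᵖ} (φ : StarDual A X) : X →ₗ[Aᵐᵒᵖ] A := φ

@[ext]
theorem ext {X : ModuleCat.{u} Aᵐᵒᵖ} {φ ψ : StarDual A X} (h : ∀ x, app φ x = app ψ x) : φ = ψ :=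
  LinearMap.ext h

theorem app_op_smul {X : ModuleCat.{u} Aᵐᵒᵖ} (φ : StarDual A X) (a : Aᵐᵒᵖ) (x : X) :
    app φ (a • x) = app φ x * a.unop := (app φ).map_smul a x

@[simp]
theorem app_add {X : ModuleCat.{u} Aᵐᵒᵖ} (φ ψ : StarDual A X) (x : X) :
    app (φ + ψ) x = app φ x + app ψ x := rfl

@[simp]
theorem app_zero {X : ModuleCat.{u} Aᵐᵒᵖ} (x : X) :
    app (0 : StarDual A X) x = 0 := rfl

instance (X : ModuleCat.{u} Aᵐᵒᵖ) : SMul Aᵐᵒᵖ (StarDual A X) where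
  smul a φ :=
    { toFun := fun x => star a.unop * app φ x
      map_add' := fun x y => by rw [map_add, mul_add]
      map_smul' := fun b x => by
        rw [app_op_smul, ← mul_assoc]
        rfl }

@[simp]
theorem app_smul {X : ModuleCat.{u} Aᵐᵒᵖ} (a : Aᵐᵒᵖ) (φ : StarDual A X) (x : X) :
    app (a • φ) x = star a.unop * app φ x := rfl

instance (X : ModuleCat.{u} Aᵐᵒᵖ) : Module Aᵐᵒᵖ (StarDual A X) where
  one_smul φ := by ext x; simp
  mul_smul a b φ := by ext x; simp [mul_assoc]
  smul_zero a := by ext x; simp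
  smul_add a φ ψ := by ext x; simp [mul_add]
  add_smul a b φ := by ext x; simp [add_mul]
  zero_smul φ := by ext x; simp

/-- The dual as an object of the category of modules. -/
def obj (X : ModuleCat.{u} Aᵐᵒᵖ) : ModuleCat.{u} Aᵐᵒᵖ := ModuleCat.of Aᵐᵒᵖ (StarDual A X)

variable {X Y Z : ModuleCat.{u} Aᵐᵒᵖ}

/-- The transpose of a morphism. -/
def map (f : X ⟶ Y) : obj Y ⟶ obj X :=
  ModuleCat.ofHom (X := StarDual A Y) (Y := StarDual A X)
    { toFun := fun φ => (app φ ∘ₗ f.hom : X →ₗ[Aᵐᵒᵖ] A)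
      map_add' := fun _ _ => rfl
      map_smul' := fun _ _ => rfl }

theorem hom_ext {f g : Y ⟶ obj X}
    (h : ∀ (y : Y) (x : X), app (f.hom y : StarDual A X) x = app (g.hom y : StarDual A X) x) :
    f = g :=
  ModuleCat.hom_ext (LinearMap.ext fun y => StarDual.ext fun x => h y x)

theorem map_comp (f : X ⟶ Y) (g : Y ⟶ Z) : map (f ≫ g) = map g ≫ map f := rfl

theorem map_id : map (𝟙 X) = 𝟙 (obj X) := rfl

theorem map_add (f g : X ⟶ Y) : map (f + g) = map f + map g :=
  hom_ext fun φ x => (app (φ : StarDual A Y)).map_add (f.hom x) (g.hom x)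

/-- Duality as an additive map on morphisms. -/
def mapHom (X Y : ModuleCat.{u} Aᵐᵒᵖ) : (X ⟶ Y) →+ (obj Y ⟶ obj X) := AddMonoidHom.mk' map map_add

/-- The evaluation morphism into the double dual. -/
def ev (X : ModuleCat.{u} Aᵐᵒᵖ) : X ⟶ obj (obj X) :=
  ModuleCat.ofHom (Y := StarDual A (obj X))
    { toFun := fun x =>
        ({toFun := fun (φ : StarDual A X) => star (app φ x)
          map_add' := fun φ ψ => by rw [app_add, star_add]
          map_smul' := fun a φ => by
            rw [app_smul, star_mul, star_star]
            rfl } : StarDual A X →ₗ[Aᵐᵒᵖ] A)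
      map_add' := fun x y => StarDual.ext (X := obj X) fun (φ : StarDual A X) => by
        change star (app φ (x + y)) = star (app φ x) + star (app φ y)
        rw [_root_.map_add, star_add]
      map_smul' := fun a x => StarDual.ext (X := obj X) fun (φ : StarDual A X) => by
        change star (app φ (a • x)) = star a.unop * star (app φ x)
        rw [app_op_smul, star_mul] }

theorem ev_naturality (f : X ⟶ Y) : f ≫ ev Y = ev X ≫ map (map f) := rfl

theorem ev_map_ev : ev (obj X) ≫ map (ev X) = 𝟙 (obj X) :=
  hom_ext fun φ x => star_star (app (φ : StarDual A X) x)

/-- The dual of the regular module. -/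
def regularIso : obj (ModuleCat.of Aᵐᵒᵖ A) ≅ ModuleCat.of Aᵐᵒᵖ A where
  hom := ModuleCat.ofHom (X := StarDual A (ModuleCat.of Aᵐᵒᵖ A)) (Y := A)
    { toFun := fun φ => star (app φ (1 : A))
      map_add' := fun φ ψ => by rw [app_add, star_add]
      map_smul' := fun a φ => by
        rw [app_smul, star_mul, star_star]
        rfl }
  inv := ModuleCat.ofHom (Y := StarDual A (ModuleCat.of Aᵐᵒᵖ A)) (X := A)
    { toFun := fun a => ({ toFun := fun x => star a * x
                           map_add' := fun x y => mul_add _ _ _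
                           map_smul' := fun b x => (mul_assoc _ _ _).symm } : A →ₗ[Aᵐᵒᵖ] A)
      map_add' := fun a b => StarDual.ext (X := ModuleCat.of Aᵐᵒᵖ A) fun (x : A) => by
        change star (a + b) * x = star a * x + star b * x
        rw [star_add, add_mul]
      map_smul' := fun b a => StarDual.ext (X := ModuleCat.of Aᵐᵒᵖ A) fun (x : A) => by
        change star (a * b.unop) * x = star b.unop * (star a * x)
        rw [star_mul, mul_assoc] }
  hom_inv_id := hom_ext fun φ (x : A) => by
    change star (star (app (φ : StarDual A _) (1 : A))) * x = app (φ : StarDual A _) x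
    rw [star_star]
    exact (app_op_smul (X := ModuleCat.of Aᵐᵒᵖ A) φ (MulOpposite.op x) (1 : A)).symm.trans
      (congrArg _ (one_mul x))
  inv_hom_id := ModuleCat.hom_ext (LinearMap.ext fun (a : A) => by
    change star (star a * 1) = a
    rw [mul_one, star_star])

theorem sum_map {n : ℕ} {i : Fin n → (X ⟶ Y)} {p : Fin n → (Y ⟶ X)} (h : ∑ k, i k ≫ p k = 𝟙 X) :
    ∑ k, map (p k) ≫ map (i k) = 𝟙 (obj X) :=
  ((map_sum (mapHom X X) _ _).symm.trans (congrArg (mapHom X X) h))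

theorem fgProj_obj (h : FGProj X) : FGProj (obj X) := by
  obtain ⟨n, i, p, h⟩ := h.exists_sum_regular
  refine FGProj.of_sum_regular (fun k => map (p k) ≫ regularIso.hom)
    (fun k => regularIso.inv ≫ map (i k)) ?_
  simp only [Category.assoc, Iso.hom_inv_id_assoc]
  exact sum_map h

theorem isIso_ev_regular : IsIso (ev (ModuleCat.of Aᵐᵒᵖ A)) := by
  have h : ev (ModuleCat.of Aᵐᵒᵖ A) = regularIso.inv ≫ map regularIso.hom := by
    refine hom_ext fun (a : A) (φ : StarDual A (ModuleCat.of Aᵐᵒᵖ A)) => ?_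
    change star (app φ a) = star a * star (app φ (1 : A))
    rw [← star_mul]
    exact congrArg star ((congrArg (app φ) (one_mul a).symm).trans
      (app_op_smul (X := ModuleCat.of Aᵐᵒᵖ A) φ (MulOpposite.op a) (1 : A)))
  have h2 : IsIso (map (regularIso (A := A)).hom) :=
    ⟨map regularIso.inv, by rw [← map_comp, Iso.inv_hom_id, map_id],
      by rw [← map_comp, Iso.hom_inv_id, map_id]⟩
  rw [h]
  infer_instance

/-- Evaluation is natural and invertible on the regular module, hence invertible on summands of its
finite sums; the inverse is assembled from the splitting of the identity of `X`. -/
theorem isIso_ev (h : FGProj X) : IsIso (ev X) := by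
  obtain ⟨n, i, p, h⟩ := h.exists_sum_regular
  have := isIso_ev_regular (A := A)
  let e := ev (ModuleCat.of Aᵐᵒᵖ A)
  refine ⟨∑ k, map (map (i k)) ≫ inv e ≫ p k, ?_, ?_⟩
  · rw [Preadditive.comp_sum, ← h]
    refine Finset.sum_congr rfl fun k _ => ?_
    rw [← Category.assoc, ← ev_naturality, Category.assoc, IsIso.hom_inv_id_assoc]
  · rw [Preadditive.sum_comp, ← sum_map (sum_map h)]
    refine Finset.sum_congr rfl fun k _ => ?_
    rw [Category.assoc, Category.assoc, ev_naturality, IsIso.inv_hom_id_assoc]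

/-- The preimage is the transpose of `ψ` conjugated by the evaluations; the identity `ev_map_ev`
shows that transposing again returns `ψ`. -/
theorem map_surjective (hY : FGProj Y) (ψ : obj Y ⟶ obj X) : ∃ f : X ⟶ Y, ψ = map f := by
  have := isIso_ev hY
  refine ⟨ev X ≫ map ψ ≫ inv (ev Y), ?_⟩
  have h1 : map (inv (ev Y)) = ev (obj Y) := by
    have h2 : map (inv (ev Y)) ≫ 𝟙 _ = map (inv (ev Y)) := Category.comp_id _
    have h3 : map (ev Y) ≫ map (inv (ev Y)) = 𝟙 _ := by
      rw [← map_comp, IsIso.inv_hom_id, map_id]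
    rw [← Category.id_comp (map (inv (ev Y))), ← ev_map_ev, Category.assoc, h3, Category.comp_id]
  rw [map_comp, map_comp, h1, Category.assoc, ← reassoc_of% (ev_naturality ψ), ev_map_ev,
    Category.comp_id]

end StarDual

end Duality

/-! ### The duality on two-term complexes. -/

namespace twoTerm

section

variable {C : Type u} [Category.{v} C] [Preadditive C] [HasZeroObject C] [HasBinaryBiproducts C]
  {P Q P' Q' : C} {f : P ⟶ Q} {g : P' ⟶ Q'}

theorem map_eq_map_iff {a a' : P ⟶ P'} {b b' : Q ⟶ Q'} (w : f ≫ b = a ≫ g)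
    (w' : f ≫ b' = a' ≫ g) :
    map a b w = map a' b' w' ↔ ∃ s : Q ⟶ P', a - a' = f ≫ s ∧ b - b' = s ≫ g := by
  have w'' : f ≫ (b - b') = (a - a') ≫ g := by
    rw [Preadditive.comp_sub, Preadditive.sub_comp, w, w']
  rw [← map_eq_zero_iff _ _ w'']
  have h := map_add (a - a') (b - b') w'' a' b' w'
  simp only [sub_add_cancel] at h
  rw [h, add_eq_right]

/-- A pair of inverse commutative squares. -/
def isoMk (a : P ≅ P') (b : Q ≅ Q') (w : f ≫ b.hom = a.hom ≫ g) : twoTerm f ≅ twoTerm g where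
  hom := map a.hom b.hom w
  inv := map a.inv b.inv (by rw [Iso.eq_inv_comp, ← reassoc_of% w, Iso.hom_inv_id, Category.comp_id])
  hom_inv_id := by
    rw [← map_comp, ← map_id]
    simp only [Iso.hom_inv_id]
  inv_hom_id := by
    rw [← map_comp, ← map_id]
    simp only [Iso.inv_hom_id]

end

variable {A : Type u} [Ring A] [StarRing A] {P Q P' Q' P'' Q'' : ModuleCat.{u} Aᵐᵒᵖ} {f : P ⟶ Q}
  {g : P' ⟶ Q'} {h : P'' ⟶ Q''}

theorem dual_w {a : P ⟶ P'} {b : Q ⟶ Q'} (w : f ≫ b = a ≫ g) :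
    StarDual.map g ≫ StarDual.map a = StarDual.map b ≫ StarDual.map f := by
  rw [← StarDual.map_comp, ← StarDual.map_comp, w]

/-- The action of the duality on morphisms of two-term complexes. -/
def dual (φ : twoTerm f ⟶ twoTerm g) : twoTerm (StarDual.map g) ⟶ twoTerm (StarDual.map f) :=
  map (StarDual.map (exists_map φ).choose_spec.choose) (StarDual.map (exists_map φ).choose)
    (dual_w (exists_map φ).choose_spec.choose_spec.choose)

/-- Independence of the chosen square: two squares of one morphism differ by a diagonal `s`, and
their transposes differ by the transpose of `s` up to sign. -/
theorem dual_map (a : P ⟶ P') (b : Q ⟶ Q') (w : f ≫ b = a ≫ g) :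
    dual (map a b w) = map (StarDual.map b) (StarDual.map a) (dual_w w) := by
  obtain ⟨s, hs1, hs2⟩ := (map_eq_map_iff _ _).1
    (exists_map (map a b w)).choose_spec.choose_spec.choose_spec
  refine ((map_eq_map_iff _ _).2 ⟨StarDual.map (-s), ?_, ?_⟩)
  · rw [← StarDual.map_comp, Preadditive.neg_comp, ← hs2, neg_sub]
    exact (map_sub (StarDual.mapHom Q Q') _ _).symm
  · rw [← StarDual.map_comp, Preadditive.comp_neg, ← hs1, neg_sub]
    exact (map_sub (StarDual.mapHom P P') _ _).symm

theorem dual_id : dual (𝟙 (twoTerm f)) = 𝟙 _ := by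
  rw [← map_id, dual_map]
  exact map_id

theorem dual_comp (φ : twoTerm f ⟶ twoTerm g) (ψ : twoTerm g ⟶ twoTerm h) :
    dual (φ ≫ ψ) = dual ψ ≫ dual φ := by
  obtain ⟨a, b, w, rfl⟩ := exists_map φ
  obtain ⟨a', b', w', rfl⟩ := exists_map ψ
  rw [← map_comp, dual_map, dual_map, dual_map, ← map_comp]
  rfl

theorem dual_add (φ ψ : twoTerm f ⟶ twoTerm g) : dual (φ + ψ) = dual φ + dual ψ := by
  obtain ⟨a, b, w, rfl⟩ := exists_map φ
  obtain ⟨a', b', w', rfl⟩ := exists_map ψ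
  rw [← map_add, dual_map, dual_map, dual_map, ← map_add]
  congr 1 <;> exact StarDual.map_add _ _

theorem dual_zero : dual (0 : twoTerm f ⟶ twoTerm g) = 0 := by
  have h := dual_add (0 : twoTerm f ⟶ twoTerm g) 0
  rwa [add_zero, left_eq_add] at h

theorem dual_sum {n : ℕ} (φ : Fin n → (twoTerm f ⟶ twoTerm g)) :
    dual (∑ k, φ k) = ∑ k, dual (φ k) :=
  map_sum (AddMonoidHom.mk' (dual (f := f) (g := g)) dual_add) _ _

/-- The action of the duality on isomorphisms. -/
def dualIso (e : twoTerm f ≅ twoTerm g) :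
    twoTerm (StarDual.map f) ≅ twoTerm (StarDual.map g) where
  hom := dual e.inv
  inv := dual e.hom
  hom_inv_id := by rw [← dual_comp, Iso.hom_inv_id, dual_id]
  inv_hom_id := by rw [← dual_comp, Iso.inv_hom_id, dual_id]

theorem nonempty_iso_dual_dual (hP : FGProj P) (hQ : FGProj Q) :
    Nonempty (twoTerm f ≅ twoTerm (StarDual.map (StarDual.map f))) := by
  have := StarDual.isIso_ev hP
  have := StarDual.isIso_ev hQ
  exact ⟨isoMk (asIso (StarDual.ev P)) (asIso (StarDual.ev Q)) (StarDual.ev_naturality f)⟩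

theorem inAdd_dual (H : InAdd (twoTerm f : HoCat A) (twoTerm g)) :
    InAdd (twoTerm (StarDual.map f) : HoCat A) (twoTerm (StarDual.map g)) := by
  obtain ⟨n, i, p, H⟩ := inAdd_iff.1 H
  refine inAdd_iff.2 ⟨n, fun k => dual (p k), fun k => dual (i k), ?_⟩
  rw [← dual_id, ← H, dual_sum]
  exact Finset.sum_congr rfl fun k _ => (dual_comp _ _).symm

/-- The criterion `siltGE_twoTerm_iff` is self-dual: transposition swaps the two summands `f ≫ β`
and `α ≫ g`. -/
theorem siltGE_dual (hQ' : FGProj Q') (H : SiltGE (twoTerm f) (twoTerm g)) :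
    SiltGE (twoTerm (StarDual.map g)) (twoTerm (StarDual.map f)) := by
  rw [siltGE_twoTerm_iff] at H ⊢
  intro h
  obtain ⟨h, rfl⟩ := StarDual.map_surjective hQ' h
  obtain ⟨β, α, rfl⟩ := H h
  exact ⟨StarDual.map α, StarDual.map β, by
    rw [StarDual.map_add, StarDual.map_comp, StarDual.map_comp, add_comm]⟩

theorem siltGE_dual_iff (hP : FGProj P) (hQ : FGProj Q) (hP' : FGProj P') (hQ' : FGProj Q') :
    SiltGE (twoTerm (StarDual.map g)) (twoTerm (StarDual.map f)) ↔
      SiltGE (twoTerm f) (twoTerm g) :=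
  ⟨fun h => (siltGE_dual (StarDual.fgProj_obj hP) h).of_iso
    (nonempty_iso_dual_dual hP hQ).some.symm (nonempty_iso_dual_dual hP' hQ').some.symm,
    siltGE_dual hQ'⟩

end twoTerm

/-! ### Two-term silting objects and their duality. -/

section TwoSilting

variable {A : Type u} [Ring A]

/-- Approximations exist in the category of perfect complexes. -/
def ApproxFinite (A : Type u) [Ring A] : Prop :=
  ∀ X Z : HoCat A, thick (regularObj A) X → thick (regularObj A) Z →
    (∃ (n : ℕ) (φ : (⨁ fun _ : Fin n => X) ⟶ Z), ∀ g : X ⟶ Z, ∃ h, h ≫ φ = g) ∧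
    ∃ (n : ℕ) (φ : X ⟶ (⨁ fun _ : Fin n => Z)), ∀ g : X ⟶ Z, ∃ h, φ ≫ h = g

theorem ApproxFinite.hasApprox (h : ApproxFinite A) {X : HoCat A} (hX : thick (regularObj A) X) :
    HasApprox X := fun Z hZ => (h X Z hX (thick_trans hX hZ)).1

open scoped ModuleCat.Algebra in
theorem approxFinite (K : Type w) [Field K] [Algebra K A] [FiniteDimensional K A] :
    ApproxFinite A := fun _ _ hX hZ =>
  have h := (homFin_regularObj (A := A) K).of_mem_thick hX hZ
  ⟨exists_approx_of_finite h, exists_coapprox_of_finite h⟩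

theorem IsTwoSilting.exists_iso_twoTerm (hA : ApproxFinite A) {T : HoCat A} (hT : IsTwoSilting T) :
    ∃ (P Q : ModuleCat.{u} Aᵐᵒᵖ) (f : P ⟶ Q), FGProj P ∧ FGProj Q ∧ Nonempty (T ≅ twoTerm f) :=
  _root_.exists_iso_twoTerm (hA.hasApprox (thick_self _))
    (isPerfect_le_thick _ hT.silting.perfect) hT.regular_ge hT.ge_shift

/-- In terms of equations between morphisms the condition can be dualized term by term. -/
theorem isBasicObj_iff {C : Type u} [Category.{v} C] [Preadditive C] [HasShift C ℤ]
    [HasZeroObject C] [∀ n : ℤ, (shiftFunctor C n).Additive] [Pretriangulated C] {T : C} :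
    IsBasicObj T ↔ ∀ (X : C) (i₁ i₂ : X ⟶ T) (p₁ p₂ : T ⟶ X), i₁ ≫ p₁ = 𝟙 X → i₁ ≫ p₂ = 0 →
      i₂ ≫ p₁ = 0 → i₂ ≫ p₂ = 𝟙 X → IsZero X := by
  constructor
  · intro H X i₁ i₂ p₁ p₂ h11 h12 h21 h22
    refine H X ⟨⟨biprod.desc i₁ i₂, biprod.lift p₁ p₂, ?_⟩⟩
    ext <;> simp [h11, h12, h21, h22]
  · rintro H X ⟨e⟩
    refine H X (biprod.inl ≫ e.i) (biprod.inr ≫ e.i) (e.r ≫ biprod.fst) (e.r ≫ biprod.snd) ?_ ?_ ?_ ?_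
    all_goals simp

theorem IsBasicObj.of_iso {C : Type u} [Category.{v} C] [Preadditive C] [HasShift C ℤ]
    [HasZeroObject C] [∀ n : ℤ, (shiftFunctor C n).Additive] [Pretriangulated C] {T T' : C}
    (h : IsBasicObj T) (e : T ≅ T') : IsBasicObj T' := fun X ⟨r⟩ =>
  h X ⟨r.trans (.ofIso e.symm)⟩

variable {P Q : ModuleCat.{u} Aᵐᵒᵖ} {f : P ⟶ Q}

/-- The right-hand side compares `twoTerm f` only with two-term complexes, which is the range where
the duality is defined. -/
theorem isTwoSilting_twoTerm_iff (hA : ApproxFinite A) (hP : FGProj P) (hQ : FGProj Q) :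
    IsTwoSilting (twoTerm f : HoCat A) ↔ SiltGE (twoTerm f) (twoTerm f) ∧
      IsBasicObj (twoTerm f : HoCat A) ∧
      ∀ (P' Q' : ModuleCat.{u} Aᵐᵒᵖ) (g : P' ⟶ Q'), FGProj P' → FGProj Q' →
        SiltGE (twoTerm f) (twoTerm g) → SiltGE (twoTerm g) (twoTerm f) →
        InAdd (twoTerm f : HoCat A) (twoTerm g) := by
  have key := fun h => isPerfect_le_thick_twoTerm_iff (hA.hasApprox (thick_self _))
    (hA.hasApprox (twoTerm_mem_thick hP hQ)) hP hQ (f := f) h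
    (hA _ _ (twoTerm_mem_thick hP hQ) (thick_shift _ (thick_self _))).1
  constructor
  · intro h
    exact ⟨h.silting.ge_self, h.basic, (key h.silting.ge_self).1 h.silting.generates⟩
  · rintro ⟨h1, h2, h3⟩
    exact ⟨⟨isPerfect_twoTerm hP hQ f, h1, (key h1).2 h3⟩, h2, regularObj_ge_twoTerm f,
      twoTerm_ge_regularObj_shift f⟩

namespace TwoSilt

/-- The class of a two-term silting object. -/
def mk (T : HoCat A) (hT : IsTwoSilting T) : TwoSilt A := Quotient.mk _ ⟨T, hT⟩

/-- Every element of `TwoSilt A` is the class of a two-term complex. -/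
theorem exists_rep (hA : ApproxFinite A) (x : TwoSilt A) :
    ∃ (P Q : ModuleCat.{u} Aᵐᵒᵖ) (f : P ⟶ Q) (_ : FGProj P) (_ : FGProj Q)
      (h : IsTwoSilting (twoTerm f : HoCat A)), x = mk _ h := by
  obtain ⟨⟨T, hT⟩, rfl⟩ := Quotient.exists_rep x
  obtain ⟨P, Q, f, hP, hQ, ⟨e⟩⟩ := hT.exists_iso_twoTerm hA
  have hf : IsTwoSilting (twoTerm f : HoCat A) := by
    rw [isTwoSilting_twoTerm_iff hA hP hQ]
    have h := hT.silting.ge_self.of_iso e e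
    refine ⟨h, hT.basic.of_iso e, ?_⟩
    refine (isPerfect_le_thick_twoTerm_iff (hA.hasApprox (thick_self _))
      (hA.hasApprox (twoTerm_mem_thick hP hQ)) hP hQ (f := f) h
      (hA _ _ (twoTerm_mem_thick hP hQ) (thick_shift _ (thick_self _))).1).1 fun X hX => ?_
    exact thick_trans (thick_retract (.ofIso e) (thick_self _)) (hT.silting.generates X hX)
  exact ⟨P, Q, f, hP, hQ, hf, Quotient.sound ⟨e⟩⟩

theorem mk_eq_mk {T U : HoCat A} (hT : IsTwoSilting T) (hU : IsTwoSilting U) :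
    mk T hT = mk U hU ↔ Nonempty (T ≅ U) :=
  Quotient.eq

theorem mk_le_mk {T U : HoCat A} (hT : IsTwoSilting T) (hU : IsTwoSilting U) :
    (mk T hT ≤ mk U hU) ↔ SiltGE U T := Iff.rfl

end TwoSilt

variable [StarRing A]

/-- A summand of the dual inherits both inequalities, so it is again two-term. A doubled summand can
therefore be dualized back to a doubled summand of `twoTerm f`, up to the double dual. -/
theorem isBasicObj_dual (hA : ApproxFinite A) (hP : FGProj P) (hQ : FGProj Q)
    (h : IsBasicObj (twoTerm f : HoCat A)) : IsBasicObj (twoTerm (StarDual.map f) : HoCat A) := by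
  rw [isBasicObj_iff]
  intro X i₁ i₂ p₁ p₂ h11 h12 h21 h22
  have e : Retract X (twoTerm (StarDual.map f)) := ⟨i₁, p₁, h11⟩
  obtain ⟨P', Q', g, hP', hQ', ⟨e'⟩⟩ := _root_.exists_iso_twoTerm (hA.hasApprox (thick_self _))
    (thick_retract e (twoTerm_mem_thick (StarDual.fgProj_obj hQ) (StarDual.fgProj_obj hP)))
    (fun i hi => HomVanish.of_retract (regularObj_ge_twoTerm _ i hi) (.refl _) e)
    (fun i hi => HomVanish.of_retract (twoTerm_ge_regularObj_shift _ i hi) e (.refl _))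
  have h2 := isBasicObj_iff.1 (h.of_iso (twoTerm.nonempty_iso_dual_dual hP hQ).some)
    (twoTerm (StarDual.map g)) (twoTerm.dual (p₁ ≫ e'.hom)) (twoTerm.dual (p₂ ≫ e'.hom))
    (twoTerm.dual (e'.inv ≫ i₁)) (twoTerm.dual (e'.inv ≫ i₂))
    (by rw [← twoTerm.dual_comp, Category.assoc, reassoc_of% h11, Iso.inv_hom_id, twoTerm.dual_id])
    (by rw [← twoTerm.dual_comp, Category.assoc, reassoc_of% h21, zero_comp, comp_zero,
          twoTerm.dual_zero])
    (by rw [← twoTerm.dual_comp, Category.assoc, reassoc_of% h12, zero_comp, comp_zero,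
          twoTerm.dual_zero])
    (by rw [← twoTerm.dual_comp, Category.assoc, reassoc_of% h22, Iso.inv_hom_id, twoTerm.dual_id])
  have h3 : IsZero (twoTerm (StarDual.map (StarDual.map g)) : HoCat A) := by
    rw [IsZero.iff_id_eq_zero] at h2 ⊢
    rw [← twoTerm.dual_id, h2, twoTerm.dual_zero]
  exact (h3.of_iso (twoTerm.nonempty_iso_dual_dual hP' hQ').some).of_iso e'

/-- For maximality, a complex compatible with the dual is replaced by its own dual, which is
compatible with `twoTerm f`, and the resulting membership in `add` is dualized back. -/
theorem isTwoSilting_dual (hA : ApproxFinite A) (hP : FGProj P) (hQ : FGProj Q)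
    (h : IsTwoSilting (twoTerm f : HoCat A)) :
    IsTwoSilting (twoTerm (StarDual.map f) : HoCat A) := by
  rw [isTwoSilting_twoTerm_iff hA (StarDual.fgProj_obj hQ) (StarDual.fgProj_obj hP)]
  rw [isTwoSilting_twoTerm_iff hA hP hQ] at h
  obtain ⟨h1, h2, h3⟩ := h
  refine ⟨(twoTerm.siltGE_dual_iff hP hQ hP hQ).2 h1, isBasicObj_dual hA hP hQ h2, ?_⟩
  intro P' Q' g hP' hQ' h4 h5
  have e := (twoTerm.nonempty_iso_dual_dual (f := g) hP' hQ').some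
  have e' := (twoTerm.nonempty_iso_dual_dual (f := f) hP hQ).some
  have h6 := h3 _ _ (StarDual.map g) (StarDual.fgProj_obj hQ') (StarDual.fgProj_obj hP')
    ((twoTerm.siltGE_dual_iff hP hQ (StarDual.fgProj_obj hQ') (StarDual.fgProj_obj hP')).1
      (h5.of_iso e (Iso.refl _)))
    ((twoTerm.siltGE_dual_iff (StarDual.fgProj_obj hQ') (StarDual.fgProj_obj hP') hP hQ).1
      (h4.of_iso (Iso.refl _) e))
  exact (twoTerm.inAdd_dual h6).of_iso (Iso.refl _) e.symm

namespace TwoSilt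

/-- The duality on two-term silting objects. -/
def dual (hA : ApproxFinite A) (x : TwoSilt A) : TwoSilt A :=
  mk _ (isTwoSilting_dual hA (exists_rep hA x).choose_spec.choose_spec.choose_spec.choose
    (exists_rep hA x).choose_spec.choose_spec.choose_spec.choose_spec.choose
    (exists_rep hA x).choose_spec.choose_spec.choose_spec.choose_spec.choose_spec.choose)

theorem dual_mk (hA : ApproxFinite A) (hP : FGProj P) (hQ : FGProj Q)
    (h : IsTwoSilting (twoTerm f : HoCat A)) :
    dual hA (mk _ h) = mk _ (isTwoSilting_dual hA hP hQ h) := by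
  have H := (exists_rep hA
    (mk _ h)).choose_spec.choose_spec.choose_spec.choose_spec.choose_spec.choose_spec
  rw [mk_eq_mk] at H
  exact (mk_eq_mk _ _).2 ⟨twoTerm.dualIso H.some.symm⟩

theorem dual_dual (hA : ApproxFinite A) (x : TwoSilt A) : dual hA (dual hA x) = x := by
  obtain ⟨P, Q, f, hP, hQ, h, rfl⟩ := exists_rep hA x
  rw [dual_mk hA hP hQ, dual_mk hA (StarDual.fgProj_obj hQ) (StarDual.fgProj_obj hP)]
  exact (mk_eq_mk _ _).2 ⟨(twoTerm.nonempty_iso_dual_dual hP hQ).some.symm⟩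

theorem dual_le_dual (hA : ApproxFinite A) (x y : TwoSilt A) :
    dual hA y ≤ dual hA x ↔ x ≤ y := by
  obtain ⟨P, Q, f, hP, hQ, h, rfl⟩ := exists_rep hA x
  obtain ⟨P', Q', g, hP', hQ', h', rfl⟩ := exists_rep hA y
  rw [dual_mk hA hP hQ, dual_mk hA hP' hQ', mk_le_mk, mk_le_mk]
  exact twoTerm.siltGE_dual_iff hP' hQ' hP hQ

end TwoSilt

end TwoSilting

/-! ### Morphisms factoring through an object, and the two factorization conditions. -/

section ThruIdeal

variable {C : Type u} [Category.{v} C] [Preadditive C]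

/-- The sums of morphisms `X ⟶ M ⟶ Y`. -/
def thruIdeal (M X Y : C) : AddSubgroup (X ⟶ Y) :=
  AddSubgroup.closure {h | ∃ (a : X ⟶ M) (b : M ⟶ Y), h = a ≫ b}

namespace thruIdeal

variable {M M' X Y Z : C}

theorem comp_mem (a : X ⟶ M) (b : M ⟶ Y) : a ≫ b ∈ thruIdeal M X Y :=
  AddSubgroup.subset_closure ⟨a, b, rfl⟩

theorem induction {p : (X ⟶ Y) → Prop} (zero : p 0) (comp : ∀ (a : X ⟶ M) (b : M ⟶ Y), p (a ≫ b))
    (add : ∀ f g, p f → p g → p (f + g)) (neg : ∀ f, p f → p (-f)) {f : X ⟶ Y}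
    (hf : f ∈ thruIdeal M X Y) : p f := by
  refine AddSubgroup.closure_induction (p := fun x _ => p x) ?_ zero (fun x y _ _ => add x y)
    (fun x _ => neg x) hf
  rintro _ ⟨a, b, rfl⟩
  exact comp a b

theorem precomp (g : X ⟶ Y) {f : Y ⟶ Z} (hf : f ∈ thruIdeal M Y Z) : g ≫ f ∈ thruIdeal M X Z := by
  refine induction (p := fun f => g ≫ f ∈ thruIdeal M X Z) ?_ (fun a b => ?_) (fun f f' h h' => ?_)
    (fun f h => ?_) hf
  · rw [comp_zero]
    exact zero_mem _
  · rw [← Category.assoc]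
    exact comp_mem _ _
  · rw [Preadditive.comp_add]
    exact add_mem h h'
  · rw [Preadditive.comp_neg]
    exact neg_mem h

theorem postcomp (g : Y ⟶ Z) {f : X ⟶ Y} (hf : f ∈ thruIdeal M X Y) : f ≫ g ∈ thruIdeal M X Z := by
  refine induction (p := fun f => f ≫ g ∈ thruIdeal M X Z) ?_ (fun a b => ?_) (fun f f' h h' => ?_)
    (fun f h => ?_) hf
  · rw [zero_comp]
    exact zero_mem _
  · rw [Category.assoc]
    exact comp_mem _ _
  · rw [Preadditive.add_comp]
    exact add_mem h h'
  · rw [Preadditive.neg_comp]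
    exact neg_mem h

theorem of_iso (e : M ≅ M') {f : X ⟶ Y} (hf : f ∈ thruIdeal M X Y) : f ∈ thruIdeal M' X Y := by
  refine induction (p := fun f => f ∈ thruIdeal M' X Y) (zero_mem _) (fun a b => ?_)
    (fun f f' h h' => add_mem h h') (fun f h => neg_mem h) hf
  have h : a ≫ b = (a ≫ e.hom) ≫ e.inv ≫ b := by simp
  rw [h]
  exact comp_mem _ _

end thruIdeal

/-- Every morphism `P ⟶ Q` factors through `M` modulo the morphisms factoring through `g`. -/
def LeftFac (P M : C) {X Y : C} (g : X ⟶ Y) : Prop :=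
  ∀ h : P ⟶ Y, ∃ γ : P ⟶ X, h - γ ≫ g ∈ thruIdeal M P Y

/-- Every morphism `X ⟶ P` factors through `M` modulo the morphisms factoring through `g`. -/
def RightFac (P M : C) {X Y : C} (g : X ⟶ Y) : Prop :=
  ∀ c : X ⟶ P, ∃ s : Y ⟶ P, c - g ≫ s ∈ thruIdeal M X P

end ThruIdeal

/-! ### The simple module of a character. -/

section CharModule

variable {A : Type u} [Ring A] {K : Type w} [Field K] [Algebra K A] (χ : A →ₐ[K] K)

/-- The kernel of a character, as a right ideal. -/
def charKer : Submodule Aᵐᵒᵖ A where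
  carrier := {a | χ a = 0}
  add_mem' ha hb := by
    simp only [Set.mem_ofPred_eq] at ha hb ⊢
    rw [map_add, ha, hb, add_zero]
  zero_mem' := map_zero χ
  smul_mem' b a ha := by
    simp only [Set.mem_ofPred_eq] at ha ⊢
    change χ (a * b.unop) = 0
    rw [map_mul, ha, zero_mul]

theorem mem_charKer {a : A} : a ∈ charKer χ ↔ χ a = 0 := Iff.rfl

/-- The one-dimensional right module of a character. -/
def charModule : ModuleCat.{u} Aᵐᵒᵖ := ModuleCat.of Aᵐᵒᵖ (A ⧸ charKer χ)

/-- The projection of the regular module onto the module of a character. -/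
def charProj : ModuleCat.of Aᵐᵒᵖ A ⟶ charModule χ :=
  ModuleCat.ofHom (X := A) (Y := A ⧸ charKer χ) (charKer χ).mkQ

theorem charProj_apply_eq_zero_iff (a : A) : (charProj χ).hom a = 0 ↔ χ a = 0 :=
  Submodule.Quotient.mk_eq_zero (charKer χ)

theorem charProj_apply_algebraMap (a : A) :
    (charProj χ).hom a = (charProj χ).hom (algebraMap K A (χ a)) := by
  rw [← sub_eq_zero, ← map_sub]
  exact (charProj_apply_eq_zero_iff χ _).2 (by simp)

theorem charProj_surjective : Function.Surjective (charProj χ).hom :=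
  Submodule.mkQ_surjective (charKer χ)

theorem exists_charProj (s : charModule χ) : ∃ c : K, s = (charProj χ).hom (algebraMap K A c) := by
  obtain ⟨a, rfl⟩ := charProj_surjective χ s
  exact ⟨χ a, charProj_apply_algebraMap χ a⟩

/-- The morphism from the regular module given by an element. -/
def elemHom {Q : ModuleCat.{u} Aᵐᵒᵖ} (x : Q) : ModuleCat.of Aᵐᵒᵖ A ⟶ Q :=
  ModuleCat.ofHom (X := A)
    { toFun := fun a => MulOpposite.op a • x
      map_add' := fun a b => by rw [MulOpposite.op_add, add_smul]
      map_smul' := fun a b => mul_smul a (MulOpposite.op b) x }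

theorem elemHom_apply {Q : ModuleCat.{u} Aᵐᵒᵖ} (x : Q) (a : A) :
    (elemHom x).hom a = MulOpposite.op a • x := rfl

theorem eq_elemHom {Q : ModuleCat.{u} Aᵐᵒᵖ} (φ : ModuleCat.of Aᵐᵒᵖ A ⟶ Q) :
    φ = elemHom (φ.hom (1 : A)) :=
  ModuleCat.hom_ext (LinearMap.ext fun (a : A) => by
    rw [elemHom_apply, ← map_smul]
    exact congrArg _ (one_mul a).symm)

theorem regular_hom_ext {Q : ModuleCat.{u} Aᵐᵒᵖ} {φ ψ : ModuleCat.of Aᵐᵒᵖ A ⟶ Q}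
    (h : φ.hom (1 : A) = ψ.hom (1 : A)) : φ = ψ := by
  rw [eq_elemHom φ, h, ← eq_elemHom]

variable {χ}

/-- The target is one-dimensional: a nonzero value is the class of a nonzero scalar, which can be
divided out. -/
theorem charModule_hom_surjective {X : ModuleCat.{u} Aᵐᵒᵖ} {θ : X ⟶ charModule χ} (hθ : θ ≠ 0) :
    Function.Surjective θ.hom := by
  obtain ⟨x, hx⟩ : ∃ x, θ.hom x ≠ 0 := by
    by_contra! h
    exact hθ (ModuleCat.hom_ext (LinearMap.ext h))
  obtain ⟨c, hc⟩ := exists_charProj χ (θ.hom x)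
  have hc0 : c ≠ 0 := by
    rintro rfl
    exact hx (hc.trans (by rw [map_zero]; exact map_zero _))
  intro s
  obtain ⟨a, rfl⟩ := charProj_surjective χ s
  refine ⟨MulOpposite.op (algebraMap K A c⁻¹ * a) • x, ?_⟩
  rw [map_smul, hc, ← map_smul]
  congr 1
  change algebraMap K A c * (algebraMap K A c⁻¹ * a) = a
  rw [← mul_assoc, ← map_mul, mul_inv_cancel₀ hc0, map_one, one_mul]

/-- The values of `φ` and `ψ` at `1` are scalars, and multiplication by their quotient descends to
an endomorphism of the module of `χ`. -/
theorem exists_factor_charModule {φ ψ : ModuleCat.of Aᵐᵒᵖ A ⟶ charModule χ} (hφ : φ ≠ 0) :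
    ∃ l : charModule χ ⟶ charModule χ, ψ = φ ≫ l := by
  obtain ⟨c, hc⟩ := exists_charProj χ (φ.hom (1 : A))
  obtain ⟨d, hd⟩ := exists_charProj χ (ψ.hom (1 : A))
  have hc0 : c ≠ 0 := by
    rintro rfl
    refine hφ (regular_hom_ext (hc.trans ?_))
    rw [map_zero]
    exact map_zero _
  let m : A →ₗ[Aᵐᵒᵖ] A :=
    { toFun := fun a => algebraMap K A (d / c) * a
      map_add' := fun a b => mul_add _ _ _
      map_smul' := fun b a => (mul_assoc _ _ _).symm }
  let l : (A ⧸ charKer χ) →ₗ[Aᵐᵒᵖ] (A ⧸ charKer χ) := (charKer χ).mapQ (charKer χ) m fun a ha => by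
    change χ (algebraMap K A (d / c) * a) = 0
    rw [map_mul, (mem_charKer χ).1 ha, mul_zero]
  have hl : ∀ a : A, l ((charProj χ).hom a) = (charProj χ).hom (algebraMap K A (d / c) * a) :=
    fun a => rfl
  refine ⟨ModuleCat.ofHom (X := A ⧸ charKer χ) (Y := A ⧸ charKer χ) l, regular_hom_ext ?_⟩
  change _ = l (φ.hom (1 : A))
  rw [hd, hc, hl, ← map_mul, div_mul_cancel₀ _ hc0]

/-- A proper submodule containing `Q · ker χ` is killed by a morphism to the module of `χ`. -/
theorem exists_hom_charModule {Q : ModuleCat.{u} Aᵐᵒᵖ} (hQ : FGProj Q) {W : Submodule Aᵐᵒᵖ Q}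
    (hW : ∀ (x : Q) (a : A), χ a = 0 → MulOpposite.op a • x ∈ W) (hW' : W ≠ ⊤) :
    ∃ θ : Q ⟶ charModule χ, θ ≠ 0 ∧ ∀ x ∈ W, θ.hom x = 0 := by
  have := hQ.1
  -- `Q` is finitely generated, so `W` lies in a maximal submodule; the simple quotient is killed by
  -- the kernel of `χ`, hence is the module of `χ`.
  obtain ⟨W', hW1, hW2⟩ := (eq_top_or_exists_le_coatom W).resolve_left hW'
  have hs : IsSimpleModule Aᵐᵒᵖ (Q ⧸ W') := isSimpleModule_iff_isCoatom.2 hW1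
  obtain ⟨x, hx⟩ : ∃ x, x ∉ W' := by
    by_contra! h
    exact hW1.1 (eq_top_iff.2 fun x _ => h x)
  have hx0 : W'.mkQ x ≠ 0 := fun h => hx ((Submodule.Quotient.mk_eq_zero W').1 h)
  let m : A →ₗ[Aᵐᵒᵖ] (Q ⧸ W') := W'.mkQ ∘ₗ (elemHom x).hom
  have hm : charKer χ ≤ LinearMap.ker m := fun a ha =>
    (Submodule.Quotient.mk_eq_zero W').2 (hW2 (hW x a ((mem_charKer χ).1 ha)))
  let l : (A ⧸ charKer χ) →ₗ[Aᵐᵒᵖ] (Q ⧸ W') := (charKer χ).liftQ m hm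
  have hl : ∀ a : A, l ((charProj χ).hom a) = MulOpposite.op a • W'.mkQ x := fun a => rfl
  have hinj : Function.Injective l := by
    rw [injective_iff_map_eq_zero]
    intro s hs
    obtain ⟨c, hc⟩ := exists_charProj χ s
    rw [hc] at hs ⊢
    rw [hl] at hs
    have hc0 : c = 0 := by
      by_contra hc0
      apply hx0
      have h1 : MulOpposite.op (algebraMap K A c⁻¹) •
        MulOpposite.op (algebraMap K A c) • W'.mkQ x = W'.mkQ x := by
        rw [smul_smul, ← MulOpposite.op_mul, ← map_mul, mul_inv_cancel₀ hc0, map_one,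
          MulOpposite.op_one, one_smul]
      rw [← h1, hs, smul_zero]
    rw [hc0, map_zero]
    exact map_zero _
  have hsurj : Function.Surjective l := by
    refine LinearMap.surjective_of_ne_zero fun h => hx0 ?_
    have := hl 1
    rw [h, MulOpposite.op_one, one_smul] at this
    exact this.symm
  let E : (A ⧸ charKer χ) ≃ₗ[Aᵐᵒᵖ] (Q ⧸ W') := LinearEquiv.ofBijective l ⟨hinj, hsurj⟩
  refine ⟨ModuleCat.ofHom (Y := A ⧸ charKer χ) (E.symm.toLinearMap ∘ₗ W'.mkQ), fun h => ?_, ?_⟩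
  · apply hx0
    have h1 : E.symm (W'.mkQ x) = 0 := congrArg (fun φ => φ.hom x) h
    simpa using h1
  · intro y hy
    change E.symm (W'.mkQ y) = 0
    exact (congrArg E.symm ((Submodule.Quotient.mk_eq_zero W').2 (hW2 hy))).trans (map_zero _)

end CharModule

/-! ### The vanishing conditions at a vertex, and their factorization forms. -/

section Splitting

variable {A : Type u} [Ring A]

/-- A decomposition of the regular module as the direct sum of `P` and `M`. -/
structure RegularSplitting (P M : ModuleCat.{u} Aᵐᵒᵖ) where
  /-- The inclusion of `P`. -/
  i : P ⟶ ModuleCat.of Aᵐᵒᵖ A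
  /-- The projection to `P`. -/
  p : ModuleCat.of Aᵐᵒᵖ A ⟶ P
  /-- The inclusion of `M`. -/
  j : M ⟶ ModuleCat.of Aᵐᵒᵖ A
  /-- The projection to `M`. -/
  q : ModuleCat.of Aᵐᵒᵖ A ⟶ M
  i_p : i ≫ p = 𝟙 P
  j_q : j ≫ q = 𝟙 M
  total : p ≫ i + q ≫ j = 𝟙 (ModuleCat.of Aᵐᵒᵖ A)

namespace RegularSplitting

variable {P M : ModuleCat.{u} Aᵐᵒᵖ} (s : RegularSplitting P M)

/-- The idempotent of a splitting. -/
def idem : A := (s.p ≫ s.i).hom (1 : A)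

theorem fgProj_left (s : RegularSplitting P M) : FGProj P :=
  fgProj_regular.retract ⟨s.i, s.p, s.i_p⟩

theorem fgProj_right (s : RegularSplitting P M) : FGProj M :=
  fgProj_regular.retract ⟨s.j, s.q, s.j_q⟩

theorem comp_i_eq : s.p ≫ s.i = elemHom s.idem := eq_elemHom _

theorem i_q : s.i ≫ s.q = 0 := by
  have h := congrArg (fun φ => s.i ≫ φ ≫ s.q) s.total
  simp only [Preadditive.add_comp, Preadditive.comp_add, Category.assoc, s.j_q, Category.comp_id,
    reassoc_of% s.i_p, Category.id_comp] at h
  rwa [add_eq_right] at h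

theorem j_p : s.j ≫ s.p = 0 := by
  have h := congrArg (fun φ => s.j ≫ φ ≫ s.p) s.total
  simp only [Preadditive.add_comp, Preadditive.comp_add, Category.assoc, s.i_p, Category.comp_id,
    reassoc_of% s.j_q, Category.id_comp] at h
  rwa [add_eq_left] at h

/-- A morphism through the regular module is a sum of a morphism through `P` and one through `M`. -/
theorem comp_eq {X Y : ModuleCat.{u} Aᵐᵒᵖ} (f : X ⟶ ModuleCat.of Aᵐᵒᵖ A)
    (g : ModuleCat.of Aᵐᵒᵖ A ⟶ Y) :
    f ≫ g = (f ≫ s.p) ≫ s.i ≫ g + (f ≫ s.q) ≫ s.j ≫ g := by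
  conv_lhs => rw [← Category.id_comp g, ← s.total]
  simp only [Preadditive.add_comp, Preadditive.comp_add, Category.assoc]

variable {K : Type w} [Field K] [Algebra K A] (χ : A →ₐ[K] K)

/-- The projection of `P` to the module of a character. -/
def proj : P ⟶ charModule χ := s.i ≫ charProj χ

variable {χ}

theorem proj_ne_zero (h : χ s.idem = 1) : s.proj χ ≠ 0 := by
  intro h0
  have h1 : (charProj χ).hom s.idem = 0 := congrArg (fun φ => φ.hom (s.p.hom (1 : A))) h0
  rw [charProj_apply_eq_zero_iff, h] at h1
  exact one_ne_zero h1

variable (χ) in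
/-- The endomorphisms of `P` killed by the projection to the module of a character. -/
def rad : Set (End P) := {u | u ≫ s.proj χ = 0}

open scoped Pointwise in
/-- The nilpotency of the radical of `P`. -/
def RadNilpotent (s : RegularSplitting P M) (χ : A →ₐ[K] K) : Prop := ∃ N : ℕ, s.rad χ ^ N ⊆ {0}

section Fac

variable {X Q : ModuleCat.{u} Aᵐᵒᵖ} (g : X ⟶ Q)

variable (χ) in
/-- There are no nonzero morphisms from the two-term complex to the module of `χ`. -/
def HomVan : Prop := ∀ θ : Q ⟶ charModule χ, g ≫ θ = 0 → θ = 0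

variable (χ) in
/-- There are no nonzero morphisms from the two-term complex to the shifted module of `χ`. -/
def ExtVan : Prop := ∀ c : X ⟶ charModule χ, ∃ t : Q ⟶ charModule χ, c = g ≫ t

variable {g}

/-- Given a nonzero `θ` killed by `g` and any `c : X ⟶ S`, lift `c` to `X ⟶ P` and lift `P ⟶ S`
along `θ` to `P ⟶ Q`. The composite `X ⟶ Q` represents a morphism from the complex to its own shift,
so it decomposes by `hg`; composing with `θ` shows that `c` factors through `g`. -/
theorem homVan_or_extVan (hX : FGProj X) (h1 : χ s.idem = 1)
    (hg : ∀ h : X ⟶ Q, ∃ (β : Q ⟶ Q) (α : X ⟶ X), h = g ≫ β + α ≫ g) :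
    HomVan χ g ∨ ExtVan χ g := by
  by_contra! h
  obtain ⟨h, h'⟩ := h
  simp only [HomVan, not_forall] at h
  obtain ⟨θ, hθ, hθ0⟩ := h
  refine h' fun c => ?_
  obtain ⟨m, hm⟩ := s.fgProj_left.lift (s.proj χ) θ (charModule_hom_surjective hθ0)
  obtain ⟨c', hc'⟩ := hX.lift c (s.proj χ) (charModule_hom_surjective (s.proj_ne_zero h1))
  obtain ⟨β, α, h⟩ := hg (c' ≫ m)
  refine ⟨β ≫ θ, ?_⟩
  rw [← hc', ← hm, ← Category.assoc, h, Preadditive.add_comp, Category.assoc, Category.assoc, hθ,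
    comp_zero, add_zero]

-- Vanishing of extensions says that each `X ⟶ P` factors through `g` up to an error landing in the
-- radical of `P`. Splitting `X` off a sum of copies of `A = P ⊕ M`, the error is a sum of maps
-- through `M`, which are allowed, and maps ending in a radical endomorphism of `P`. Repeating this,
-- nilpotency removes the error.
open scoped Pointwise in
theorem rightFac_of_extVan (hX : FGProj X) (hQ : FGProj Q) (h1 : χ s.idem = 1)
    (hr : s.RadNilpotent χ) (h : ExtVan χ g) : RightFac P M g := by
  obtain ⟨N, hN⟩ := hr
  let G : Set (X ⟶ P) := {c | ∃ t : Q ⟶ P, c - g ≫ t ∈ thruIdeal M X P}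
  have hGadd : ∀ c c', c ∈ G → c' ∈ G → c + c' ∈ G := by
    rintro c c' ⟨t, ht⟩ ⟨t', ht'⟩
    refine ⟨t + t', ?_⟩
    have := add_mem ht ht'
    rwa [sub_add_sub_comm, ← Preadditive.comp_add] at this
  have hG0 : (0 : X ⟶ P) ∈ G := ⟨0, by rw [comp_zero, sub_zero]; exact zero_mem _⟩
  have hGcomp : ∀ c (w : P ⟶ P), c ∈ G → c ≫ w ∈ G := by
    rintro c w ⟨t, ht⟩
    refine ⟨t ≫ w, ?_⟩
    rw [← Category.assoc, ← Preadditive.sub_comp]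
    exact thruIdeal.postcomp w ht
  have hGI : ∀ c ∈ thruIdeal M X P, c ∈ G := fun c hc => ⟨0, by rwa [comp_zero, sub_zero]⟩
  have hGsum : ∀ {n : ℕ} (c : Fin n → (X ⟶ P)), (∀ k, c k ∈ G) → ∑ k, c k ∈ G := fun c hc =>
    Finset.sum_induction _ (· ∈ G) hGadd hG0 fun k _ => hc k
  obtain ⟨n, a, b, hab⟩ := hX.exists_sum_regular
  -- Induction from the `N`th power of the radical, which is zero, down to the zeroth, which
  -- contains the identity.
  have key : ∀ k ≤ N, ∀ w ∈ s.rad χ ^ (N - k), ∀ c : X ⟶ P, c ≫ w ∈ G := by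
    intro k
    induction k with
    | zero =>
      intro _ w hw c
      rw [show w = (0 : P ⟶ P) from hN hw, comp_zero]
      exact hG0
    | succ k ih =>
      intro hk w hw c
      obtain ⟨t, ht⟩ := h (c ≫ s.proj χ)
      obtain ⟨t', ht'⟩ := hQ.lift t (s.proj χ) (charModule_hom_surjective (s.proj_ne_zero h1))
      have hc : c = g ≫ t' + (c - g ≫ t') := by abel
      rw [hc, Preadditive.add_comp]
      refine hGadd _ _ (hGcomp _ _ ⟨t', by rw [sub_self]; exact zero_mem _⟩) ?_
      set x := c - g ≫ t' with hx
      have hx0 : x ≫ s.proj χ = 0 := by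
        rw [hx, Preadditive.sub_comp, ht, Category.assoc, ht', sub_self]
      rw [← Category.id_comp x, ← hab, Preadditive.sum_comp, Preadditive.sum_comp]
      refine hGsum _ fun l => ?_
      rw [Category.assoc, s.comp_eq, Preadditive.add_comp]
      refine hGadd _ _ ?_ (hGI _ (thruIdeal.postcomp _ (thruIdeal.comp_mem _ _)))
      rw [Category.assoc]
      refine ih (by lia) _ ?_ _
      -- Multiplication in `End P` is composition in reverse order, so the new radical factor,
      -- composed before `w`, is multiplied on the right.
      rw [show N - k = (N - (k + 1)) + 1 by lia, pow_succ]
      rw [show (s.i ≫ b l) ≫ x ≫ w = (s.i ≫ b l ≫ x) ≫ w by simp only [Category.assoc]]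
      refine Set.mul_mem_mul hw ?_
      change (s.i ≫ b l ≫ x) ≫ s.proj χ = 0
      rw [Category.assoc, Category.assoc, hx0, comp_zero, comp_zero]
  intro c
  have := key N le_rfl (1 : End P) (by rw [Nat.sub_self, pow_zero]; rfl) c
  rwa [show c ≫ (1 : End P) = c from Category.comp_id c] at this

-- Vanishing of morphisms to `S` says that `Q` is spanned by the image of `g` and the elements `y ·
-- a` with `χ a = 0`. A map `P ⟶ Q` given by an element of `Q` is accordingly a map through `g`,
-- plus maps through `M`, plus maps beginning with a radical endomorphism of `P`; nilpotency of the
-- radical ends the iteration.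
open scoped Pointwise in
theorem leftFac_of_homVan (hQ : FGProj Q) (hr : s.RadNilpotent χ) (h : HomVan χ g) :
    LeftFac P M g := by
  obtain ⟨N, hN⟩ := hr
  let G : Set (P ⟶ Q) := {c | ∃ γ : P ⟶ X, c - γ ≫ g ∈ thruIdeal M P Q}
  have hGadd : ∀ c c', c ∈ G → c' ∈ G → c + c' ∈ G := by
    rintro c c' ⟨t, ht⟩ ⟨t', ht'⟩
    refine ⟨t + t', ?_⟩
    have := add_mem ht ht'
    rwa [sub_add_sub_comm, ← Preadditive.add_comp] at this
  have hG0 : (0 : P ⟶ Q) ∈ G := ⟨0, by rw [zero_comp, sub_zero]; exact zero_mem _⟩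
  have hGI : ∀ c ∈ thruIdeal M P Q, c ∈ G := fun c hc => ⟨0, by rwa [zero_comp, sub_zero]⟩
  have hGcomp : ∀ c (w : P ⟶ P), c ∈ G → w ≫ c ∈ G := by
    rintro c w ⟨t, ht⟩
    refine ⟨w ≫ t, ?_⟩
    rw [Category.assoc, ← Preadditive.comp_sub]
    exact thruIdeal.precomp w ht
  let B : Set Q := {x | ∃ (y : Q) (a : A), χ a = 0 ∧ x = MulOpposite.op a • y}
  let W : Submodule Aᵐᵒᵖ Q := LinearMap.range g.hom ⊔ Submodule.span Aᵐᵒᵖ B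
  -- Otherwise `exists_hom_charModule` gives a nonzero `Q ⟶ S` vanishing on the image of `g`,
  -- against `HomVan`.
  have hW : W = ⊤ := by
    by_contra hW
    obtain ⟨θ, hθ, hθW⟩ := exists_hom_charModule (χ := χ) hQ (W := W)
      (fun x a ha => Submodule.mem_sup_right (Submodule.subset_span ⟨x, a, ha, rfl⟩)) hW
    exact hθ (h θ (ModuleCat.hom_ext (LinearMap.ext fun x =>
      hθW _ (Submodule.mem_sup_left ⟨x, rfl⟩))))
  have key : ∀ k ≤ N, ∀ w ∈ s.rad χ ^ (N - k), ∀ c : P ⟶ Q, w ≫ c ∈ G := by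
    intro k
    induction k with
    | zero =>
      intro _ w hw c
      rw [show w = (0 : P ⟶ P) from hN hw, zero_comp]
      exact hG0
    | succ k ih =>
      intro hk w hw c
      have hstep : ∀ x : Q, w ≫ s.i ≫ elemHom x ∈ G := by
        intro x
        have hx : x ∈ W := hW ▸ Submodule.mem_top
        obtain ⟨_, ⟨y, rfl⟩, z, hz, rfl⟩ := Submodule.mem_sup.1 hx
        have hadd : ∀ x x' : Q, elemHom (x + x') = elemHom x + elemHom x' := fun x x' =>
          ModuleCat.hom_ext (LinearMap.ext fun a => smul_add _ _ _)
        rw [hadd, Preadditive.comp_add, Preadditive.comp_add]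
        refine hGadd _ _ ⟨w ≫ s.i ≫ elemHom y, ?_⟩ ?_
        · have h2 : elemHom (g.hom y) = elemHom y ≫ g :=
            ModuleCat.hom_ext (LinearMap.ext fun a => (map_smul g.hom _ _).symm)
          rw [h2]
          simp only [Category.assoc, sub_self]
          exact zero_mem _
        · refine Submodule.closure_induction (p := fun z _ => w ≫ s.i ≫ elemHom z ∈ G) ?_ ?_ ?_ hz
          · have h2 : elemHom (0 : Q) = 0 := ModuleCat.hom_ext (LinearMap.ext fun a => smul_zero _)
            rw [h2, comp_zero, comp_zero]
            exact hG0
          · intro x x' _ _ hx hx'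
            rw [hadd, Preadditive.comp_add, Preadditive.comp_add]
            exact hGadd _ _ hx hx'
          · rintro b _ ⟨y, a, ha, rfl⟩
            have h3 : elemHom (b • MulOpposite.op a • y) = elemHom (a * b.unop : A) ≫ elemHom y := by
              refine regular_hom_ext ?_
              change MulOpposite.op (1 : A) • b • MulOpposite.op a • y =
                MulOpposite.op (MulOpposite.op (1 : A) • (a * b.unop : A)) • y
              simp [mul_smul]
            rw [h3, ← Category.assoc s.i, s.comp_eq, Preadditive.comp_add]
            refine hGadd _ _ ?_ (hGI _ (thruIdeal.precomp _ (thruIdeal.comp_mem _ _)))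
            rw [← Category.assoc w]
            refine ih (by lia) _ ?_ _
            rw [show N - k = (N - (k + 1)) + 1 by lia, pow_succ']
            refine Set.mul_mem_mul ?_ hw
            change ((s.i ≫ elemHom (a * b.unop : A)) ≫ s.p) ≫ s.i ≫ charProj χ = 0
            -- The `P`-component of left multiplication by `a * b.unop` is radical, because `χ a =
            -- 0` and `χ` is multiplicative.
            have h4 : elemHom (a * b.unop : A) ≫ (s.p ≫ s.i) ≫ charProj χ = 0 := by
              refine regular_hom_ext ?_
              rw [s.comp_i_eq]
              change (charProj χ).hom (s.idem * ((a * b.unop) * 1)) = 0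
              rw [charProj_apply_eq_zero_iff]
              simp [ha]
            simp only [Category.assoc] at h4 ⊢
            rw [h4, comp_zero]
      have hc : c = s.i ≫ elemHom ((s.p ≫ c).hom (1 : A)) := by
        rw [← eq_elemHom, reassoc_of% s.i_p]
      rw [hc]
      exact hstep _
  intro c
  have := key N le_rfl (1 : End P) (by rw [Nat.sub_self, pow_zero]; rfl) c
  rwa [show (1 : End P) ≫ c = c from Category.id_comp c] at this

end Fac

end RegularSplitting

end Splitting

/-! ### Approximations, and the silting order along a mutation triangle. -/

section Approximations

variable {C : Type u} [Category.{v} C] [Preadditive C] [HasShift C ℤ] [HasZeroObject C]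
  [∀ n : ℤ, (shiftFunctor C n).Additive] [Pretriangulated C]

theorem InAdd.exists_extend {M N X M' : C} (hN : InAdd M N) {f : X ⟶ M'}
    (hf : ∀ h : X ⟶ M, ∃ g : M' ⟶ M, f ≫ g = h) (h : X ⟶ N) : ∃ g : M' ⟶ N, f ≫ g = h := by
  obtain ⟨n, i, p, hip⟩ := inAdd_iff.1 hN
  choose g hg using fun k => hf (h ≫ i k)
  refine ⟨∑ k, g k ≫ p k, ?_⟩
  rw [Preadditive.comp_sum, ← Category.comp_id h, ← hip, Preadditive.comp_sum]
  exact Finset.sum_congr rfl fun k _ => by rw [← Category.assoc, hg, Category.assoc]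

theorem InAdd.exists_lift {M N X M' : C} (hN : InAdd M N) {f : M' ⟶ X}
    (hf : ∀ h : M ⟶ X, ∃ g : M ⟶ M', g ≫ f = h) (h : N ⟶ X) : ∃ g : N ⟶ M', g ≫ f = h := by
  obtain ⟨n, i, p, hip⟩ := inAdd_iff.1 hN
  choose g hg using fun k => hf (p k ≫ h)
  refine ⟨∑ k, i k ≫ g k, ?_⟩
  rw [Preadditive.sum_comp, ← Category.id_comp h, ← hip, Preadditive.sum_comp]
  exact Finset.sum_congr rfl fun k _ => by rw [Category.assoc, hg, Category.assoc]

theorem InAdd.shift {M N : C} (h : InAdd M N) (n : ℤ) : InAdd (M⟦n⟧) (N⟦n⟧) := by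
  obtain ⟨m, i, p, hip⟩ := inAdd_iff.1 h
  refine inAdd_iff.2 ⟨m, fun k => (i k)⟦n⟧', fun k => (p k)⟦n⟧', ?_⟩
  rw [← CategoryTheory.Functor.map_id, ← hip, Functor.map_sum]
  exact Finset.sum_congr rfl fun k _ => (Functor.map_comp _ _ _).symm

theorem InAdd.hom_eq_zero {M N Z : C} (h : InAdd M N) (hM : ∀ χ : M ⟶ Z, χ = 0) (χ : N ⟶ Z) :
    χ = 0 := by
  obtain ⟨n, i, p, hip⟩ := inAdd_iff.1 h
  rw [← Category.id_comp χ, ← hip, Preadditive.sum_comp]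
  exact Finset.sum_eq_zero fun k _ => by rw [Category.assoc, hM (p k ≫ χ), comp_zero]

/-- If every nonzero `X ⟶ Z` generates all morphisms `X ⟶ Z`, only one summand of `X` can map
nontrivially to `Z`. A mutation allows any complement of `P` in `A`; this shows that none of them
maps to the top of `P`, without a Krull–Schmidt theorem. -/
theorem hom_eq_zero_of_biprod {X B M Z : C} (e : X ≅ B ⊞ M)
    (hX : ∀ φ ψ : X ⟶ Z, φ ≠ 0 → ∃ l : Z ⟶ Z, ψ = φ ≫ l) (b : B ⟶ Z) (hb : b ≠ 0) (χ : M ⟶ Z) :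
    χ = 0 := by
  obtain ⟨l, hl⟩ := hX (e.hom ≫ biprod.fst ≫ b) (e.hom ≫ biprod.snd ≫ χ) fun h0 => hb <| by
    have : b = biprod.inl ≫ e.inv ≫ e.hom ≫ biprod.fst ≫ b := by simp
    rw [this, h0, comp_zero, comp_zero]
  have : χ = biprod.inr ≫ e.inv ≫ e.hom ≫ biprod.snd ≫ χ := by simp
  rw [this, hl]
  simp

variable {X M' Y T : C}

theorem exists_factor_of_siltGE {f : X ⟶ M'} {g : M' ⟶ Y} {h : Y ⟶ X⟦(1 : ℤ)⟧}
    (H : Triangle.mk f g h ∈ distTriang C) (hY : HomVanish Y T 1) (φ : X ⟶ T) :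
    ∃ ψ : M' ⟶ T, φ = f ≫ ψ :=
  exists_factor_of_shift_comp_eq_zero H φ (hY _)

/-- Only degree one needs an argument: `Y ⟶ T⟦1⟧` comes from some `X ⟶ T`, and it vanishes once that
morphism extends along `f`. -/
theorem siltGE_of_exists_factor {f : X ⟶ M'} {g : M' ⟶ Y} {h : Y ⟶ X⟦(1 : ℤ)⟧}
    (H : Triangle.mk f g h ∈ distTriang C) (hM' : SiltGE M' T) (hX : SiltGE X T)
    (hf : ∀ φ : X ⟶ T, ∃ ψ : M' ⟶ T, φ = f ≫ ψ) : SiltGE Y T := by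
  intro i hi
  by_cases h1 : i = 1
  · subst h1
    intro χ
    obtain ⟨φ, rfl⟩ := exists_shift_of_comp_eq_zero H χ (hM' 1 hi _)
    obtain ⟨ψ, rfl⟩ := hf φ
    exact shift_comp_eq_zero H ψ
  · exact HomVanish.src_ext₃ H (sub_add_cancel i 1) (hX _ (by lia)) (hM' i hi)

theorem exists_factor_of_siltGE' {g : Y ⟶ M'} {f : M' ⟶ X} {h : X ⟶ Y⟦(1 : ℤ)⟧}
    (H : Triangle.mk g f h ∈ distTriang C) (hY : HomVanish T Y 1) (ψ : T ⟶ X) :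
    ∃ ψ' : T ⟶ M', ψ = ψ' ≫ f :=
  Triangle.coyoneda_exact₃ _ H ψ (hY _)

theorem siltGE_of_exists_factor' {g : Y ⟶ M'} {f : M' ⟶ X} {h : X ⟶ Y⟦(1 : ℤ)⟧}
    (H : Triangle.mk g f h ∈ distTriang C) (hM' : SiltGE T M') (hX : SiltGE T X)
    (hf : ∀ ψ : T ⟶ X, ∃ ψ' : T ⟶ M', ψ = ψ' ≫ f) : SiltGE T Y := by
  intro i hi
  by_cases h1 : i = 1
  · subst h1
    intro χ
    obtain ⟨ψ, hψ⟩ := Triangle.coyoneda_exact₁ _ H χ (hM' 1 hi _)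
    obtain ⟨ψ', rfl⟩ := hf ψ
    have h0 : f ≫ h = 0 := comp_distTriang_mor_zero₂₃ _ H
    refine hψ.trans ((Category.assoc ψ' f h).trans ?_)
    rw [h0, comp_zero]
  · exact HomVanish.tgt_ext₁ H (sub_add_cancel i 1) (hM' i hi) (hX _ (by lia))

end Approximations

/-! ### Minimal approximations over an artinian ring. -/

section Minimal

variable {R : Type u} [Ring R]

/-- Splitting off the nilpotent part of an endomorphism. -/
theorem exists_retract_range_pow [IsArtinianRing R] {N : ModuleCat.{u} R} (hN : FGProj N)
    (g : N ⟶ N) (hg : ¬ IsIso g) :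
    ∃ (N' : ModuleCat.{u} R) (r : Retract N' N) (t : N ⟶ N), (∀ {Z : ModuleCat.{u} R} (f : Z ⟶ N),
      f ≫ g = f → f ≫ r.r ≫ r.i = f) ∧ (∀ {Z : ModuleCat.{u} R} (f : N ⟶ Z),
      g ≫ f = f → t ≫ r.r ≫ r.i ≫ f = f) ∧ Module.length R N' < Module.length R N := by
  have := hN.1
  -- Fitting's lemma: for large `k` the module is the direct sum of kernel and image of `g ^ k`, and
  -- the image carries every morphism fixed by `g`. The condition `1 ≤ k` makes `g` surjective when
  -- `g ^ k` is, so the image is proper.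
  obtain ⟨k, hk1, hk2⟩ := ((LinearMap.eventually_isCompl_ker_pow_range_pow g.hom).and
    (Filter.eventually_ge_atTop 1)).exists
  set G : N →ₗ[R] N := g.hom ^ k with hG
  let ρ : N →ₗ[R] LinearMap.range G := (LinearMap.range G).projectionOnto _ hk1.symm
  have hρ : ∀ x : LinearMap.range G, ρ x = x := fun x =>
    Submodule.projectionOnto_apply_left hk1.symm x
  refine ⟨ModuleCat.of R (LinearMap.range G), ⟨ModuleCat.ofHom (LinearMap.range G).subtype,
    ModuleCat.ofHom ρ, ?_⟩, ModuleCat.ofHom G, ?_, ?_, ?_⟩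
  · ext x
    exact congrArg Subtype.val (hρ x)
  · intro Z f hf
    have h1 : ∀ m : ℕ, ∀ z, (g.hom ^ m) (f.hom z) = f.hom z := by
      intro m z
      induction m with
      | zero => rfl
      | succ m ih =>
        rw [pow_succ]
        exact (congrArg (g.hom ^ m) (congrArg (fun φ => φ.hom z) hf)).trans ih
    ext z
    exact congrArg Subtype.val (hρ ⟨f.hom z, ⟨f.hom z, h1 k z⟩⟩)
  · intro Z f hf
    have h1 : ∀ m : ℕ, ∀ x, f.hom ((g.hom ^ m) x) = f.hom x := by
      intro m
      induction m with
      | zero => exact fun _ => rfl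
      | succ m ih =>
        intro x
        rw [pow_succ]
        exact (ih _).trans (congrArg (fun φ => φ.hom x) hf)
    ext x
    refine Eq.trans ?_ (h1 k x)
    exact congrArg (fun y => f.hom (Subtype.val y)) (hρ ⟨G x, ⟨x, rfl⟩⟩)
  · refine Submodule.length_lt fun htop => hg ?_
    have hsurj : Function.Surjective g.hom := by
      intro y
      obtain ⟨x, hx⟩ := LinearMap.range_eq_top.1 htop y
      refine ⟨(g.hom ^ (k - 1)) x, ?_⟩
      rw [← hx, hG, show k = (k - 1) + 1 by lia, pow_succ']
      rfl
    have hinj := IsNoetherian.injective_of_surjective_endomorphism g.hom hsurj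
    exact (ConcreteCategory.isIso_iff_bijective g).2 ⟨hinj, hsurj⟩

variable [IsArtinianRing R] {X M : ModuleCat.{u} R}

/-- The left approximations by sums of summands of `M`. -/
def IsLeftApproxMod (M : ModuleCat.{u} R) {X N : ModuleCat.{u} R} (f : X ⟶ N) : Prop :=
  (∃ n : ℕ, Nonempty (Retract N (⨁ fun _ : Fin n => M))) ∧ ∀ h : X ⟶ M, ∃ k : N ⟶ M, f ≫ k = h

/-- The right approximations by sums of summands of `M`. -/
def IsRightApproxMod (M : ModuleCat.{u} R) {X N : ModuleCat.{u} R} (f : N ⟶ X) : Prop :=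
  (∃ n : ℕ, Nonempty (Retract N (⨁ fun _ : Fin n => M))) ∧ ∀ h : M ⟶ X, ∃ k : M ⟶ N, k ≫ f = h

/-- Descent on length: a non-invertible `g` with `f ≫ g = f` lets the target be replaced by a
summand of smaller length. -/
theorem exists_minimal_left (hM : FGProj M)
    (h : ∃ (N : ModuleCat.{u} R) (f : X ⟶ N), IsLeftApproxMod M f) :
    ∃ (N : ModuleCat.{u} R) (f : X ⟶ N), IsLeftApproxMod M f ∧
      ∀ g : N ⟶ N, f ≫ g = f → IsIso g := by
  obtain ⟨N, f, hf⟩ := h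
  induction hl : Module.length R N using WellFoundedLT.induction generalizing N with
  | ind l ih =>
    by_cases hmin : ∀ g : N ⟶ N, f ≫ g = f → IsIso g
    · exact ⟨N, f, hf, hmin⟩
    · push Not at hmin
      obtain ⟨g, hg, hgi⟩ := hmin
      obtain ⟨⟨n, ⟨e⟩⟩, hf'⟩ := hf
      obtain ⟨N', r, t, h1, -, h3⟩ := exists_retract_range_pow ((hM.biproduct n).retract e) g hgi
      refine ih _ (hl ▸ h3) N' (f ≫ r.r) ⟨⟨n, ⟨r.trans e⟩⟩, fun h => ?_⟩ rfl
      obtain ⟨k, hk⟩ := hf' h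
      refine ⟨r.i ≫ k, ?_⟩
      rw [← hk]
      conv_rhs => rw [← h1 f hg]
      simp only [Category.assoc]

theorem exists_minimal_right (hM : FGProj M)
    (h : ∃ (N : ModuleCat.{u} R) (f : N ⟶ X), IsRightApproxMod M f) :
    ∃ (N : ModuleCat.{u} R) (f : N ⟶ X), IsRightApproxMod M f ∧
      ∀ g : N ⟶ N, g ≫ f = f → IsIso g := by
  obtain ⟨N, f, hf⟩ := h
  induction hl : Module.length R N using WellFoundedLT.induction generalizing N with
  | ind l ih =>
    by_cases hmin : ∀ g : N ⟶ N, g ≫ f = f → IsIso g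
    · exact ⟨N, f, hf, hmin⟩
    · push Not at hmin
      obtain ⟨g, hg, hgi⟩ := hmin
      obtain ⟨⟨n, ⟨e⟩⟩, hf'⟩ := hf
      obtain ⟨N', r, t, -, h1, h3⟩ := exists_retract_range_pow ((hM.biproduct n).retract e) g hgi
      refine ih _ (hl ▸ h3) N' (r.i ≫ f) ⟨⟨n, ⟨r.trans e⟩⟩, fun h => ?_⟩ rfl
      obtain ⟨k, hk⟩ := hf' h
      refine ⟨k ≫ t ≫ r.r, ?_⟩
      rw [← hk]
      conv_rhs => rw [← h1 f hg]
      simp only [Category.assoc]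

end Minimal

/-! ### Mutations of the regular object. -/

section Mutation

open HoSingle

variable {A : Type u} [Ring A]

theorem exists_leftApproxMod (hA : ApproxFinite A) {X M : ModuleCat.{u} Aᵐᵒᵖ} (hX : FGProj X)
    (hM : FGProj M) : ∃ (N : ModuleCat.{u} Aᵐᵒᵖ) (f : X ⟶ N), IsLeftApproxMod M f := by
  obtain ⟨n, φ, hφ⟩ := (hA (stalk X) (stalk M) (stalk_mem_thick hX) (stalk_mem_thick hM)).2
  obtain ⟨e⟩ := biproduct_stalk_iso M n
  obtain ⟨f, hf⟩ := (st (ModuleCat.{u} Aᵐᵒᵖ)).map_surjective (φ ≫ e.hom)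
  refine ⟨_, f, ⟨n, ⟨Retract.refl _⟩⟩, fun h => ?_⟩
  obtain ⟨k, hk⟩ := hφ ((st _).map h)
  obtain ⟨k', hk'⟩ := (st (ModuleCat.{u} Aᵐᵒᵖ)).map_surjective (e.inv ≫ k)
  refine ⟨k', (st (ModuleCat.{u} Aᵐᵒᵖ)).map_injective ?_⟩
  rw [CategoryTheory.Functor.map_comp, hf, hk', Category.assoc, Iso.hom_inv_id_assoc]
  exact hk

theorem exists_rightApproxMod (hA : ApproxFinite A) {X M : ModuleCat.{u} Aᵐᵒᵖ} (hX : FGProj X)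
    (hM : FGProj M) : ∃ (N : ModuleCat.{u} Aᵐᵒᵖ) (f : N ⟶ X), IsRightApproxMod M f := by
  obtain ⟨n, φ, hφ⟩ := (hA (stalk M) (stalk X) (stalk_mem_thick hM) (stalk_mem_thick hX)).1
  obtain ⟨e⟩ := biproduct_stalk_iso M n
  obtain ⟨f, hf⟩ := (st (ModuleCat.{u} Aᵐᵒᵖ)).map_surjective (e.inv ≫ φ)
  refine ⟨_, f, ⟨n, ⟨Retract.refl _⟩⟩, fun h => ?_⟩
  obtain ⟨k, hk⟩ := hφ ((st _).map h)
  obtain ⟨k', hk'⟩ := (st (ModuleCat.{u} Aᵐᵒᵖ)).map_surjective (k ≫ e.hom)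
  refine ⟨k', (st (ModuleCat.{u} Aᵐᵒᵖ)).map_injective ?_⟩
  rw [CategoryTheory.Functor.map_comp, hf, hk', Category.assoc, Iso.hom_inv_id_assoc]
  exact hk

theorem inAdd_stalk {M N : ModuleCat.{u} Aᵐᵒᵖ} {n : ℕ} (e : Retract N (⨁ fun _ : Fin n => M)) :
    InAdd (stalk M) (stalk N) :=
  ⟨n, ⟨(e.map (st _)).trans (.ofIso (biproduct_stalk_iso M n).some.symm)⟩⟩

theorem isMinLeftApprox_stalk {X M N : ModuleCat.{u} Aᵐᵒᵖ} {f : X ⟶ N}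
    (hf : IsLeftApproxMod M f) (hmin : ∀ g : N ⟶ N, f ≫ g = f → IsIso g) :
    IsMinLeftApprox (stalk M) (X := stalk X) (M' := stalk N) ((st _).map f) := by
  obtain ⟨⟨n, ⟨e⟩⟩, hf⟩ := hf
  refine ⟨inAdd_stalk e, fun Z h hZ => hZ.exists_extend (fun h => ?_) h, fun g hg => ?_⟩
  · obtain ⟨h, rfl⟩ := (st (ModuleCat.{u} Aᵐᵒᵖ)).map_surjective h
    obtain ⟨k, rfl⟩ := hf h
    exact ⟨(st _).map k, ((st _).map_comp _ _).symm⟩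
  · obtain ⟨g, rfl⟩ := (st (ModuleCat.{u} Aᵐᵒᵖ)).map_surjective g
    have := hmin g ((st (ModuleCat.{u} Aᵐᵒᵖ)).map_injective
      (((st _).map_comp _ _).trans hg))
    exact Functor.map_isIso (st (ModuleCat.{u} Aᵐᵒᵖ)) g

theorem isMinRightApprox_stalk {X M N : ModuleCat.{u} Aᵐᵒᵖ} {f : N ⟶ X}
    (hf : IsRightApproxMod M f) (hmin : ∀ g : N ⟶ N, g ≫ f = f → IsIso g) :
    IsMinRightApprox ((stalk M)⟦(1 : ℤ)⟧) (X := (stalk X)⟦(1 : ℤ)⟧) (M' := (stalk N)⟦(1 : ℤ)⟧)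
      (((st _).map f)⟦(1 : ℤ)⟧') := by
  obtain ⟨⟨n, ⟨e⟩⟩, hf⟩ := hf
  let F : ModuleCat.{u} Aᵐᵒᵖ ⥤ HoCat A := st _ ⋙ shiftFunctor (HoCat A) (1 : ℤ)
  refine ⟨(inAdd_stalk e).shift 1, fun Z h hZ => hZ.exists_lift (fun h => ?_) h, fun g hg => ?_⟩
  · obtain ⟨h, rfl⟩ := F.map_surjective h
    obtain ⟨k, rfl⟩ := hf h
    exact ⟨F.map k, (F.map_comp _ _).symm⟩
  · obtain ⟨g, rfl⟩ := F.map_surjective g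
    have := hmin g (F.map_injective ((F.map_comp _ _).trans hg))
    exact Functor.map_isIso F g

namespace RegularSplitting

variable {P M : ModuleCat.{u} Aᵐᵒᵖ} (s : RegularSplitting P M)

/-- The decomposition of the regular object. -/
def stalkIso : regularObj A ≅ stalk P ⊞ stalk M where
  hom := biprod.lift ((st _).map s.p) ((st _).map s.q)
  inv := biprod.desc ((st _).map s.i) ((st _).map s.j)
  hom_inv_id := by
    rw [biprod.lift_desc, ← CategoryTheory.Functor.map_comp, ← CategoryTheory.Functor.map_comp,
      ← CategoryTheory.Functor.map_add, s.total]
    exact (st _).map_id _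
  inv_hom_id := by
    ext
    · simp only [biprod.inl_desc_assoc, Category.assoc, biprod.lift_fst, Category.comp_id,
        biprod.inl_fst, ← CategoryTheory.Functor.map_comp, s.i_p]
      exact (st _).map_id _
    · simp only [biprod.inl_desc_assoc, Category.assoc, biprod.lift_snd, Category.comp_id,
        biprod.inl_snd, ← CategoryTheory.Functor.map_comp, s.i_q]
      exact (st _).map_zero _ _
    · simp only [biprod.inr_desc_assoc, Category.assoc, biprod.lift_fst, Category.comp_id,
        biprod.inr_fst, ← CategoryTheory.Functor.map_comp, s.j_p]
      exact (st _).map_zero _ _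
    · simp only [biprod.inr_desc_assoc, Category.assoc, biprod.lift_snd, Category.comp_id,
        biprod.inr_snd, ← CategoryTheory.Functor.map_comp, s.j_q]
      exact (st _).map_id _

/-- The shifted decomposition of the regular object. -/
def shiftStalkIso : (regularObj A)⟦(1 : ℤ)⟧ ≅ (stalk P)⟦(1 : ℤ)⟧ ⊞ (stalk M)⟦(1 : ℤ)⟧ :=
  have := preservesBinaryBiproduct_of_preservesBiproduct (shiftFunctor (HoCat A) (1 : ℤ))
    (stalk P) (stalk M)
  (shiftFunctor (HoCat A) (1 : ℤ)).mapIso s.stalkIso ≪≫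
    (shiftFunctor (HoCat A) (1 : ℤ)).mapBiprod _ _

variable {X Q : ModuleCat.{u} Aᵐᵒᵖ} {g : X ⟶ Q}

theorem siltGE_stalk_twoTerm (P : ModuleCat.{u} Aᵐᵒᵖ) (g : X ⟶ Q) :
    SiltGE (stalk P) (twoTerm g) := fun _ hi =>
  homVanish_st_twoTerm g P (by lia) (by lia)

theorem siltGE_twoTerm_stalk (P : ModuleCat.{u} Aᵐᵒᵖ) (g : X ⟶ Q) :
    SiltGE (twoTerm g) ((stalk P)⟦(1 : ℤ)⟧) := fun _ hi =>
  (HomVanish.shift_right_iff rfl).2 (homVanish_twoTerm_st g _ (by lia) (by lia))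

theorem siltGE_biprod_left {C : Type u} [Category.{v} C] [Preadditive C] [HasShift C ℤ]
    [HasZeroObject C] [∀ n : ℤ, (shiftFunctor C n).Additive] [Pretriangulated C] {X Y Z : C}
    (h : SiltGE X Z) (h' : SiltGE Y Z) : SiltGE (X ⊞ Y) Z := fun i hi =>
  HomVanish.src_biprod (h i hi) (h' i hi)

theorem siltGE_biprod_right {C : Type u} [Category.{v} C] [Preadditive C] [HasShift C ℤ]
    [HasZeroObject C] [∀ n : ℤ, (shiftFunctor C n).Additive] [Pretriangulated C] {X Y Z : C}
    (h : SiltGE Z X) (h' : SiltGE Z Y) : SiltGE Z (X ⊞ Y) := fun i hi =>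
  HomVanish.tgt_biprod (h i hi) (h' i hi)

/-- A morphism from `P` to the complex is given by `P ⟶ Q` modulo maps through `g`; `LeftFac` makes
it a sum of maps through `M`, and these extend along the approximation of `P`. By
`siltGE_of_exists_factor` this is what the cone needs. -/
theorem exists_leftMutation_ge (s : RegularSplitting P M) [IsArtinianRing Aᵐᵒᵖ] (hA : ApproxFinite A)
    (hg : LeftFac P M g) : ∃ U : HoCat A, IsLeftMutation (regularObj A) (stalk P) U ∧
      SiltGE U (twoTerm g) := by
  obtain ⟨N, f, hf, hmin⟩ := exists_minimal_left s.fgProj_right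
    (exists_leftApproxMod hA s.fgProj_left s.fgProj_right)
  obtain ⟨Y, a, b, H⟩ := distinguished_cocone_triangle ((st (ModuleCat.{u} Aᵐᵒᵖ)).map f)
  refine ⟨Y ⊞ stalk M, ⟨stalk M, stalk N, Y, (st _).map f, a, b, ⟨s.stalkIso⟩,
    isMinLeftApprox_stalk hf hmin, H, ⟨Iso.refl _⟩⟩,
    siltGE_biprod_left ?_ (siltGE_stalk_twoTerm M g)⟩
  refine siltGE_of_exists_factor H (siltGE_stalk_twoTerm N g) (siltGE_stalk_twoTerm P g)
    fun φ => ?_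
  obtain ⟨h, rfl⟩ := exists_comp_inr g φ
  obtain ⟨γ, hγ⟩ := hg h
  have h1 : ∃ k : N ⟶ Q, h - γ ≫ g = f ≫ k := by
    refine thruIdeal.induction (p := fun x => ∃ k : N ⟶ Q, x = f ≫ k) ⟨0, by rw [comp_zero]⟩ ?_ ?_ ?_
      hγ
    · intro a b
      obtain ⟨k, rfl⟩ := hf.2 a
      exact ⟨k ≫ b, Category.assoc _ _ _⟩
    · rintro _ _ ⟨k, rfl⟩ ⟨k', rfl⟩
      exact ⟨k + k', (Preadditive.comp_add _ _ _ _ _ _).symm⟩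
    · rintro _ ⟨k, rfl⟩
      exact ⟨-k, (Preadditive.comp_neg _ _).symm⟩
  obtain ⟨k, hk⟩ := h1
  refine ⟨(st _).map k ≫ twoTerm.inr g, ?_⟩
  have h2 : (st _).map (γ ≫ g) ≫ twoTerm.inr g = 0 := (comp_inr_eq_zero_iff g _).2 ⟨γ, rfl⟩
  rw [← Category.assoc, ← CategoryTheory.Functor.map_comp, ← hk, CategoryTheory.Functor.map_sub,
    Preadditive.sub_comp, h2, sub_zero]

/-- A morphism from the complex to `P[1]` is given by `X ⟶ P` modulo maps beginning with `g`;
`RightFac` makes it a sum of maps through `M`, which lift along the approximation. -/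
theorem exists_rightMutation_le (s : RegularSplitting P M) [IsArtinianRing Aᵐᵒᵖ] (hA : ApproxFinite A)
    (hg : RightFac P M g) : ∃ U : HoCat A,
      IsRightMutation ((regularObj A)⟦(1 : ℤ)⟧) ((stalk P)⟦(1 : ℤ)⟧) U ∧
      SiltGE (twoTerm g) U := by
  obtain ⟨N, f, hf, hmin⟩ := exists_minimal_right s.fgProj_right
    (exists_rightApproxMod hA s.fgProj_left s.fgProj_right)
  obtain ⟨Y, a, b, H⟩ := distinguished_cocone_triangle₁
    (((st (ModuleCat.{u} Aᵐᵒᵖ)).map f)⟦(1 : ℤ)⟧')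
  refine ⟨Y ⊞ (stalk M)⟦(1 : ℤ)⟧, ⟨(stalk M)⟦(1 : ℤ)⟧, (stalk N)⟦(1 : ℤ)⟧, Y, a,
    ((st _).map f)⟦(1 : ℤ)⟧', b, ⟨s.shiftStalkIso⟩,
    isMinRightApprox_stalk hf hmin, H, ⟨Iso.refl _⟩⟩,
    siltGE_biprod_right ?_ (siltGE_twoTerm_stalk M g)⟩
  refine siltGE_of_exists_factor' H (siltGE_twoTerm_stalk N g) (siltGE_twoTerm_stalk P g)
    fun ψ => ?_
  obtain ⟨c, rfl⟩ := exists_shift_of_comp_eq_zero (twoTerm.distinguished g) ψ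
    (hom_st_st_shift_eq_zero one_ne_zero _)
  obtain ⟨c, rfl⟩ := (st (ModuleCat.{u} Aᵐᵒᵖ)).map_surjective c
  obtain ⟨t, ht⟩ := hg c
  have h1 : ∃ k : X ⟶ N, c - g ≫ t = k ≫ f := by
    refine thruIdeal.induction (p := fun x => ∃ k : X ⟶ N, x = k ≫ f) ⟨0, by rw [zero_comp]⟩ ?_ ?_ ?_
      ht
    · intro a b
      obtain ⟨k, rfl⟩ := hf.2 b
      exact ⟨a ≫ k, (Category.assoc _ _ _).symm⟩
    · rintro _ _ ⟨k, rfl⟩ ⟨k', rfl⟩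
      exact ⟨k + k', (Preadditive.add_comp _ _ _ _ _ _).symm⟩
    · rintro _ ⟨k, rfl⟩
      exact ⟨-k, (Preadditive.neg_comp _ _).symm⟩
  obtain ⟨k, hk⟩ := h1
  refine ⟨twoTerm.δ g ≫ ((st _).map k)⟦(1 : ℤ)⟧', ?_⟩
  have h2 := shift_comp_eq_zero (twoTerm.distinguished g) ((st _).map t)
  have h3 : (st _).map c = (st _).map g ≫ (st _).map t + (st _).map k ≫ (st _).map f := by
    rw [← CategoryTheory.Functor.map_comp, ← CategoryTheory.Functor.map_comp,
      ← CategoryTheory.Functor.map_add, ← hk, add_sub_cancel]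
  rw [h3, CategoryTheory.Functor.map_add, Preadditive.comp_add, h2, zero_add,
    CategoryTheory.Functor.map_comp, Category.assoc]

end RegularSplitting

end Mutation

/-! ### The sign decomposition for an algebra with involution. -/

section SignDecomposition

open HoSingle

variable {A : Type u} [Ring A] {K : Type w} [Field K] [Algebra K A] {χ : A →ₐ[K] K}

theorem exists_factor_stalk_charModule (φ ψ : regularObj A ⟶ stalk (charModule χ)) (hφ : φ ≠ 0) :
    ∃ l : stalk (charModule χ) ⟶ stalk (charModule χ), ψ = φ ≫ l := by
  obtain ⟨φ, rfl⟩ := (st (ModuleCat.{u} Aᵐᵒᵖ)).map_surjective φ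
  obtain ⟨ψ, rfl⟩ := (st (ModuleCat.{u} Aᵐᵒᵖ)).map_surjective ψ
  obtain ⟨l, rfl⟩ := exists_factor_charModule (χ := χ) (φ := φ) (ψ := ψ) (by
    rintro rfl
    exact hφ ((st _).map_zero _ _))
  exact ⟨(st _).map l, (st _).map_comp _ _⟩

theorem exists_factor_shift_charModule
    (φ ψ : (regularObj A)⟦(1 : ℤ)⟧ ⟶ (stalk (charModule χ))⟦(1 : ℤ)⟧) (hφ : φ ≠ 0) :
    ∃ l : (stalk (charModule χ))⟦(1 : ℤ)⟧ ⟶ (stalk (charModule χ))⟦(1 : ℤ)⟧, ψ = φ ≫ l := by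
  obtain ⟨φ, rfl⟩ := (shiftFunctor (HoCat A) (1 : ℤ)).map_surjective φ
  obtain ⟨ψ, rfl⟩ := (shiftFunctor (HoCat A) (1 : ℤ)).map_surjective ψ
  obtain ⟨l, rfl⟩ := exists_factor_stalk_charModule φ ψ (by
    rintro rfl
    exact hφ (CategoryTheory.Functor.map_zero _ _ _))
  exact ⟨l⟦(1 : ℤ)⟧', CategoryTheory.Functor.map_comp _ _ _⟩

theorem isPerfect_stalk {P : ModuleCat.{u} Aᵐᵒᵖ} (hP : FGProj P) : IsPerfect (stalk P) :=
  ⟨(CochainComplex.singleFunctor _ 0).obj P, ⟨0, 0, fun _ hi =>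
    HomologicalComplex.isZero_single_obj_X _ _ _ _ (by lia)⟩, fun i => hP.single i, ⟨Iso.refl _⟩⟩

namespace RegularSplitting

variable {P M : ModuleCat.{u} Aᵐᵒᵖ} (s : RegularSplitting P M) {X Q : ModuleCat.{u} Aᵐᵒᵖ}
  {g : X ⟶ Q}

/-- Were there a nonzero morphism from the complex to `S`, the projection `P ⟶ S` would factor
through the complex. By `U ≥ twoTerm g` its first factor extends along the approximation, so `P ⟶ S`
would pass through an object of `add M₁`, which has no nonzero morphism to `S`. -/
theorem homVan_of_leftMutation (h1 : χ s.idem = 1) {U : HoCat A}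
    (hU : IsLeftMutation (regularObj A) (stalk P) U) (hg : SiltGE U (twoTerm g)) :
    HomVan χ g := by
  obtain ⟨M₁, N, Y, f, a, b, ⟨e⟩, hf, H, ⟨e'⟩⟩ := hU
  have hY : SiltGE Y (twoTerm g) := fun i hi =>
    HomVanish.of_retract (hg i hi) ⟨biprod.inl ≫ e'.inv, e'.hom ≫ biprod.fst, by simp⟩ (.refl _)
  intro θ hθ
  by_contra hθ0
  obtain ⟨m, hm⟩ := s.fgProj_left.lift (s.proj χ) θ (charModule_hom_surjective hθ0)
  obtain ⟨ψ, hψ⟩ := exists_factor_of_siltGE H (hY 1 one_pos) ((st _).map m ≫ twoTerm.inr g)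
  obtain ⟨θ', hθ'⟩ := Triangle.yoneda_exact₂ _ (twoTerm.distinguished g) ((st _).map θ)
    (((st _).map_comp _ _).symm.trans ((congrArg (st _).map hθ).trans ((st _).map_zero _ _)))
  have hπ : (st _).map (s.proj χ) ≠ 0 := fun h => s.proj_ne_zero h1
    ((st (ModuleCat.{u} Aᵐᵒᵖ)).map_injective (h.trans ((st _).map_zero _ _).symm))
  apply hπ
  have h2 : ψ ≫ θ' = 0 :=
    hf.1.hom_eq_zero (hom_eq_zero_of_biprod e exists_factor_stalk_charModule _ hπ) _
  rw [← hm, CategoryTheory.Functor.map_comp]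
  refine (congrArg (fun x => (st _).map m ≫ x) hθ').trans ((Category.assoc _ _ _).symm.trans ?_)
  refine (congrArg (fun x => x ≫ θ') hψ).trans ((Category.assoc _ _ _).trans ?_)
  exact (congrArg (fun x => f ≫ x) h2).trans comp_zero

/-- Lift `c` to `X ⟶ P`. The induced morphism to `P[1]` factors through the approximation because
`twoTerm g ≥ U`, and the approximating object has no nonzero morphism to `S[1]`; so the class of `c`
vanishes. -/
theorem extVan_of_rightMutation (h1 : χ s.idem = 1) (hX : FGProj X) {U : HoCat A}
    (hU : IsRightMutation ((regularObj A)⟦(1 : ℤ)⟧) ((stalk P)⟦(1 : ℤ)⟧) U)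
    (hg : SiltGE (twoTerm g) U) : ExtVan χ g := by
  obtain ⟨M₁, N, Y, a, f, b, ⟨e⟩, hf, H, ⟨e'⟩⟩ := hU
  have hY : SiltGE (twoTerm g) Y := fun i hi =>
    HomVanish.of_retract (hg i hi) (.refl _) ⟨biprod.inl ≫ e'.inv, e'.hom ≫ biprod.fst, by simp⟩
  intro c
  obtain ⟨c', hc'⟩ := hX.lift c (s.proj χ) (charModule_hom_surjective (s.proj_ne_zero h1))
  obtain ⟨ψ, hψ⟩ := exists_factor_of_siltGE' H (hY 1 one_pos)
    (twoTerm.δ g ≫ ((st _).map c')⟦(1 : ℤ)⟧')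
  have hπ : ((st _).map (s.proj χ))⟦(1 : ℤ)⟧' ≠ 0 := fun h => s.proj_ne_zero h1
    ((st (ModuleCat.{u} Aᵐᵒᵖ)).map_injective ((shiftFunctor (HoCat A) (1 : ℤ)).map_injective
      (h.trans ((congrArg _ ((st _).map_zero _ _)).trans
        (CategoryTheory.Functor.map_zero _ _ _)).symm)))
  have h2 : f ≫ ((st _).map (s.proj χ))⟦(1 : ℤ)⟧' = 0 :=
    hf.1.hom_eq_zero (hom_eq_zero_of_biprod e exists_factor_shift_charModule _ hπ) _
  obtain ⟨t, ht⟩ := exists_factor_of_shift_comp_eq_zero (twoTerm.distinguished g) ((st _).map c) (by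
    rw [← hc', CategoryTheory.Functor.map_comp, CategoryTheory.Functor.map_comp, ← Category.assoc,
      hψ, Category.assoc, h2, comp_zero])
  obtain ⟨t, rfl⟩ := (st (ModuleCat.{u} Aᵐᵒᵖ)).map_surjective t
  exact ⟨t, (st (ModuleCat.{u} Aᵐᵒᵖ)).map_injective (ht.trans ((st _).map_comp _ _).symm)⟩

/-- Together the two conditions kill the morphisms from the complex to every shift of `S`. This
passes to the thick subcategory, which contains `P`, although `P ⟶ S` is nonzero. -/
theorem not_homVan_and_extVan (h1 : χ s.idem = 1) (hg : IsPerfect ≤ thick (twoTerm g : HoCat A)) :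
    ¬ (HomVan χ g ∧ ExtVan χ g) := by
  rintro ⟨hH, hE⟩
  have h2 : ∀ i, HomVanish (twoTerm g) (stalk (charModule χ)) i := by
    intro i
    by_cases hi0 : i = 0
    · subst hi0
      rw [HomVanish.zero_iff]
      intro φ
      obtain ⟨θ, hθ⟩ := (st (ModuleCat.{u} Aᵐᵒᵖ)).map_surjective (twoTerm.inr g ≫ φ)
      have h0 : (st _).map g ≫ twoTerm.inr g = 0 :=
        comp_distTriang_mor_zero₁₂ _ (twoTerm.distinguished g)
      have hθ0 : θ = 0 := hH θ ((st (ModuleCat.{u} Aᵐᵒᵖ)).map_injective (by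
        rw [CategoryTheory.Functor.map_comp, hθ, ← Category.assoc, h0, zero_comp,
          CategoryTheory.Functor.map_zero]))
      have h3 : twoTerm.inr g ≫ φ = 0 := by
        rw [← hθ, hθ0, CategoryTheory.Functor.map_zero]
      obtain ⟨ψ, hψ⟩ := Triangle.yoneda_exact₃ _ (twoTerm.distinguished g) φ h3
      have h4 : HomVanish ((stalk X)⟦(1 : ℤ)⟧) (stalk (charModule χ)) 0 := by
        rw [HomVanish.shift_left_iff (neg_add_cancel 1)]
        exact fun _ => hom_st_st_shift_eq_zero (by lia) _
      rw [hψ, HomVanish.zero_iff.1 h4 ψ]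
      exact comp_zero
    · by_cases hi1 : i = 1
      · subst hi1
        intro φ
        obtain ⟨c, rfl⟩ := exists_shift_of_comp_eq_zero (twoTerm.distinguished g) φ
          (hom_st_st_shift_eq_zero one_ne_zero _)
        obtain ⟨c, rfl⟩ := (st (ModuleCat.{u} Aᵐᵒᵖ)).map_surjective c
        obtain ⟨t, rfl⟩ := hE c
        rw [CategoryTheory.Functor.map_comp (st _)]
        exact shift_comp_eq_zero (twoTerm.distinguished g) _
      · exact homVanish_twoTerm_st g _ hi1 hi0
  have h3 : ∀ Z, thick (twoTerm g : HoCat A) Z → ∀ i, HomVanish Z (stalk (charModule χ)) i := by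
    intro Z hZ
    refine thick_induction (p := fun Z => ∀ i, HomVanish Z (stalk (charModule χ)) i) h2 ?_ ?_ ?_ hZ
    · exact fun Z n h i => (HomVanish.shift_left_iff (sub_add_cancel i n)).2 (h _)
    · exact fun Z Z' e h i => (h i).of_retract e (.refl _)
    · exact fun Z₁ Z₂ Z₃ _ _ _ H h h' i => HomVanish.src_ext₂ H (h i) (h' i)
  have h4 := HomVanish.zero_iff.1 (h3 _ (hg _ (isPerfect_stalk s.fgProj_left)) 0)
    ((st _).map (s.proj χ))
  exact s.proj_ne_zero h1 ((st (ModuleCat.{u} Aᵐᵒᵖ)).map_injective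
    (h4.trans ((st _).map_zero _ _).symm))

end RegularSplitting

section Dual

variable [StarRing A]

/-- When the idempotent is fixed by the involution, `P` and its dual split the same idempotent
endomorphism of `A`. -/
theorem nonempty_iso_dual {P : ModuleCat.{u} Aᵐᵒᵖ} (i : P ⟶ ModuleCat.of Aᵐᵒᵖ A)
    (p : ModuleCat.of Aᵐᵒᵖ A ⟶ P) (h : i ≫ p = 𝟙 P)
    (he : star ((p ≫ i).hom (1 : A) : A) = (p ≫ i).hom (1 : A)) :
    Nonempty (P ≅ StarDual.obj P) := by
  let p' : ModuleCat.of Aᵐᵒᵖ A ⟶ StarDual.obj P := StarDual.regularIso.inv ≫ StarDual.map i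
  let i' : StarDual.obj P ⟶ ModuleCat.of Aᵐᵒᵖ A := StarDual.map p ≫ StarDual.regularIso.hom
  have h1 : p' ≫ i' = p ≫ i := by
    refine regular_hom_ext ?_
    change star (star (1 : A) * ((p ≫ i).hom (1 : A) : A)) = _
    rw [star_one, one_mul, he]
  have h2 : i' ≫ p' = 𝟙 _ := by
    simp only [i', p', Category.assoc, Iso.hom_inv_id_assoc]
    rw [← StarDual.map_comp, h, StarDual.map_id]
  clear_value i' p'
  refine ⟨⟨i ≫ p', i' ≫ p, ?_, ?_⟩⟩
  · rw [Category.assoc, reassoc_of% h1, reassoc_of% h, h]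
  · have h3 : (i' ≫ p) ≫ i ≫ p' = i' ≫ (p ≫ i) ≫ p' := by simp only [Category.assoc]
    rw [h3, ← h1, Category.assoc, h2, Category.comp_id, h2]

theorem map_mem_thruIdeal {M X Y : ModuleCat.{u} Aᵐᵒᵖ} {f : X ⟶ Y} (hf : f ∈ thruIdeal M X Y)
    (e : M ≅ StarDual.obj M) :
    StarDual.map f ∈ thruIdeal M (StarDual.obj Y) (StarDual.obj X) := by
  refine thruIdeal.of_iso e.symm (thruIdeal.induction (M := M)
    (p := fun f : X ⟶ Y => StarDual.map f ∈ thruIdeal (StarDual.obj M) (StarDual.obj Y) (StarDual.obj X))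
    ?_ (fun a b => ?_) (fun f g hf hg => ?_) (fun f hf => ?_) hf)
  · rw [show StarDual.map (0 : X ⟶ Y) = 0 from map_zero (StarDual.mapHom X Y)]
    exact zero_mem _
  · exact thruIdeal.comp_mem (StarDual.map b) (StarDual.map a)
  · rw [StarDual.map_add]
    exact add_mem hf hg
  · rw [show StarDual.map (-f) = -StarDual.map f from map_neg (StarDual.mapHom X Y) f]
    exact neg_mem hf

variable {P M X Q : ModuleCat.{u} Aᵐᵒᵖ} {g : X ⟶ Q}

/-- Transposition turns maps `P ⟶ Q` into maps `Q* ⟶ P*`; self-duality of `P` and `M` makes the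
transposed condition refer to the same `P` and `M`. -/
theorem LeftFac.dual (hg : LeftFac P M g) (eP : P ≅ StarDual.obj P) (eM : M ≅ StarDual.obj M)
    (hQ : FGProj Q) : RightFac P M (StarDual.map g) := by
  intro c
  obtain ⟨h, hh⟩ := StarDual.map_surjective hQ (c ≫ eP.hom)
  obtain ⟨γ, hγ⟩ := hg h
  refine ⟨StarDual.map γ ≫ eP.inv, ?_⟩
  have h1 := thruIdeal.postcomp eP.inv (map_mem_thruIdeal hγ eM)
  have h2 : StarDual.map (h - γ ≫ g) = StarDual.map h - StarDual.map g ≫ StarDual.map γ :=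
    map_sub (StarDual.mapHom P Q) _ _
  rwa [h2, ← hh, Preadditive.sub_comp, Category.assoc, Iso.hom_inv_id, Category.comp_id,
    Category.assoc] at h1

theorem RightFac.dual (hg : RightFac P M g) (eP : P ≅ StarDual.obj P) (eM : M ≅ StarDual.obj M)
    (hP : FGProj P) : LeftFac P M (StarDual.map g) := by
  intro c
  obtain ⟨h, hh⟩ := StarDual.map_surjective hP (eP.inv ≫ c)
  obtain ⟨γ, hγ⟩ := hg h
  refine ⟨eP.hom ≫ StarDual.map γ, ?_⟩
  have h1 := thruIdeal.precomp eP.hom (map_mem_thruIdeal hγ eM)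
  have h2 : StarDual.map (h - g ≫ γ) = StarDual.map h - StarDual.map γ ≫ StarDual.map g :=
    map_sub (StarDual.mapHom X P) _ _
  rwa [h2, ← hh, Preadditive.comp_sub, Iso.hom_inv_id_assoc, ← Category.assoc] at h1

end Dual

namespace TwoSilt

variable {P M : ModuleCat.{u} Aᵐᵒᵖ} (s : RegularSplitting P M) {X Q : ModuleCat.{u} Aᵐᵒᵖ}
  {g : X ⟶ Q}

/-- A cycle of three implications closes the equivalence. `HomVan` serves the dichotomy with `plus
P`, `LeftFac` serves the duality. -/
theorem mem_minus_iff [IsArtinianRing Aᵐᵒᵖ] (hA : ApproxFinite A) (h1 : χ s.idem = 1)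
    (hr : s.RadNilpotent χ) (hQ : FGProj Q) (hT : IsTwoSilting (twoTerm g : HoCat A)) :
    (mk _ hT ∈ minus P ↔ RegularSplitting.HomVan χ g) ∧ (mk _ hT ∈ minus P ↔ LeftFac P M g) := by
  have h2 : mk _ hT ∈ minus P → RegularSplitting.HomVan χ g := fun ⟨U, hU, hUT, _⟩ =>
    s.homVan_of_leftMutation h1 hU hUT
  have h3 : RegularSplitting.HomVan χ g → LeftFac P M g := s.leftFac_of_homVan hQ hr
  have h4 : LeftFac P M g → mk _ hT ∈ minus P := fun h => by
    obtain ⟨U, hU, hUT⟩ := s.exists_leftMutation_ge hA h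
    exact ⟨U, hU, hUT, hT.ge_shift⟩
  exact ⟨⟨h2, h4 ∘ h3⟩, ⟨h3 ∘ h2, h4⟩⟩

theorem mem_plus_iff [IsArtinianRing Aᵐᵒᵖ] (hA : ApproxFinite A) (h1 : χ s.idem = 1)
    (hr : s.RadNilpotent χ) (hX : FGProj X) (hQ : FGProj Q)
    (hT : IsTwoSilting (twoTerm g : HoCat A)) :
    (mk _ hT ∈ plus P ↔ RegularSplitting.ExtVan χ g) ∧ (mk _ hT ∈ plus P ↔ RightFac P M g) := by
  have h2 : mk _ hT ∈ plus P → RegularSplitting.ExtVan χ g := fun ⟨U, hU, _, hUT⟩ =>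
    s.extVan_of_rightMutation h1 hX hU hUT
  have h3 : RegularSplitting.ExtVan χ g → RightFac P M g := s.rightFac_of_extVan hX hQ h1 hr
  have h4 : RightFac P M g → mk _ hT ∈ plus P := fun h => by
    obtain ⟨U, hU, hUT⟩ := s.exists_rightMutation_le hA h
    exact ⟨U, hU, hT.regular_ge, hUT⟩
  exact ⟨⟨h2, h4 ∘ h3⟩, ⟨h3 ∘ h2, h4⟩⟩

theorem compl_minus [IsArtinianRing Aᵐᵒᵖ] (hA : ApproxFinite A) (h1 : χ s.idem = 1)
    (hr : s.RadNilpotent χ) : (minus P)ᶜ = plus P := by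
  ext x
  obtain ⟨X, Q, g, hX, hQ, hT, rfl⟩ := exists_rep hA x
  have h2 := s.homVan_or_extVan hX h1 ((siltGE_twoTerm_iff g g).1 hT.silting.ge_self)
  have h3 := s.not_homVan_and_extVan h1 hT.silting.generates
  rw [Set.mem_compl_iff, (mem_minus_iff s hA h1 hr hQ hT).1, (mem_plus_iff s hA h1 hr hX hQ hT).1]
  tauto

theorem dual_mem_plus_iff [StarRing A] [IsArtinianRing Aᵐᵒᵖ] (hA : ApproxFinite A)
    (h1 : χ s.idem = 1) (hs : star s.idem = s.idem) (hr : s.RadNilpotent χ) (x : TwoSilt A) :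
    x ∈ minus P ↔ dual hA x ∈ plus P := by
  obtain ⟨eP⟩ := nonempty_iso_dual s.i s.p s.i_p hs
  -- The complementary idempotent `1 - e` is fixed as well, so `M` is also self-dual.
  have hs' : star ((s.q ≫ s.j).hom (1 : A) : A) = (s.q ≫ s.j).hom (1 : A) := by
    have h : (s.q ≫ s.j).hom (1 : A) = 1 - s.idem := by
      rw [show s.q ≫ s.j = 𝟙 _ - s.p ≫ s.i from eq_sub_of_add_eq' s.total]
      rfl
    rw [h, star_sub, star_one, hs]
  obtain ⟨eM⟩ := nonempty_iso_dual s.j s.q s.j_q hs'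
  have key : ∀ x, x ∈ minus P → dual hA x ∈ plus P := by
    intro x hx
    obtain ⟨X, Q, g, hX, hQ, hT, rfl⟩ := exists_rep hA x
    rw [dual_mk hA hX hQ, (mem_plus_iff s hA h1 hr (StarDual.fgProj_obj hQ)
      (StarDual.fgProj_obj hX) _).2]
    exact ((mem_minus_iff s hA h1 hr hQ hT).2.1 hx).dual eP eM hQ
  have key' : ∀ x, x ∈ plus P → dual hA x ∈ minus P := by
    intro x hx
    obtain ⟨X, Q, g, hX, hQ, hT, rfl⟩ := exists_rep hA x
    rw [dual_mk hA hX hQ, (mem_minus_iff s hA h1 hr (StarDual.fgProj_obj hX) _).2]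
    exact ((mem_plus_iff s hA h1 hr hX hQ hT).2.1 hx).dual eP eM s.fgProj_left
  exact ⟨key x, fun h => dual_dual hA x ▸ key' _ h⟩

/-- The sign decomposition of the two-term silting objects of an algebra with an involution. -/
theorem sign_decomposition [StarRing A] [IsArtinianRing Aᵐᵒᵖ] (hA : ApproxFinite A)
    (h1 : χ s.idem = 1) (hs : star s.idem = s.idem) (hr : s.RadNilpotent χ) :
    (∃ f : minus P ≃ plus P, ∀ S T, S.1 ≤ T.1 ↔ (f T).1 ≤ (f S).1) ∧
      Cardinal.mk (TwoSilt A) = 2 * Cardinal.mk (minus P) := by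
  let F : TwoSilt A ≃ TwoSilt A := ⟨dual hA, dual hA, dual_dual hA, dual_dual hA⟩
  let f : minus P ≃ plus P := F.subtypeEquiv (dual_mem_plus_iff s hA h1 hs hr)
  refine ⟨⟨f, fun S T => (dual_le_dual hA S.1 T.1).symm⟩, ?_⟩
  rw [← Cardinal.mk_sum_compl (minus P), compl_minus s hA h1 hr, ← Cardinal.mk_congr f, two_mul]

end TwoSilt

end SignDecomposition

/-! ### Idempotents of indecomposable objects. -/

section Indecomposable

theorem eq_zero_or_eq_id_of_indecomposable {C : Type u} [Category.{v} C] [Preadditive C]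
    [HasZeroObject C] [HasBinaryBiproducts C] [IsIdempotentComplete C] {X : C}
    (hX : Indecomposable X) (ε : X ⟶ X) (hε : ε ≫ ε = ε) : ε = 0 ∨ ε = 𝟙 X := by
  obtain ⟨Y, i₁, r₁, h1, h1'⟩ := IsIdempotentComplete.idempotents_split X ε hε
  obtain ⟨Z, i₂, r₂, h2, h2'⟩ := IsIdempotentComplete.idempotents_split X (𝟙 X - ε) (by
    simp [hε])
  have h3 : i₁ ≫ r₂ = 0 := by
    have : i₁ ≫ r₂ ≫ i₂ = 0 := by
      rw [h2', ← h1', Preadditive.comp_sub, reassoc_of% h1, Category.comp_id, sub_self]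
    rw [← Category.comp_id (i₁ ≫ r₂), ← h2, ← Category.assoc, Category.assoc i₁, this, zero_comp]
  have h4 : i₂ ≫ r₁ = 0 := by
    have : i₂ ≫ r₁ ≫ i₁ = 0 := by
      rw [h1', show ε = 𝟙 X - r₂ ≫ i₂ by rw [h2']; abel, Preadditive.comp_sub, reassoc_of% h2,
        Category.comp_id, sub_self]
    rw [← Category.comp_id (i₂ ≫ r₁), ← h1, ← Category.assoc, Category.assoc i₂, this, zero_comp]
  let e : X ≅ Y ⊞ Z :=
    { hom := biprod.lift r₁ r₂
      inv := biprod.desc i₁ i₂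
      hom_inv_id := by rw [biprod.lift_desc, h1', h2', add_sub_cancel]
      inv_hom_id := by ext <;> simp [h1, h2, h3, h4] }
  rcases hX.2 Y Z e with h | h
  · left
    rw [← h1', h.eq_of_src i₁ 0, comp_zero]
  · right
    rw [h.eq_of_src i₂ 0, comp_zero] at h2'
    exact (sub_eq_zero.1 h2'.symm).symm

end Indecomposable

/-! ### Indecomposable projectives of an algebra with nilpotent radical and one-dimensional simples.
-/

section PrimitiveIdempotents

open scoped Pointwise

variable {A : Type u} [Ring A] {K : Type w} [Field K] [Algebra K A] {V : Type v} [Fintype V]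

/-- The common kernel of a family of characters. -/
def commonKer (χ : V → (A →ₐ[K] K)) : Set A := {a | ∀ j, χ j a = 0}

/-- Left multiplication by an element, as an endomorphism of the regular module. -/
abbrev regHom (x : A) : ModuleCat.of Aᵐᵒᵖ A ⟶ ModuleCat.of Aᵐᵒᵖ A :=
  elemHom (Q := ModuleCat.of Aᵐᵒᵖ A) x

theorem regHom_comp {x y : A} : regHom x ≫ regHom y = regHom (y * x) :=
  regular_hom_ext (by
    change y * (x * 1) = (y * x) * 1
    rw [mul_one, mul_one])

theorem regHom_one : regHom (1 : A) = 𝟙 _ :=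
  regular_hom_ext (mul_one (1 : A))

theorem elemHom_zero {Q : ModuleCat.{u} Aᵐᵒᵖ} : elemHom (0 : Q) = 0 :=
  ModuleCat.hom_ext (LinearMap.ext fun _ => smul_zero _)

theorem regHom_apply_one (x : A) : (regHom (x)).hom (1 : A) = x := mul_one x

variable {χ : V → (A →ₐ[K] K)} {N : ℕ}

/-- If all entries of the idempotent matrix defining `P` were in the nilpotent common kernel,
iterating `b k = ∑ (b k ≫ a l) ≫ b l` would express `b k` through products of `N` such entries, so
`P` would be zero. -/
theorem exists_notMem_commonKer (hN : commonKer χ ^ N ⊆ {0}) {P : ModuleCat.{u} Aᵐᵒᵖ}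
    (hP : ¬ IsZero P) {n : ℕ} (a : Fin n → (P ⟶ ModuleCat.of Aᵐᵒᵖ A))
    (b : Fin n → (ModuleCat.of Aᵐᵒᵖ A ⟶ P)) (hab : ∑ k, a k ≫ b k = 𝟙 P) :
    ∃ k l, (b k ≫ a l).hom (1 : A) ∉ commonKer χ := by
  by_contra! H
  let S : ℕ → AddSubgroup (ModuleCat.of Aᵐᵒᵖ A ⟶ P) := fun m =>
    AddSubgroup.closure {f | ∃ x ∈ commonKer χ ^ m, ∃ l, f = regHom (x) ≫ b l}
  have key : ∀ m k, b k ∈ S m := by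
    intro m
    induction m with
    | zero =>
      intro k
      refine AddSubgroup.subset_closure ⟨1, by rw [pow_zero]; rfl, k, ?_⟩
      rw [regHom_one, Category.id_comp]
    | succ m ih =>
      intro k
      have h1 : b k = ∑ l, elemHom ((b k ≫ a l).hom (1 : A)) ≫ b l := by
        conv_lhs => rw [← Category.comp_id (b k), ← hab, Preadditive.comp_sum]
        refine Finset.sum_congr rfl fun l _ => ?_
        rw [← eq_elemHom, Category.assoc]
      rw [h1]
      refine sum_mem fun l _ => ?_
      refine AddSubgroup.closure_induction (p := fun f _ =>
        elemHom ((b k ≫ a l).hom (1 : A)) ≫ f ∈ S (m + 1)) ?_ ?_ ?_ ?_ (ih l)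
      · rintro _ ⟨x, hx, l', rfl⟩
        refine AddSubgroup.subset_closure ⟨x * (b k ≫ a l).hom (1 : A), ?_, l', ?_⟩
        · rw [pow_succ]
          exact Set.mul_mem_mul hx (H k l)
        · rw [← Category.assoc]
          exact congrArg (fun φ => φ ≫ b l') regHom_comp
      · rw [comp_zero]
        exact zero_mem _
      · intro f f' _ _ h h'
        rw [Preadditive.comp_add]
        exact add_mem h h'
      · intro f _ h
        rw [Preadditive.comp_neg]
        exact neg_mem h
  have h0 : ∀ k, b k = 0 := by
    intro k
    refine AddSubgroup.closure_induction (p := fun f _ => f = 0) ?_ rfl ?_ ?_ (key N k)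
    · rintro _ ⟨x, hx, l, rfl⟩
      rw [show x = 0 from hN hx]
      exact (congrArg (fun φ => φ ≫ b l) elemHom_zero).trans zero_comp
    · rintro f f' _ _ rfl rfl
      exact add_zero 0
    · rintro f _ rfl
      exact neg_zero
  apply hP
  rw [IsZero.iff_id_eq_zero, ← hab]
  exact Finset.sum_eq_zero fun k _ => by rw [h0, comp_zero]

theorem pow_eq_zero_of_mem_commonKer (hN : commonKer χ ^ N ⊆ {0}) {r : A} (hr : r ∈ commonKer χ) :
    r ^ N = 0 := hN (Set.pow_mem_pow hr)

variable [DecidableEq V] {e : V → A}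

/-- An indecomposable projective is given by one of the idempotents. -/
theorem exists_splitting_idem (hN : commonKer χ ^ N ⊆ {0}) (he : ∀ v, e v * e v = e v)
    (hχ : ∀ i j, χ i (e j) = if i = j then 1 else 0) {P : ModuleCat.{u} Aᵐᵒᵖ} (hP : FGProj P)
    (hP' : Indecomposable P) :
    ∃ (v : V) (M : ModuleCat.{u} Aᵐᵒᵖ) (s : RegularSplitting P M), s.idem = e v := by
  obtain ⟨n, a, b, hab⟩ := hP.exists_sum_regular
  obtain ⟨k, l, hkl⟩ := exists_notMem_commonKer hN hP'.1 a b hab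
  set x : A := (b k ≫ a l).hom (1 : A) with hx
  have hx' : b k ≫ a l = regHom (x) := eq_elemHom _
  obtain ⟨v, hv⟩ : ∃ v, χ v x ≠ 0 := by
    by_contra! h
    exact hkl h
  set t : K := χ v x with ht
  -- The corner element `e v * x * e v` equals `t` times `e v * (1 - r)` with `r` in the nilpotent
  -- common kernel, so a geometric series gives a right inverse `w` of it relative to `e v`.
  set r : A := e v - algebraMap K A t⁻¹ * (e v * x * e v) with hr
  have hrJ : r ∈ commonKer χ := by
    intro j
    rw [hr, map_sub, map_mul, map_mul, map_mul, hχ]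
    by_cases hj : j = v
    · subst hj
      simp [← ht, inv_mul_cancel₀ hv]
    · simp [hj]
  set u : A := ∑ m ∈ Finset.range N, r ^ m with hu
  have hu1 : (1 - r) * u = 1 := by
    rw [hu, mul_neg_geom_sum, pow_eq_zero_of_mem_commonKer hN hrJ, sub_zero]
  have hc : e v * x * e v = algebraMap K A t * (e v * (1 - r)) := by
    have h1 : e v * r = r := by
      rw [hr, mul_sub, he, ← mul_assoc (e v), ← Algebra.commutes, mul_assoc (algebraMap K A t⁻¹),
        ← mul_assoc (e v) (e v * x), ← mul_assoc (e v) (e v), he]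
    rw [mul_sub, mul_one, h1, hr, sub_sub_cancel, ← mul_assoc, ← map_mul, mul_inv_cancel₀ hv,
      map_one, one_mul]
  set w : A := u * algebraMap K A t⁻¹ with hw
  have hcw : (e v * x * e v) * w = e v := by
    rw [hc, hw, ← mul_assoc, mul_assoc (algebraMap K A t), mul_assoc (e v), hu1, mul_one,
      Algebra.commutes t, mul_assoc, ← map_mul, mul_inv_cancel₀ hv, map_one, mul_one]
  let E : ModuleCat.of Aᵐᵒᵖ A ⟶ ModuleCat.of Aᵐᵒᵖ A := regHom (e v)
  have hE : E ≫ E = E := regHom_comp.trans (by rw [he])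
  let p : ModuleCat.of Aᵐᵒᵖ A ⟶ P := regHom (w) ≫ E ≫ b k
  let i : P ⟶ ModuleCat.of Aᵐᵒᵖ A := a l ≫ E
  have hpi : p ≫ i = E := by
    have h1 : p ≫ i = regHom (w) ≫ (E ≫ (b k ≫ a l)) ≫ E := by
      simp only [p, i, Category.assoc]
    have h2 : (E ≫ (b k ≫ a l)) ≫ E = regHom (e v * x * e v) := by
      rw [hx']
      refine (congrArg (fun φ => φ ≫ E) regHom_comp).trans (regHom_comp.trans ?_)
      rw [mul_assoc]
    rw [h1, h2]
    exact regHom_comp.trans (by rw [hcw])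
  have hiE : i ≫ E = i := by rw [Category.assoc, hE]
  have hip : i ≫ p = 𝟙 P := by
    -- Since `p ≫ i = E`, the composite `i ≫ p` is an idempotent of `P`, and it is nonzero because
    -- `E` is.
    refine (eq_zero_or_eq_id_of_indecomposable hP' (i ≫ p) ?_).resolve_left fun h0 => ?_
    · rw [Category.assoc, ← Category.assoc p, hpi, ← Category.assoc, hiE]
    · have hE0 : E = 0 := by
        rw [← hE, ← hpi, Category.assoc, ← Category.assoc i, h0, zero_comp, comp_zero]
      have h2 : e v = 0 := (regHom_apply_one (e v)).symm.trans
        (congrArg (fun φ => φ.hom (1 : A)) hE0)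
      have h3 := hχ v v
      rw [h2, map_zero, if_pos rfl] at h3
      exact zero_ne_one h3
  obtain ⟨M, j, q, h1, h2⟩ := IsIdempotentComplete.idempotents_split (ModuleCat.of Aᵐᵒᵖ A)
    (𝟙 _ - p ≫ i) (by
      simp only [hpi, Preadditive.comp_sub, Preadditive.sub_comp, Category.comp_id,
        Category.id_comp, hE, sub_self, sub_zero])
  refine ⟨v, M, ⟨i, p, j, q, hip, h1, by rw [h2, add_sub_cancel]⟩, ?_⟩
  change (p ≫ i).hom (1 : A) = e v
  rw [hpi]
  exact regHom_apply_one (e v)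

/-- `End P` is the corner ring of `e v`, embedded in `A` by `α`. A radical endomorphism is killed by
`χ v` by definition, and by the other characters because they kill `e v`; so its image lies in the
nilpotent common kernel. -/
theorem RegularSplitting.radNilpotent (hN : commonKer χ ^ N ⊆ {0})
    (hχ : ∀ i j, χ i (e j) = if i = j then 1 else 0) {P M : ModuleCat.{u} Aᵐᵒᵖ}
    (s : RegularSplitting P M) (v : V) (hs : s.idem = e v) : s.RadNilpotent (χ v) := by
  let α : (P ⟶ P) → A := fun f => (s.p ≫ f ≫ s.i).hom (1 : A)
  have hα : ∀ f, s.p ≫ f ≫ s.i = regHom (α f) := fun f => eq_elemHom _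
  have hmul : ∀ f g, α (f ≫ g) = α g * α f := by
    intro f g
    have h1 : s.p ≫ (f ≫ g) ≫ s.i = (s.p ≫ f ≫ s.i) ≫ s.p ≫ g ≫ s.i := by
      simp only [Category.assoc, reassoc_of% s.i_p]
    have h2 : s.p ≫ (f ≫ g) ≫ s.i = regHom (α g * α f) := by
      rw [h1, hα, hα]
      exact regHom_comp
    change (s.p ≫ (f ≫ g) ≫ s.i).hom (1 : A) = _
    rw [h2]
    exact regHom_apply_one _
  have hrad : ∀ f ∈ s.rad (χ v), α f ∈ commonKer χ := by
    intro f hf j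
    by_cases hj : j = v
    · subst hj
      rw [← charProj_apply_eq_zero_iff]
      have h1 : f ≫ s.i ≫ charProj (χ j) = 0 := hf
      change ((s.p ≫ f ≫ s.i) ≫ charProj (χ j)).hom (1 : A) = 0
      rw [Category.assoc, Category.assoc, h1, comp_zero]
      rfl
    · have h1 : α f = e v * α f := by
        have h2 : s.p ≫ f ≫ s.i = (s.p ≫ f ≫ s.i) ≫ s.p ≫ s.i := by
          simp only [Category.assoc, reassoc_of% s.i_p]
        have h3 : s.p ≫ f ≫ s.i = regHom (e v * α f) := by
          rw [h2, hα, s.comp_i_eq, hs]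
          exact regHom_comp
        change (s.p ≫ f ≫ s.i).hom (1 : A) = _
        rw [h3]
        exact regHom_apply_one _
      rw [h1, map_mul, hχ, if_neg hj, zero_mul]
  have hpow : ∀ n, ∀ f ∈ s.rad (χ v) ^ (n + 1), α f ∈ commonKer χ ^ (n + 1) := by
    intro n
    induction n with
    | zero =>
      intro f hf
      rw [zero_add, pow_one] at hf ⊢
      exact hrad f hf
    | succ n ih =>
      intro f hf
      rw [pow_succ] at hf ⊢
      obtain ⟨f, hf, g, hg, rfl⟩ := hf
      change α (g ≫ f) ∈ _
      rw [hmul]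
      exact Set.mul_mem_mul (ih f hf) (hrad g hg)
  -- `α` sends the identity to `e v` rather than to `1`, so `hpow` covers only positive exponents;
  -- hence `N + 1`.
  refine ⟨N + 1, fun f hf => ?_⟩
  have h1 := hpow N f hf
  rw [pow_succ] at h1
  obtain ⟨x, hx, y, -, hxy⟩ := h1
  have h2 : α f = 0 := by
    rw [← hxy, show x = 0 from hN hx]
    exact zero_mul y
  have h3 : f = s.i ≫ (s.p ≫ f ≫ s.i) ≫ s.p := by
    simp only [Category.assoc, reassoc_of% s.i_p, s.i_p]
    exact (Category.comp_id f).symm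
  have h4 : s.p ≫ f ≫ s.i = 0 := by
    rw [hα, h2]
    exact elemHom_zero
  rw [h4, zero_comp, comp_zero] at h3
  exact h3

/-- The sign decomposition for an algebra with an involution fixing primitive idempotents. -/
theorem TwoSilt.sign_decomposition_of_idempotents [StarRing A] [FiniteDimensional K A]
    (hN : commonKer χ ^ N ⊆ {0}) (he : ∀ v, e v * e v = e v) (hs : ∀ v, star (e v) = e v)
    (hχ : ∀ i j, χ i (e j) = if i = j then 1 else 0) {P : ModuleCat.{u} Aᵐᵒᵖ} (hP : FGProj P)
    (hP' : Indecomposable P) :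
    (∃ f : minus P ≃ plus P, ∀ S T, S.1 ≤ T.1 ↔ (f T).1 ≤ (f S).1) ∧
      Cardinal.mk (TwoSilt A) = 2 * Cardinal.mk (minus P) := by
  have : IsArtinianRing Aᵐᵒᵖ := isArtinian_of_tower K inferInstance
  obtain ⟨v, M, s, hv⟩ := exists_splitting_idem hN he hχ hP hP'
  exact sign_decomposition s (approxFinite K) (χ := χ v) (by rw [hv, hχ, if_pos rfl])
    (by rw [hv, hs]) (s.radNilpotent hN hχ v hv)

end PrimitiveIdempotents

/-! ### Quotients of path algebras: length filtration, reversal, characters of vertices. -/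

namespace PathAlgebra

section Structure

variable {K : Type u} [Field K] {W : Type v} [Quiver.{w} W]

/-- The linear map on the path algebra with prescribed values on paths. -/
def linearExt {M : Type*} [AddCommGroup M] [Module K M]
    (f : (i : W) × (j : W) × Quiver.Path i j → M) : PathAlgebra K W →ₗ[K] M :=
  Finsupp.linearCombination K f

theorem linearExt_ofPath {M : Type*} [AddCommGroup M] [Module K M]
    (f : (i : W) × (j : W) × Quiver.Path i j → M) {i j : W} (p : Quiver.Path i j) :
    linearExt f (ofPath K p) = f ⟨i, j, p⟩ :=
  (Finsupp.linearCombination_single K 1 _).trans (one_smul K _)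

/-- The linear combinations of paths of length at least `n`. -/
def pathsGE (K : Type u) [Field K] (W : Type v) [Quiver.{w} W] (n : ℕ) :
    Submodule K (PathAlgebra K W) :=
  Submodule.span K {y | ∃ (i j : W) (p : Quiver.Path i j), n ≤ p.length ∧ y = ofPath K p}

theorem ofPath_mem_pathsGE {n : ℕ} {i j : W} (p : Quiver.Path i j) (h : n ≤ p.length) :
    ofPath K p ∈ pathsGE K W n :=
  Submodule.subset_span ⟨i, j, p, h, rfl⟩

theorem mul_mem_pathsGE {m n : ℕ} {x y : PathAlgebra K W} (hx : x ∈ pathsGE K W m)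
    (hy : y ∈ pathsGE K W n) : x * y ∈ pathsGE K W (m + n) := by
  induction hx using Submodule.span_induction with
  | zero => rw [zero_mul]; exact zero_mem _
  | add x x' _ _ h h' => rw [add_mul]; exact add_mem h h'
  | smul c x _ h => rw [smul_mul_assoc]; exact Submodule.smul_mem _ c h
  | mem x hx =>
    obtain ⟨i, j, p, hp, rfl⟩ := hx
    induction hy using Submodule.span_induction with
    | zero => rw [mul_zero]; exact zero_mem _
    | add y y' _ _ h h' => rw [mul_add]; exact add_mem h h'
    | smul c y _ h => rw [mul_smul_comm]; exact Submodule.smul_mem _ c h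
    | mem y hy =>
      obtain ⟨k, l, q, hq, rfl⟩ := hy
      by_cases hjk : j = k
      · subst hjk
        rw [ofPath_mul_ofPath]
        exact ofPath_mem_pathsGE _ (by rw [Quiver.Path.length_comp]; omega)
      · rw [ofPath_mul_ofPath_of_ne _ _ hjk]
        exact zero_mem _

theorem finite_paths_length_eq [Finite W] [∀ i j : W, Finite (i ⟶ j)] (n : ℕ) :
    {p : (i : W) × (j : W) × Quiver.Path i j | p.2.2.length = n}.Finite := by
  induction n with
  | zero =>
    refine (Set.finite_range fun i : W =>
      (⟨i, i, Quiver.Path.nil⟩ : (i : W) × (j : W) × Quiver.Path i j)).subset ?_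
    rintro ⟨i, j, p⟩ hp
    cases p with
    | nil => exact ⟨i, rfl⟩
    | cons p e => exact absurd hp (by simp)
  | succ n ih =>
    refine (ih.biUnion fun q _ => Set.finite_range fun e : (k : W) × (q.2.1 ⟶ k) =>
      (⟨q.1, e.1, q.2.2.cons e.2⟩ : (i : W) × (j : W) × Quiver.Path i j)).subset ?_
    rintro ⟨i, j, p⟩ hp
    cases p with
    | nil => exact absurd hp (by simp)
    | cons p e =>
      exact Set.mem_biUnion (x := ⟨i, _, p⟩) (by simpa using hp) ⟨⟨j, e⟩, rfl⟩

theorem finite_paths_length_lt [Finite W] [∀ i j : W, Finite (i ⟶ j)] (n : ℕ) :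
    {p : (i : W) × (j : W) × Quiver.Path i j | p.2.2.length < n}.Finite := by
  refine ((Set.finite_lt_nat n).biUnion fun m _ => finite_paths_length_eq m).subset ?_
  intro p hp
  exact Set.mem_biUnion (x := p.2.2.length) hp rfl

section Reverse

variable [Quiver.HasInvolutiveReverse W]

/-- The linear map reversing paths. -/
def pathStar : PathAlgebra K W →ₗ[K] PathAlgebra K W :=
  linearExt fun p => ofPath K p.2.2.reverse

theorem pathStar_ofPath {i j : W} (p : Quiver.Path i j) :
    pathStar (ofPath K p) = ofPath K p.reverse :=
  linearExt_ofPath _ p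

theorem pathStar_pathStar (x : PathAlgebra K W) : pathStar (pathStar x) = x := by
  induction x using induction_path with
  | zero => simp only [map_zero]
  | add x y hx hy => simp only [map_add, hx, hy]
  | smul c i j p => simp only [map_smul, pathStar_ofPath, Quiver.Path.reverse_reverse]

theorem pathStar_mul (x y : PathAlgebra K W) :
    pathStar (x * y) = pathStar y * pathStar x := by
  induction x using induction_path with
  | zero => simp only [map_zero, zero_mul, mul_zero]
  | add x x' hx hx' => simp only [map_add, add_mul, mul_add, hx, hx']
  | smul c i j p =>
    induction y using induction_path with
    | zero => simp only [map_zero, zero_mul, mul_zero]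
    | add y y' hy hy' => simp only [map_add, add_mul, mul_add, hy, hy']
    | smul d k l q =>
      simp only [smul_mul_assoc, mul_smul_comm, map_smul, pathStar_ofPath]
      rw [smul_comm]
      by_cases h : j = k
      · subst h
        rw [ofPath_mul_ofPath, ofPath_mul_ofPath, pathStar_ofPath, Quiver.Path.reverse_comp]
      · rw [ofPath_mul_ofPath_of_ne _ _ h, ofPath_mul_ofPath_of_ne _ _ (Ne.symm h), map_zero]

theorem pathStar_mem_span [Fintype W] {R : Set (PathAlgebra K W)}
    (h : ∀ x ∈ R, pathStar x ∈ TwoSidedIdeal.span R) {x : PathAlgebra K W}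
    (hx : x ∈ TwoSidedIdeal.span R) : pathStar x ∈ TwoSidedIdeal.span R := by
  induction hx using TwoSidedIdeal.span_induction with
  | mem x hx => exact h x hx
  | zero => rw [map_zero]; exact zero_mem _
  | add x y _ _ hx hy => rw [map_add]; exact add_mem hx hy
  | neg x _ hx => rw [map_neg]; exact neg_mem hx
  | left_absorb a x _ hx =>
    rw [pathStar_mul]
    exact TwoSidedIdeal.mul_mem_right _ _ _ hx
  | right_absorb b x _ hx =>
    rw [pathStar_mul]
    exact TwoSidedIdeal.mul_mem_left _ _ _ hx

end Reverse

section Augmentation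

variable [Fintype W]

open Classical in
/-- The coefficient of the trivial path at `v`, as an algebra homomorphism. -/
def nilCoeff (v : W) : PathAlgebra K W →ₐ[K] K :=
  AlgHom.ofLinearMap
    (linearExt fun p : (i : W) × (j : W) × Quiver.Path i j =>
      if p.1 = v ∧ p.2.2.length = 0 then (1 : K) else 0)
    (by
      rw [one_def, map_sum]
      simp only [linearExt_ofPath]
      simp)
    (by
      intro x y
      induction x using induction_path with
      | zero => simp only [map_zero, zero_mul]
      | add x x' hx hx' => simp only [map_add, add_mul, hx, hx']
      | smul c i j p =>
        induction y using induction_path with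
        | zero => simp only [map_zero, mul_zero]
        | add y y' hy hy' => simp only [map_add, mul_add, hy, hy']
        | smul d k l q =>
          simp only [smul_mul_assoc, mul_smul_comm, map_smul]
          congr 2
          by_cases h : j = k
          · subst h
            rw [ofPath_mul_ofPath]
            simp only [linearExt_ofPath, Quiver.Path.length_comp, Nat.add_eq_zero_iff]
            by_cases hp : p.length = 0
            · obtain rfl := Quiver.Path.eq_of_length_zero p hp
              by_cases hi : i = v <;> simp [hi, hp]
            · simp [hp]
          · rw [ofPath_mul_ofPath_of_ne _ _ h, map_zero]
            simp only [linearExt_ofPath]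
            by_cases hp : p.length = 0
            · obtain rfl := Quiver.Path.eq_of_length_zero p hp
              by_cases hi : i = v
              · subst hi
                simp [Ne.symm h]
              · simp [hi]
            · simp [hp])

open Classical in
theorem nilCoeff_ofPath (v : W) {i j : W} (p : Quiver.Path i j) :
    nilCoeff (K := K) v (ofPath K p) = if i = v ∧ p.length = 0 then 1 else 0 :=
  linearExt_ofPath _ p

theorem nilCoeff_of_mem_pathsGE {n : ℕ} (hn : 1 ≤ n) {x : PathAlgebra K W}
    (hx : x ∈ pathsGE K W n) (v : W) : nilCoeff v x = 0 := by
  induction hx using Submodule.span_induction with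
  | zero => exact map_zero _
  | add x y _ _ hx hy => rw [map_add, hx, hy, add_zero]
  | smul c x _ hx => rw [map_smul, hx, smul_zero]
  | mem x hx =>
    obtain ⟨i, j, p, hp, rfl⟩ := hx
    rw [nilCoeff_ofPath, if_neg]
    rintro ⟨-, h⟩
    omega

theorem sub_sum_nilCoeff_mem (x : PathAlgebra K W) :
    x - ∑ v : W, nilCoeff v x • ofPath K (Quiver.Path.nil : Quiver.Path v v) ∈
      pathsGE K W 1 := by
  classical
  induction x using induction_path with
  | zero => simp
  | add x y hx hy =>
    have h := add_mem hx hy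
    simp only [map_add, add_smul, Finset.sum_add_distrib]
    convert h using 1
    abel
  | smul c i j p =>
    simp only [map_smul, smul_assoc, ← Finset.smul_sum]
    rw [← smul_sub]
    refine Submodule.smul_mem _ c ?_
    simp only [nilCoeff_ofPath, ite_smul, one_smul, zero_smul]
    by_cases hp : p.length = 0
    · obtain rfl := Quiver.Path.eq_of_length_zero p hp
      obtain rfl := Quiver.Path.eq_nil_of_length_zero p hp
      simp
    · simp only [hp, and_false, if_false, Finset.sum_const_zero, sub_zero]
      exact ofPath_mem_pathsGE p (by omega)

theorem mem_pathsGE_one {x : PathAlgebra K W} (hx : ∀ v, nilCoeff v x = 0) :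
    x ∈ pathsGE K W 1 := by
  have h := sub_sum_nilCoeff_mem x
  simpa [hx] using h

theorem nilCoeff_of_mem_span {R : Set (PathAlgebra K W)}
    (h : ∀ x ∈ R, ∀ v, nilCoeff v x = 0) {x : PathAlgebra K W}
    (hx : x ∈ TwoSidedIdeal.span R) (v : W) : nilCoeff v x = 0 := by
  have h1 : TwoSidedIdeal.span R ≤ TwoSidedIdeal.ker (nilCoeff (K := K) v) :=
    TwoSidedIdeal.span_le.2 fun y hy => (TwoSidedIdeal.mem_ker _).2 (h y hy v)
  exact (TwoSidedIdeal.mem_ker _).1 (h1 hx)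

theorem smul_mem_ideal (J : TwoSidedIdeal (PathAlgebra K W)) (c : K) {x : PathAlgebra K W}
    (hx : x ∈ J) : c • x ∈ J := by
  rw [Algebra.smul_def]
  exact J.mul_mem_left _ _ hx

theorem pathsGE_le {J : TwoSidedIdeal (PathAlgebra K W)} {n : ℕ}
    (h : ∀ (i j : W) (p : Quiver.Path i j), n ≤ p.length → ofPath K p ∈ J)
    {x : PathAlgebra K W} (hx : x ∈ pathsGE K W n) : x ∈ J := by
  induction hx using Submodule.span_induction with
  | zero => exact zero_mem _
  | add x y _ _ hx hy => exact add_mem hx hy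
  | smul c x _ hx => exact smul_mem_ideal J c hx
  | mem x hx =>
    obtain ⟨i, j, p, hp, rfl⟩ := hx
    exact h i j p hp

end Augmentation

section Quotient

variable [Fintype W] (J : TwoSidedIdeal (PathAlgebra K W))

theorem quotient_coe_eq_zero {x : PathAlgebra K W} :
    (x : J.ringCon.Quotient) = 0 ↔ x ∈ J := by
  rw [← RingCon.coe_zero, RingCon.eq]
  exact Iff.rfl

/-- The classes of the finitely many paths of length less than `n` span. -/
theorem finite_quotient [∀ i j : W, Finite (i ⟶ j)] {n : ℕ}
    (h : ∀ (i j : W) (p : Quiver.Path i j), n ≤ p.length → ofPath K p ∈ J) :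
    FiniteDimensional K J.ringCon.Quotient := by
  refine ⟨Submodule.fg_def.2 ⟨_, (finite_paths_length_lt (W := W) n).image
    fun p => ((ofPath K p.2.2 : PathAlgebra K W) : J.ringCon.Quotient), ?_⟩⟩
  rw [eq_top_iff]
  rintro x -
  obtain ⟨x, rfl⟩ := J.ringCon.mk'_surjective x
  induction x using induction_path with
  | zero => rw [map_zero]; exact zero_mem _
  | add x y hx hy => rw [map_add]; exact add_mem hx hy
  | smul c i j p =>
    change c • (J.ringCon.mk' (ofPath K p)) ∈ _
    refine Submodule.smul_mem _ c ?_
    by_cases hp : n ≤ p.length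
    · rw [show J.ringCon.mk' (ofPath K p) = 0 from (quotient_coe_eq_zero J).2 (h i j p hp)]
      exact zero_mem _
    · exact Submodule.subset_span ⟨⟨i, j, p⟩, not_le.1 hp, rfl⟩

variable {J}

/-- The character of a quotient of the path algebra by an ideal inside the arrow ideal. -/
def quotientCharacter (h : ∀ x ∈ J, ∀ v, nilCoeff v x = 0) (v : W) :
    J.ringCon.Quotient →ₐ[K] K :=
  RingCon.liftₐ J.ringCon (nilCoeff v) fun x y hxy => by
    have h1 := h _ ((J.rel_iff x y).1 hxy) v
    rw [map_sub, sub_eq_zero] at h1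
    exact h1

-- An element killed by all vertex characters lifts to the arrow ideal, and a product of `n` such
-- lifts consists of paths of length at least `n`.
open scoped Pointwise in
theorem commonKer_pow_subset (h : ∀ x ∈ J, ∀ v, nilCoeff v x = 0) (n : ℕ) :
    commonKer (quotientCharacter h) ^ n ⊆ J.ringCon.mk' '' (pathsGE K W n) := by
  induction n with
  | zero =>
    rw [pow_zero]
    rintro _ rfl
    refine ⟨1, ?_, map_one _⟩
    rw [one_def]
    exact sum_mem fun i _ => ofPath_mem_pathsGE _ (Nat.zero_le _)
  | succ n ih =>
    rw [pow_succ]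
    rintro _ ⟨a, ha, b, hb, rfl⟩
    obtain ⟨x, hx, rfl⟩ := ih ha
    obtain ⟨y, rfl⟩ := J.ringCon.mk'_surjective b
    exact ⟨x * y, mul_mem_pathsGE hx (mem_pathsGE_one fun v => hb v), map_mul _ _ _⟩

/-- The involution of a quotient of the path algebra induced by the reversal of paths. -/
abbrev quotientStarRing [Quiver.HasInvolutiveReverse W] (h : ∀ x ∈ J, pathStar x ∈ J) :
    StarRing J.ringCon.Quotient where
  star := Quotient.map' pathStar fun x y hxy => by
    have h1 := h _ ((J.rel_iff x y).1 hxy)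
    rw [map_sub] at h1
    exact (J.rel_iff _ _).2 h1
  star_involutive := by
    intro x
    obtain ⟨x, rfl⟩ := J.ringCon.mk'_surjective x
    exact congrArg J.ringCon.mk' (pathStar_pathStar x)
  star_mul := by
    intro x y
    obtain ⟨x, rfl⟩ := J.ringCon.mk'_surjective x
    obtain ⟨y, rfl⟩ := J.ringCon.mk'_surjective y
    exact congrArg J.ringCon.mk' (pathStar_mul x y)
  star_add := by
    intro x y
    obtain ⟨x, rfl⟩ := J.ringCon.mk'_surjective x
    obtain ⟨y, rfl⟩ := J.ringCon.mk'_surjective y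
    exact congrArg J.ringCon.mk' (map_add pathStar x y)

/-- The sign decomposition for a finite-dimensional quotient of a path algebra by an ideal which
is stable under the reversal of paths. -/
theorem sign_decomposition [∀ i j : W, Finite (i ⟶ j)] [Quiver.HasInvolutiveReverse W]
    (hstar : ∀ x ∈ J, pathStar x ∈ J) (hnil : ∀ x ∈ J, ∀ v, nilCoeff v x = 0)
    (hJ : ∃ n, ∀ (i j : W) (p : Quiver.Path i j), n ≤ p.length → ofPath K p ∈ J)
    {P : ModuleCat.{max u v w} (J.ringCon.Quotient)ᵐᵒᵖ} (hP : FGProj P)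
    (hP' : Indecomposable P) :
    (∃ f : TwoSilt.minus P ≃ TwoSilt.plus P, ∀ S T, S.1 ≤ T.1 ↔ (f T).1 ≤ (f S).1) ∧
      Cardinal.mk (TwoSilt J.ringCon.Quotient) = 2 * Cardinal.mk (TwoSilt.minus P) := by
  classical
  obtain ⟨n, hn⟩ := hJ
  let _ : StarRing J.ringCon.Quotient := quotientStarRing hstar
  have : FiniteDimensional K J.ringCon.Quotient := finite_quotient J hn
  refine TwoSilt.sign_decomposition_of_idempotents (K := K) (χ := quotientCharacter hnil)
    (e := fun v => J.ringCon.mk' (ofPath K (Quiver.Path.nil : Quiver.Path v v))) (N := n)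
    ?_ ?_ ?_ ?_ hP hP'
  · intro a ha
    obtain ⟨x, hx, rfl⟩ := commonKer_pow_subset hnil n ha
    exact (quotient_coe_eq_zero J).2 (pathsGE_le hn hx)
  · intro v
    rw [← map_mul, ofPath_mul_ofPath]
    rfl
  · intro v
    exact congrArg J.ringCon.mk' (pathStar_ofPath _)
  · intro i j
    refine (nilCoeff_ofPath i _).trans ?_
    by_cases h : i = j
    · simp [h]
    · simp [h, Ne.symm h]

end Quotient

end Structure

end PathAlgebra

/-! ### The double quiver and the algebra `Λ(Q, I)`. -/

section DoubleQuiver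

variable {K : Type u} [Field K] {V : Type v} [Quiver.{w} V]

open PathAlgebra

theorem Prefunctor.length_mapPath {U : Type*} [Quiver U] {U' : Type*} [Quiver U']
    (F : U ⥤q U') {i j : U} (p : Quiver.Path i j) : (F.mapPath p).length = p.length := by
  induction p with
  | nil => rfl
  | cons p e ih => exact congrArg (· + 1) ih

theorem Quiver.Path.length_reverse {U : Type*} [Quiver U] [Quiver.HasReverse U] {i j : U}
    (p : Quiver.Path i j) : p.reverse.length = p.length := by
  induction p with
  | nil => rfl
  | cons p e ih =>
    rw [Quiver.Path.reverse, Quiver.Path.length_comp, ih, Quiver.Path.length_toPath,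
      Quiver.Path.length_cons, add_comm]

instance [h : ∀ i j : V, Finite (i ⟶ j)] (i j : Quiver.Symmetrify V) : Finite (i ⟶ j) :=
  @Finite.instSum _ _ (h i j) (h j i)

theorem pathStar_dblArrow {i j : V} (a : i ⟶ j) :
    pathStar (dblArrow K a) = dblArrowStar K a :=
  pathStar_ofPath _

theorem pathStar_dblArrowStar {i j : V} (a : i ⟶ j) :
    pathStar (dblArrowStar K a) = dblArrow K a :=
  pathStar_ofPath _

theorem dblArrow_mul_dblArrowStar_mem {i j k l : V} (a : i ⟶ j) (b : k ⟶ l) :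
    dblArrow K a * dblArrowStar K b ∈ pathsGE K (Quiver.Symmetrify V) 2 :=
  mul_mem_pathsGE (m := 1) (n := 1) (ofPath_mem_pathsGE _ le_rfl) (ofPath_mem_pathsGE _ le_rfl)

theorem dblArrowStar_mul_dblArrow_mem {i j k l : V} (a : i ⟶ j) (b : k ⟶ l) :
    dblArrowStar K a * dblArrow K b ∈ pathsGE K (Quiver.Symmetrify V) 2 :=
  mul_mem_pathsGE (m := 1) (n := 1) (ofPath_mem_pathsGE _ le_rfl) (ofPath_mem_pathsGE _ le_rfl)

/-- A path, as a path of the double quiver. -/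
def Quiver.Path.toDouble {i j : V} (p : Quiver.Path i j) :
    Quiver.Path (V := Quiver.Symmetrify V) i j :=
  Quiver.Symmetrify.of.mapPath p

theorem Quiver.Path.length_toDouble {i j : V} (p : Quiver.Path i j) :
    p.toDouble.length = p.length :=
  Prefunctor.length_mapPath _ p

theorem dblPath_ofPath {i j : V} (p : Quiver.Path i j) :
    dblPath (ofPath K p) = ofPath K p.toDouble :=
  linearExt_ofPath _ p

theorem dblPathStar_ofPath {i j : V} (p : Quiver.Path i j) :
    dblPathStar (ofPath K p) = ofPath K p.toDouble.reverse :=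
  linearExt_ofPath _ p

theorem pathStar_dblPath (x : PathAlgebra K V) : pathStar (dblPath x) = dblPathStar x := by
  induction x using induction_path with
  | zero => simp only [map_zero]
  | add x y hx hy => simp only [map_add, hx, hy]
  | smul c i j p =>
    simp only [map_smul, dblPath_ofPath, dblPathStar_ofPath]
    exact congrArg (c • ·) (pathStar_ofPath _)

theorem pathStar_dblPathStar (x : PathAlgebra K V) : pathStar (dblPathStar x) = dblPath x := by
  rw [← pathStar_dblPath, pathStar_pathStar]

theorem dblPath_ofPath_cons {i j k : V} (p : Quiver.Path i j) (a : j ⟶ k) :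
    dblPath (ofPath K (p.cons a)) = dblPath (ofPath K p) * dblArrow K a := by
  rw [dblPath_ofPath, dblPath_ofPath]
  exact (ofPath_mul_ofPath (K := K) (V := Quiver.Symmetrify V) p.toDouble
    (Quiver.Hom.toPath (V := Quiver.Symmetrify V) a.toPos)).symm

theorem dblPath_ofPath_toPath_comp {i j k : V} (a : i ⟶ j) (p : Quiver.Path j k) :
    dblPath (ofPath K (a.toPath.comp p)) = dblArrow K a * dblPath (ofPath K p) := by
  rw [dblPath_ofPath, dblPath_ofPath, Quiver.Path.toDouble, Prefunctor.mapPath_comp]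
  exact (ofPath_mul_ofPath (K := K) (V := Quiver.Symmetrify V)
    (Quiver.Hom.toPath (V := Quiver.Symmetrify V) a.toPos) p.toDouble).symm

theorem dblPathStar_ofPath_toPath_comp {i j k : V} (a : i ⟶ j) (p : Quiver.Path j k) :
    dblPathStar (ofPath K (a.toPath.comp p)) =
      dblPathStar (ofPath K p) * dblArrowStar K a := by
  rw [← pathStar_dblPath, dblPath_ofPath_toPath_comp, pathStar_mul, pathStar_dblArrow,
    pathStar_dblPath]

theorem dblPath_nil_mul_dblArrowStar {i j : V} (a : i ⟶ j) :
    dblPath (ofPath K (Quiver.Path.nil : Quiver.Path j j)) * dblArrowStar K a =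
      dblArrowStar K a * dblPath (ofPath K (Quiver.Path.nil : Quiver.Path i i)) := by
  rw [dblPath_ofPath, dblPath_ofPath]
  exact (ofPath_mul_ofPath (V := Quiver.Symmetrify V) _ _).trans
    (ofPath_mul_ofPath (K := K) (V := Quiver.Symmetrify V)
      (Quiver.Hom.toPath (V := Quiver.Symmetrify V) a.toNeg) Quiver.Path.nil).symm

theorem dblPathStar_nil_mul_dblPath_nil (i : V) :
    dblPathStar (ofPath K (Quiver.Path.nil : Quiver.Path i i)) *
      dblPath (ofPath K (Quiver.Path.nil : Quiver.Path i i)) =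
        ofPath K (Quiver.Path.nil : Quiver.Path (V := Quiver.Symmetrify V) i i) := by
  rw [dblPath_ofPath, dblPathStar_ofPath]
  exact ofPath_mul_ofPath (V := Quiver.Symmetrify V) _ _

theorem ofPath_cons_inl {i j k : Quiver.Symmetrify V} (p : Quiver.Path i j)
    (a : Quiver.Hom (V := V) j k) :
    ofPath K (p.cons (Sum.inl a : j ⟶ k)) = ofPath K p * dblArrow (V := V) K a :=
  (ofPath_mul_ofPath p (Quiver.Hom.toPath (Sum.inl a : j ⟶ k))).symm

theorem ofPath_cons_inr {i j k : Quiver.Symmetrify V} (p : Quiver.Path i j)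
    (a : Quiver.Hom (V := V) k j) :
    ofPath K (p.cons (Sum.inr a : j ⟶ k)) = ofPath K p * dblArrowStar (V := V) K a :=
  (ofPath_mul_ofPath p (Quiver.Hom.toPath (Sum.inr a : j ⟶ k))).symm

theorem dblPath_mem_pathsGE {n : ℕ} {x : PathAlgebra K V} (hx : x ∈ pathsGE K V n) :
    dblPath x ∈ pathsGE K (Quiver.Symmetrify V) n := by
  induction hx using Submodule.span_induction with
  | zero => rw [map_zero]; exact zero_mem _
  | add x y _ _ hx hy => rw [map_add]; exact add_mem hx hy
  | smul c x _ hx => rw [map_smul]; exact Submodule.smul_mem _ c hx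
  | mem x hx =>
    obtain ⟨i, j, p, hp, rfl⟩ := hx
    rw [dblPath_ofPath]
    exact ofPath_mem_pathsGE _ (by rwa [Quiver.Path.length_toDouble])

theorem pathStar_mem_pathsGE {W : Type v} [Quiver.{w} W] [Quiver.HasInvolutiveReverse W] {n : ℕ}
    {x : PathAlgebra K W} (hx : x ∈ pathsGE K W n) : pathStar x ∈ pathsGE K W n := by
  induction hx using Submodule.span_induction with
  | zero => rw [map_zero]; exact zero_mem _
  | add x y _ _ hx hy => rw [map_add]; exact add_mem hx hy
  | smul c x _ hx => rw [map_smul]; exact Submodule.smul_mem _ c hx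
  | mem x hx =>
    obtain ⟨i, j, p, hp, rfl⟩ := hx
    rw [pathStar_ofPath]
    exact ofPath_mem_pathsGE _ (by rwa [Quiver.Path.length_reverse])

variable [Fintype V]

/-- Modulo the products `a * b^*`, every path is zero or of the form `q^* * r`. -/
theorem ofPath_mem_or_exists_eq_comp (J : TwoSidedIdeal (DoublePathAlgebra K V))
    (hJ : ∀ (i j k l : V) (a : i ⟶ j) (b : k ⟶ l), dblArrow K a * dblArrowStar K b ∈ J)
    {i j : Quiver.Symmetrify V} (p : Quiver.Path i j) :
    ofPath K p ∈ J ∨ ∃ (k : V) (q : Quiver.Path (V := V) k i) (r : Quiver.Path (V := V) k j),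
      p.length = q.length + r.length ∧
        ofPath K p = dblPathStar (ofPath K q) * dblPath (ofPath K r) := by
  induction p with
  | nil =>
    refine Or.inr ⟨i, Quiver.Path.nil, Quiver.Path.nil, rfl,
      (dblPathStar_nil_mul_dblPath_nil (V := V) i).symm⟩
  | cons p e ih =>
    obtain ih | ⟨k, q, r, hl, hp⟩ := ih
    · left
      obtain a | b := e
      · rw [ofPath_cons_inl]
        exact J.mul_mem_right _ _ ih
      · rw [ofPath_cons_inr]
        exact J.mul_mem_right _ _ ih
    · obtain a | b := e
      · refine Or.inr ⟨k, q, Quiver.Path.cons (V := V) r a, congrArg (· + 1) hl, ?_⟩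
        rw [ofPath_cons_inl, hp, mul_assoc]
        exact congrArg _ (dblPath_ofPath_cons (V := V) r a).symm
      -- Appending `b^*` to `q^* r`: if `r` is trivial, `b^*` is absorbed into the starred factor;
      -- otherwise `r` ends in some arrow `a` and the product `a b^*` lies in `J`.
      · cases r with
        | nil =>
          refine Or.inr ⟨_, Quiver.Path.comp (V := V) (Quiver.Hom.toPath (V := V) b) q,
            Quiver.Path.nil, ?_, ?_⟩
          · refine (congrArg (· + 1) hl).trans
              (Eq.trans ?_ (Quiver.Path.length_comp (V := V) _ q).symm)
            exact add_comm _ _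
          · rw [ofPath_cons_inr, hp, mul_assoc]
            exact ((congrArg _ (dblPath_nil_mul_dblArrowStar (V := V) b)).trans
              (mul_assoc _ _ _).symm).trans
              (congrArg (· * _) (dblPathStar_ofPath_toPath_comp (V := V) b q).symm)
        | cons r a =>
          left
          rw [ofPath_cons_inr, hp, mul_assoc]
          refine J.mul_mem_left _ _ ?_
          have h1 := dblPath_ofPath_cons (K := K) (V := V) r a
          refine (congrArg (fun z => z * _ ∈ J) h1).mpr ?_
          rw [mul_assoc]
          exact J.mul_mem_left _ _ (hJ _ _ _ _ a b)

theorem mem_pathsGE_of_isAdmissible {I : TwoSidedIdeal (PathAlgebra K V)} (hI : IsAdmissible I)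
    {x : PathAlgebra K V} (hx : x ∈ I) : x ∈ pathsGE K V 2 :=
  hI.2 x hx

/-- If all paths of length at least `m` lie in `I`, then in `q^* r` of length at least `2 * m` one
of `q`, `r` has length at least `m`. -/
theorem exists_ofPath_mem_dualExtension {I : TwoSidedIdeal (PathAlgebra K V)}
    (hI : IsAdmissible I) :
    ∃ n, ∀ (i j : Quiver.Symmetrify V) (p : Quiver.Path i j), n ≤ p.length →
      ofPath K p ∈ TwoSidedIdeal.span (dualExtensionRelations I) := by
  obtain ⟨⟨m, -, hm⟩, -⟩ := hI
  refine ⟨2 * m, fun i j p hp => ?_⟩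
  obtain h | ⟨k, q, r, hl, hqr⟩ := ofPath_mem_or_exists_eq_comp
    (TwoSidedIdeal.span (dualExtensionRelations I))
    (fun i j k l a b => TwoSidedIdeal.subset_span (Or.inr ⟨i, j, k, l, a, b, rfl⟩)) p
  · exact h
  rw [hqr]
  by_cases hr : m ≤ r.length
  · exact TwoSidedIdeal.mul_mem_left _ _ _ (TwoSidedIdeal.subset_span
      (Or.inl (Or.inl ⟨_, hm _ _ r hr, rfl⟩)))
  · exact TwoSidedIdeal.mul_mem_right _ _ _ (TwoSidedIdeal.subset_span
      (Or.inl (Or.inr ⟨_, hm _ _ q (by omega), rfl⟩)))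

/-- Reversal exchanges the relations `p` and `p^*` and sends `a b^*` to `b a^*`; all relations lie
in the square of the arrow ideal. -/
theorem dualExtension_sign_decomposition [∀ i j : V, Finite (i ⟶ j)]
    {I : TwoSidedIdeal (PathAlgebra K V)} (hI : IsAdmissible I)
    {P : ModuleCat.{max u v w} (DualExtensionAlgebra I)ᵐᵒᵖ} (hP : FGProj P)
    (hP' : Indecomposable P) :
    (∃ f : TwoSilt.minus P ≃ TwoSilt.plus P, ∀ S T, S.1 ≤ T.1 ↔ (f T).1 ≤ (f S).1) ∧
      Cardinal.mk (TwoSilt (DualExtensionAlgebra I)) = 2 * Cardinal.mk (TwoSilt.minus P) := by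
  refine PathAlgebra.sign_decomposition (K := K) (W := Quiver.Symmetrify V) ?_ ?_
    (exists_ofPath_mem_dualExtension hI) hP hP'
  · intro x hx
    refine pathStar_mem_span ?_ hx
    rintro x ((⟨p, hp, rfl⟩ | ⟨p, hp, rfl⟩) | ⟨i, j, k, l, a, b, rfl⟩) <;>
      refine TwoSidedIdeal.subset_span ?_
    · exact Or.inl (Or.inr ⟨p, hp, pathStar_dblPath p⟩)
    · exact Or.inl (Or.inl ⟨p, hp, pathStar_dblPathStar p⟩)
    · refine Or.inr ⟨k, l, i, j, b, a, ?_⟩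
      rw [pathStar_mul, pathStar_dblArrow, pathStar_dblArrowStar]
  · intro x hx v
    refine nilCoeff_of_mem_span ?_ hx v
    rintro x ((⟨p, hp, rfl⟩ | ⟨p, hp, rfl⟩) | ⟨i, j, k, l, a, b, rfl⟩)
    · exact nilCoeff_of_mem_pathsGE one_le_two
        (dblPath_mem_pathsGE (mem_pathsGE_of_isAdmissible hI hp))
    · rw [← pathStar_dblPath]
      exact nilCoeff_of_mem_pathsGE one_le_two
        (pathStar_mem_pathsGE (dblPath_mem_pathsGE (mem_pathsGE_of_isAdmissible hI hp)))
    · exact nilCoeff_of_mem_pathsGE one_le_two (dblArrow_mul_dblArrowStar_mem a b)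

end DoubleQuiver

/-! ### The symplectic form on representations of the double quiver. -/

section DoubleRepresentation

theorem two_mul_finrank_le_of_isotropic {K : Type*} [Field K] {T : Type*} [AddCommGroup T]
    [Module K T] [FiniteDimensional K T] {B : LinearMap.BilinForm K T} (hB : B.Nondegenerate)
    {U : Submodule K T} (hU : ∀ x ∈ U, ∀ y ∈ U, B x y = 0) :
    2 * Module.finrank K U ≤ Module.finrank K T := by
  have h1 := LinearMap.BilinForm.finrank_orthogonal hB U
  have h2 : U ≤ B.orthogonal U := fun y hy x hx => hU x hx y hy
  have h3 := Submodule.finrank_mono h2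
  have h4 := Submodule.finrank_le U
  omega

/-- Testing against the rank-one maps `y ↦ ξ y • x` gives `ξ (f x) = 0` for every functional `ξ`. -/
theorem LinearMap.eq_zero_of_trace_comp_eq_zero {K : Type*} [Field K] {M N : Type*}
    [AddCommGroup M] [Module K M] [FiniteDimensional K M] [AddCommGroup N] [Module K N]
    [FiniteDimensional K N] {f : M →ₗ[K] N}
    (h : ∀ g : N →ₗ[K] M, LinearMap.trace K N (f ∘ₗ g) = 0) : f = 0 := by
  ext x
  rw [LinearMap.zero_apply, ← Module.forall_dual_apply_eq_zero_iff K]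
  intro ξ
  have h1 := h (ξ.smulRight x)
  have h2 : f ∘ₗ ξ.smulRight x = ξ.smulRight (f x) := by
    ext y
    simp
  rwa [h2, LinearMap.trace_smulRight] at h1

variable {K : Type*} [Field K] {V E : Type*} [Fintype V] [Fintype E] (s t : E → V)
  (M : V → Type*) [∀ i, AddCommGroup (M i)] [∀ i, Module K (M i)]

/-- The representations of the double quiver with arrows `E` on the spaces `M i`. -/
abbrev DoubleRep (K : Type*) [Field K] {V E : Type*} (s t : E → V) (M : V → Type*)
    [∀ i, AddCommGroup (M i)] [∀ i, Module K (M i)] : Type _ :=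
  (a : E) → (M (s a) →ₗ[K] M (t a)) × (M (t a) →ₗ[K] M (s a))

/-- The symplectic form on the space of representations of the double quiver. -/
def DoubleRep.form : LinearMap.BilinForm K (DoubleRep K s t M) :=
  LinearMap.mk₂ K
    (fun x y => ∑ a, (LinearMap.trace K _ ((x a).1 ∘ₗ (y a).2) -
      LinearMap.trace K _ ((x a).2 ∘ₗ (y a).1)))
    (fun x x' y => by
      rw [← Finset.sum_add_distrib]
      refine Finset.sum_congr rfl fun a _ => ?_
      simp only [Pi.add_apply, Prod.fst_add, Prod.snd_add, LinearMap.add_comp, map_add]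
      abel)
    (fun c x y => by
      simp only [Pi.smul_apply, Prod.smul_fst, Prod.smul_snd, LinearMap.smul_comp, map_smul,
        Finset.smul_sum, smul_sub])
    (fun x y y' => by
      rw [← Finset.sum_add_distrib]
      refine Finset.sum_congr rfl fun a _ => ?_
      simp only [Pi.add_apply, Prod.fst_add, Prod.snd_add, LinearMap.comp_add, map_add]
      abel)
    (fun c x y => by
      simp only [Pi.smul_apply, Prod.smul_fst, Prod.smul_snd, LinearMap.comp_smul, map_smul,
        Finset.smul_sum, smul_sub])

theorem DoubleRep.form_apply (x y : DoubleRep K s t M) :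
    form s t M x y = ∑ a, (LinearMap.trace K _ ((x a).1 ∘ₗ (y a).2) -
      LinearMap.trace K _ ((x a).2 ∘ₗ (y a).1)) :=
  rfl

variable [∀ i, FiniteDimensional K (M i)]

theorem DoubleRep.form_isRefl : (form (K := K) s t M).IsRefl := by
  intro x y h
  rw [form_apply] at h ⊢
  rw [← neg_eq_zero, ← h, ← Finset.sum_neg_distrib]
  refine Finset.sum_congr rfl fun a _ => ?_
  rw [neg_sub, LinearMap.trace_comp_comm' (y a).2, LinearMap.trace_comp_comm' (y a).1]

theorem DoubleRep.form_nondegenerate : (form (K := K) s t M).Nondegenerate := by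
  classical
  suffices h : (form (K := K) s t M).SeparatingLeft from
    ⟨h, fun y hy => h y fun x => form_isRefl s t M x y (hy x)⟩
  intro x hx
  funext a
  have h1 : ∀ z : (M (s a) →ₗ[K] M (t a)) × (M (t a) →ₗ[K] M (s a)),
      LinearMap.trace K _ ((x a).1 ∘ₗ z.2) -
      LinearMap.trace K _ ((x a).2 ∘ₗ z.1) = 0 := by
    intro z
    have h := hx (Pi.single a z)
    rw [form_apply, Finset.sum_eq_single a] at h
    · simpa using h
    · intro b _ hb
      rw [Pi.single_eq_of_ne hb]
      simp
    · simp
  refine Prod.ext ?_ ?_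
  · refine LinearMap.eq_zero_of_trace_comp_eq_zero fun g => ?_
    simpa using h1 (0, g)
  · refine LinearMap.eq_zero_of_trace_comp_eq_zero fun g => ?_
    simpa using h1 (g, 0)

/-- The infinitesimal action of the endomorphisms of the spaces `M i` on a representation; its
kernel consists of the endomorphisms of the representation. -/
def DoubleRep.infAction {s t : E → V} {M : V → Type*} [∀ i, AddCommGroup (M i)]
    [∀ i, Module K (M i)] (x : DoubleRep K s t M) :
    ((i : V) → Module.End K (M i)) →ₗ[K] DoubleRep K s t M where
  toFun φ a := (φ (t a) ∘ₗ (x a).1 - (x a).1 ∘ₗ φ (s a), φ (s a) ∘ₗ (x a).2 - (x a).2 ∘ₗ φ (t a))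
  map_add' φ ψ := by
    funext a
    refine Prod.ext ?_ ?_ <;>
    · simp only [Pi.add_apply, LinearMap.add_comp, LinearMap.comp_add, Prod.fst_add, Prod.snd_add]
      abel
  map_smul' c φ := by
    funext a
    simp only [Pi.smul_apply, LinearMap.smul_comp, LinearMap.comp_smul, RingHom.id_apply,
      Prod.smul_mk, smul_sub]

variable {s t M}

/-- The contribution of one arrow to the symplectic pairing of two tangent vectors of an orbit: by
cyclicity of the trace, it is minus the moment map paired with the commutators of the acting
endomorphisms. -/
theorem trace_infAction_aux {M N : Type*} [AddCommGroup M] [Module K M]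
    [FiniteDimensional K M] [AddCommGroup N] [Module K N] [FiniteDimensional K N]
    (φ ψ : Module.End K M) (φ' ψ' : Module.End K N) (f : M →ₗ[K] N) (g : N →ₗ[K] M) :
    LinearMap.trace K N ((φ' ∘ₗ f - f ∘ₗ φ) ∘ₗ (ψ ∘ₗ g - g ∘ₗ ψ')) -
      LinearMap.trace K M ((φ ∘ₗ g - g ∘ₗ φ') ∘ₗ (ψ' ∘ₗ f - f ∘ₗ ψ)) =
    -(LinearMap.trace K M ((φ ∘ₗ ψ - ψ ∘ₗ φ) ∘ₗ g ∘ₗ f) -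
      LinearMap.trace K N ((φ' ∘ₗ ψ' - ψ' ∘ₗ φ') ∘ₗ f ∘ₗ g)) := by
  simp only [LinearMap.sub_comp, LinearMap.comp_sub, map_sub, LinearMap.comp_assoc]
  have h1 : LinearMap.trace K N (φ' ∘ₗ f ∘ₗ ψ ∘ₗ g) = LinearMap.trace K M (g ∘ₗ φ' ∘ₗ f ∘ₗ ψ) :=
    (LinearMap.trace_comp_comm' (φ' ∘ₗ f ∘ₗ ψ) g).symm
  have h2 : LinearMap.trace K N (f ∘ₗ φ ∘ₗ g ∘ₗ ψ') = LinearMap.trace K M (φ ∘ₗ g ∘ₗ ψ' ∘ₗ f) :=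
    (LinearMap.trace_comp_comm' f (φ ∘ₗ g ∘ₗ ψ')).symm
  have h3 : LinearMap.trace K N (φ' ∘ₗ f ∘ₗ g ∘ₗ ψ') = LinearMap.trace K N (ψ' ∘ₗ φ' ∘ₗ f ∘ₗ g) :=
    (LinearMap.trace_comp_comm' (φ' ∘ₗ f ∘ₗ g) ψ').symm
  have h4 : LinearMap.trace K N (f ∘ₗ φ ∘ₗ ψ ∘ₗ g) = LinearMap.trace K M (φ ∘ₗ ψ ∘ₗ g ∘ₗ f) :=
    (LinearMap.trace_comp_comm' f (φ ∘ₗ ψ ∘ₗ g)).symm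
  have h5 : LinearMap.trace K M (φ ∘ₗ g ∘ₗ f ∘ₗ ψ) = LinearMap.trace K M (ψ ∘ₗ φ ∘ₗ g ∘ₗ f) :=
    (LinearMap.trace_comp_comm' (φ ∘ₗ g ∘ₗ f) ψ).symm
  have h6 : LinearMap.trace K M (g ∘ₗ φ' ∘ₗ ψ' ∘ₗ f) = LinearMap.trace K N (φ' ∘ₗ ψ' ∘ₗ f ∘ₗ g) :=
    (LinearMap.trace_comp_comm' g (φ' ∘ₗ ψ' ∘ₗ f)).symm
  rw [h1, h2, h3, h4, h5, h6]
  ring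

/-- For a representation of the double quiver satisfying the preprojective relation, the
dimension of the endomorphism ring is bounded below by the Euler form. -/
theorem DoubleRep.sum_sq_finrank_le (x : DoubleRep K s t M)
    (hx : ∀ θ : (i : V) → Module.End K (M i),
      ∑ a, (LinearMap.trace K _ (θ (s a) ∘ₗ (x a).2 ∘ₗ (x a).1) -
        LinearMap.trace K _ (θ (t a) ∘ₗ (x a).1 ∘ₗ (x a).2)) = 0) :
    ∑ i, Module.finrank K (M i) ^ 2 ≤
      ∑ a, Module.finrank K (M (s a)) * Module.finrank K (M (t a)) +
        Module.finrank K (LinearMap.ker x.infAction) := by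
  -- By `hx` the moment map vanishes at `x`, so the tangent space of the orbit is isotropic and has
  -- at most half the total dimension. Rank–nullity then gives the estimate.
  have h1 : 2 * Module.finrank K (LinearMap.range x.infAction) ≤
      Module.finrank K (DoubleRep K s t M) := by
    refine two_mul_finrank_le_of_isotropic (form_nondegenerate s t M) ?_
    rintro _ ⟨φ, rfl⟩ _ ⟨ψ, rfl⟩
    rw [form_apply, ← neg_eq_zero, ← hx fun i => φ i ∘ₗ ψ i - ψ i ∘ₗ φ i,
      ← Finset.sum_neg_distrib]
    refine Finset.sum_congr rfl fun a _ => ?_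
    rw [neg_eq_iff_eq_neg]
    exact trace_infAction_aux (φ (s a)) (ψ (s a)) (φ (t a)) (ψ (t a)) (x a).1 (x a).2
  have h2 : Module.finrank K (DoubleRep K s t M) =
      2 * ∑ a, Module.finrank K (M (s a)) * Module.finrank K (M (t a)) := by
    rw [Module.finrank_pi_fintype, Finset.mul_sum]
    refine Finset.sum_congr rfl fun a _ => ?_
    rw [Module.finrank_prod, Module.finrank_linearMap, Module.finrank_linearMap]
    ring
  have h3 := LinearMap.finrank_range_add_finrank_ker x.infAction
  have h4 : Module.finrank K ((i : V) → Module.End K (M i)) =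
      ∑ i, Module.finrank K (M i) ^ 2 := by
    rw [Module.finrank_pi_fintype]
    refine Finset.sum_congr rfl fun i _ => ?_
    rw [Module.finrank_linearMap, sq]
  omega

end DoubleRepresentation

/-! ### The spaces `A e` and right multiplication between them. -/

section IdempotentPart

variable (K : Type*) [Field K] {A : Type*} [Ring A] [Algebra K A]

/-- The subspace `A e` for an element `e` of an algebra `A`, in the form suited to idempotents. -/
def idemPart (e : A) : Submodule K A where
  carrier := {x | x * e = x}
  add_mem' {x y} hx hy := (add_mul x y e).trans (congrArg₂ _ hx hy)
  zero_mem' := zero_mul e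
  smul_mem' c x hx := (smul_mul_assoc c x e).trans (congrArg _ hx)

variable {K}

/-- Right multiplication by an idempotent, as a projection. -/
def idemProj {e : A} (he : e * e = e) : A →ₗ[K] idemPart K e :=
  (LinearMap.mulRight K e).codRestrict (idemPart K e) fun x =>
    (mul_assoc x e e).trans (congrArg (x * ·) he)

theorem idemProj_coe {e : A} (he : e * e = e) (x : A) :
    (idemProj (K := K) he x : A) = x * e :=
  rfl

theorem idemProj_of_mem {e : A} (he : e * e = e) (x : idemPart K e) :
    idemProj (K := K) he (x : A) = x :=
  Subtype.ext x.2

variable (K) in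
/-- The map `A e → A e'` given by right multiplication by an element of the algebra. -/
def rightAct (e : A) {e' : A} (he' : e' * e' = e') :
    A →ₗ[K] idemPart K e →ₗ[K] idemPart K e' :=
  LinearMap.mk₂ K (fun z x => idemProj he' ((x : A) * z))
    (fun z z' x => by rw [mul_add, map_add])
    (fun c z x => by rw [mul_smul_comm, map_smul])
    (fun z x x' => by rw [Submodule.coe_add, add_mul, map_add])
    (fun c z x => by rw [Submodule.coe_smul, smul_mul_assoc, map_smul])

theorem rightAct_apply_coe (e : A) {e' : A} (he' : e' * e' = e') (z : A) (x : idemPart K e) :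
    (rightAct K e he' z x : A) = (x : A) * z * e' :=
  rfl

theorem rightAct_comp (e : A) {e' e'' : A} (he' : e' * e' = e') (he'' : e'' * e'' = e'')
    {z z' : A} (hz : z * e' = z) :
    rightAct K e' he'' z' ∘ₗ rightAct K e he' z = rightAct K e he'' (z * z') := by
  ext x
  simp only [LinearMap.comp_apply, rightAct_apply_coe]
  rw [mul_assoc (x : A) z e', hz, mul_assoc (x : A) z z']

theorem rightAct_idemProj {e e' : A} (he : e * e = e) (he' : e' * e' = e') {z : A}
    (hz : e * z = z) (x : A) :
    rightAct K e he' z (idemProj he x) = idemProj he' (x * z) := by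
  ext
  rw [rightAct_apply_coe, idemProj_coe, idemProj_coe, mul_assoc x e z, hz]

theorem rightAct_eq_zero {e e' : A} (he' : e' * e' = e') {z : A} (hz : e * z = 0) :
    rightAct K e he' z = 0 := by
  ext x
  have hx : (x : A) * e = x := x.2
  rw [rightAct_apply_coe, ← hx, mul_assoc (x : A) e z, hz, mul_zero, zero_mul]
  rfl

end IdempotentPart

/-! ### Dimension vectors of finite-dimensional quotients of the preprojective algebra. -/

section PreprojectiveDimension

open PathAlgebra

variable {K : Type u} [Field K] {V : Type v} [Quiver.{w} V]

/-- The idempotent of the path algebra of the double quiver given by a vertex. -/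
def dblNil (K : Type u) [Field K] {V : Type v} [Quiver.{w} V] (i : V) : DoublePathAlgebra K V :=
  ofPath K (Quiver.Path.nil : Quiver.Path (V := Quiver.Symmetrify V) i i)

theorem dblNil_mul_self (i : V) : dblNil K i * dblNil K i = dblNil K i :=
  ofPath_mul_ofPath (V := Quiver.Symmetrify V) _ _

theorem dblNil_mul_dblArrow_of_ne {i j k : V} (a : i ⟶ j) (h : k ≠ i) :
    dblNil K k * dblArrow K a = 0 :=
  ofPath_mul_ofPath_of_ne (V := Quiver.Symmetrify V) _ _ h

theorem dblNil_mul_dblArrowStar_of_ne {i j k : V} (a : i ⟶ j) (h : k ≠ j) :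
    dblNil K k * dblArrowStar K a = 0 :=
  ofPath_mul_ofPath_of_ne (V := Quiver.Symmetrify V) _ _ h

theorem dblNil_mul_dblArrow {i j : V} (a : i ⟶ j) :
    dblNil K i * dblArrow K a = dblArrow K a :=
  ofPath_mul_ofPath (V := Quiver.Symmetrify V) _ _

theorem dblNil_mul_dblArrowStar {i j : V} (a : i ⟶ j) :
    dblNil K j * dblArrowStar K a = dblArrowStar K a :=
  ofPath_mul_ofPath (V := Quiver.Symmetrify V) _ _

theorem dblArrow_mul_dblNil {i j : V} (a : i ⟶ j) :
    dblArrow K a * dblNil K j = dblArrow K a :=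
  ofPath_mul_ofPath (V := Quiver.Symmetrify V) _ _

theorem dblArrowStar_mul_dblNil {i j : V} (a : i ⟶ j) :
    dblArrowStar K a * dblNil K i = dblArrowStar K a :=
  ofPath_mul_ofPath (V := Quiver.Symmetrify V) _ _

theorem sum_dblNil [Fintype V] : ∑ i : V, dblNil K i = 1 :=
  rfl

variable [Fintype V] {A : Type*} [Ring A] [Algebra K A]
  (π : DoublePathAlgebra K V →ₐ[K] A)

theorem map_dblNil_mul_self (i : V) : π (dblNil K i) * π (dblNil K i) = π (dblNil K i) := by
  rw [← map_mul, dblNil_mul_self]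

/-- The representation of the double quiver on the spaces `A e` for the vertex idempotents `e`. -/
def regularDoubleRep :
    DoubleRep K (fun a : (i : V) × (j : V) × (i ⟶ j) => a.1) (fun a => a.2.1)
      (fun i => idemPart K (π (dblNil K i))) := fun a =>
  (rightAct K _ (map_dblNil_mul_self π _) (π (dblArrow K a.2.2)),
    rightAct K _ (map_dblNil_mul_self π _) (π (dblArrowStar K a.2.2)))

variable [∀ i j : V, Fintype (i ⟶ j)]

/-- The left side is one linear functional `L` of the preprojective relation: `L z` sums over the
vertices the trace of `θ i` composed with right multiplication by `z` on `A e i`. On a product `a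
a^*` or `a^* a` only the starting vertex contributes. -/
theorem regularDoubleRep_relation [FiniteDimensional K A]
    (hπ : π (preprojectiveRelation K V) = 0)
    (θ : (i : V) → Module.End K (idemPart K (π (dblNil K i)))) :
    ∑ a : (i : V) × (j : V) × (i ⟶ j),
      (LinearMap.trace K _ (θ a.1 ∘ₗ (regularDoubleRep π a).2 ∘ₗ (regularDoubleRep π a).1) -
        LinearMap.trace K _
          (θ a.2.1 ∘ₗ (regularDoubleRep π a).1 ∘ₗ (regularDoubleRep π a).2)) = 0 := by
  classical
  let L : A →ₗ[K] K := ∑ i : V, LinearMap.trace K _ ∘ₗ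
    LinearMap.llcomp K _ _ _ (θ i) ∘ₗ rightAct K _ (map_dblNil_mul_self π i)
  have hL : ∀ (i : V) (z : A), (∀ k, k ≠ i → π (dblNil K k) * z = 0) →
      L z = LinearMap.trace K _ (θ i ∘ₗ rightAct K _ (map_dblNil_mul_self π i) z) := by
    intro i z hz
    change (∑ i : V, LinearMap.trace K _ ∘ₗ
      LinearMap.llcomp K _ _ _ (θ i) ∘ₗ rightAct K _ (map_dblNil_mul_self π i)) z = _
    rw [LinearMap.sum_apply, Finset.sum_eq_single i]
    · rfl
    · intro k _ hk
      change LinearMap.trace K _ (θ k ∘ₗ rightAct K _ (map_dblNil_mul_self π k) z) = 0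
      rw [rightAct_eq_zero _ (hz k hk), LinearMap.comp_zero, map_zero]
    · simp
  have h0 : L (π (preprojectiveRelation K V)) = 0 := by rw [hπ, map_zero]
  simp only [preprojectiveRelation, map_sum, map_sub, map_mul] at h0
  rw [Fintype.sum_sigma, ← h0]
  refine Finset.sum_congr rfl fun i _ => ?_
  rw [Fintype.sum_sigma]
  refine Finset.sum_congr rfl fun j _ => Finset.sum_congr rfl fun a _ => ?_
  rw [hL i, hL j]
  · simp only [regularDoubleRep]
    rw [rightAct_comp, rightAct_comp]
    · rw [← map_mul, dblArrowStar_mul_dblNil]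
    · rw [← map_mul, dblArrow_mul_dblNil]
  · intro k hk
    rw [← mul_assoc, ← map_mul, dblNil_mul_dblArrowStar_of_ne a hk, map_zero, zero_mul]
  · intro k hk
    rw [← mul_assoc, ← map_mul, dblNil_mul_dblArrow_of_ne a hk, map_zero, zero_mul]

theorem map_infAction_ker_idemProj_mul_dblArrow
    {φ : (i : V) → Module.End K (idemPart K (π (dblNil K i)))}
    (hφ : (regularDoubleRep π).infAction φ = 0) {i j : V} (a : i ⟶ j) {x : A}
    (hx : φ i (idemProj (map_dblNil_mul_self π i) x) = 0) :
    φ j (idemProj (map_dblNil_mul_self π j) (x * π (dblArrow K a))) = 0 := by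
  have h1 : φ j ∘ₗ rightAct K _ (map_dblNil_mul_self π j) (π (dblArrow K a)) =
      rightAct K _ (map_dblNil_mul_self π j) (π (dblArrow K a)) ∘ₗ φ i :=
    sub_eq_zero.1 (congrArg Prod.fst (congrFun hφ ⟨i, j, a⟩))
  have h2 := LinearMap.congr_fun h1 (idemProj (map_dblNil_mul_self π i) x)
  rw [LinearMap.comp_apply, LinearMap.comp_apply, hx, map_zero,
    rightAct_idemProj _ _ (by rw [← map_mul, dblNil_mul_dblArrow])] at h2
  exact h2

theorem map_infAction_ker_idemProj_mul_dblArrowStar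
    {φ : (i : V) → Module.End K (idemPart K (π (dblNil K i)))}
    (hφ : (regularDoubleRep π).infAction φ = 0) {i j : V} (a : i ⟶ j) {x : A}
    (hx : φ j (idemProj (map_dblNil_mul_self π j) x) = 0) :
    φ i (idemProj (map_dblNil_mul_self π i) (x * π (dblArrowStar K a))) = 0 := by
  have h1 : φ i ∘ₗ rightAct K _ (map_dblNil_mul_self π i) (π (dblArrowStar K a)) =
      rightAct K _ (map_dblNil_mul_self π i) (π (dblArrowStar K a)) ∘ₗ φ j :=
    sub_eq_zero.1 (congrArg Prod.snd (congrFun hφ ⟨i, j, a⟩))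
  have h2 := LinearMap.congr_fun h1 (idemProj (map_dblNil_mul_self π j) x)
  rw [LinearMap.comp_apply, LinearMap.comp_apply, hx, map_zero,
    rightAct_idemProj _ _ (by rw [← map_mul, dblNil_mul_dblArrowStar])] at h2
  exact h2

theorem infAction_ker_apply_ofPath
    {φ : (i : V) → Module.End K (idemPart K (π (dblNil K i)))}
    (hφ : (regularDoubleRep π).infAction φ = 0)
    (h0 : ∀ i, φ i (idemProj (map_dblNil_mul_self π i) (π (dblNil K i))) = 0)
    {i j : Quiver.Symmetrify V} (p : Quiver.Path i j) :
    φ j (idemProj (map_dblNil_mul_self (V := V) π j) (π (ofPath K p))) = 0 := by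
  induction p with
  | nil => exact h0 i
  | @cons k l p e ih =>
    obtain a | a := e
    · rw [ofPath_cons_inl, map_mul]
      exact map_infAction_ker_idemProj_mul_dblArrow (V := V) π hφ a ih
    · rw [ofPath_cons_inr, map_mul]
      exact map_infAction_ker_idemProj_mul_dblArrowStar (V := V) π hφ a ih

theorem idemProj_map_ofPath_of_ne {i j : Quiver.Symmetrify V} (p : Quiver.Path i j) {k : V}
    (h : j ≠ k) : idemProj (K := K) (map_dblNil_mul_self π k) (π (ofPath K p)) = 0 := by
  ext
  rw [idemProj_coe, ← map_mul]
  exact (congrArg π (ofPath_mul_ofPath_of_ne p _ h)).trans (map_zero π)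

theorem infAction_ker_apply_map
    {φ : (i : V) → Module.End K (idemPart K (π (dblNil K i)))}
    (hφ : (regularDoubleRep π).infAction φ = 0)
    (h0 : ∀ i, φ i (idemProj (map_dblNil_mul_self π i) (π (dblNil K i))) = 0)
    (k : V) (y : DoublePathAlgebra K V) :
    φ k (idemProj (map_dblNil_mul_self π k) (π y)) = 0 := by
  induction y using induction_path with
  | zero => simp only [map_zero]
  | add x y hx hy => simp only [map_add, hx, hy, add_zero]
  | smul c i j p =>
    simp only [map_smul]
    by_cases h : j = k
    · subst h
      rw [infAction_ker_apply_ofPath π hφ h0 p, smul_zero]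
    · rw [idemProj_map_ofPath_of_ne π p h, map_zero, smul_zero]

/-- An element of the kernel commutes with right multiplication by all arrows, so it is determined
by its values at the vertex idempotents, and the value at `e i` lies in `A e i`. -/
theorem finrank_infAction_ker_le [FiniteDimensional K A] (hπ : Function.Surjective π) :
    Module.finrank K (LinearMap.ker (regularDoubleRep π).infAction) ≤
      ∑ i : V, Module.finrank K (idemPart K (π (dblNil K i))) := by
  rw [← Module.finrank_pi_fintype]
  let F : ((i : V) → Module.End K (idemPart K (π (dblNil K i)))) →ₗ[K]
      ((i : V) → idemPart K (π (dblNil K i))) := LinearMap.pi fun i =>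
    LinearMap.applyₗ (idemProj (map_dblNil_mul_self π i) (π (dblNil K i))) ∘ₗ LinearMap.proj i
  refine LinearMap.finrank_le_finrank_of_injective
    (f := F ∘ₗ (LinearMap.ker (regularDoubleRep π).infAction).subtype) ?_
  rw [← LinearMap.ker_eq_bot, LinearMap.ker_eq_bot']
  rintro ⟨φ, hφ⟩ h
  ext k x : 4
  obtain ⟨y, hy⟩ := hπ x
  have h1 := infAction_ker_apply_map π (LinearMap.mem_ker.1 hφ) (fun i => congrFun h i) k y
  rw [hy, idemProj_of_mem] at h1
  exact congrArg Subtype.val h1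

theorem finrank_le_sum_idemPart [FiniteDimensional K A] :
    Module.finrank K A ≤ ∑ i : V, Module.finrank K (idemPart K (π (dblNil K i))) := by
  rw [← Module.finrank_pi_fintype]
  refine LinearMap.finrank_le_finrank_of_injective
    (f := LinearMap.pi fun i => idemProj (map_dblNil_mul_self π i)) ?_
  rw [← LinearMap.ker_eq_bot, LinearMap.ker_eq_bot']
  intro x hx
  have h1 : ∀ i, x * π (dblNil K i) = 0 := fun i => congrArg Subtype.val (congrFun hx i)
  rw [← mul_one x, ← map_one π, ← sum_dblNil, map_sum, Finset.mul_sum]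
  exact Finset.sum_eq_zero fun i _ => h1 i

/-- A finite-dimensional quotient of the preprojective algebra has a dimension vector satisfying
the inequality given by the Euler form. -/
theorem exists_dimension_vector [FiniteDimensional K A] (hπ : Function.Surjective π)
    (hρ : π (preprojectiveRelation K V) = 0) :
    ∃ d : V → ℕ, Module.finrank K A ≤ ∑ i, d i ∧
      ∑ i, d i ^ 2 ≤ ∑ i, ∑ j, Fintype.card (i ⟶ j) * (d i * d j) + ∑ i, d i := by
  refine ⟨fun i => Module.finrank K (idemPart K (π (dblNil K i))), finrank_le_sum_idemPart π, ?_⟩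
  have h1 := (regularDoubleRep π).sum_sq_finrank_le (regularDoubleRep_relation π hρ)
  have h2 := finrank_infAction_ker_le π hπ
  refine h1.trans (add_le_add (le_of_eq ?_) h2)
  rw [Fintype.sum_sigma]
  refine Finset.sum_congr rfl fun i _ => ?_
  rw [Fintype.sum_sigma]
  refine Finset.sum_congr rfl fun j _ => ?_
  have h3 (x : ℕ) : ∑ _a : (i ⟶ j), x = Fintype.card (i ⟶ j) * x := by
    rw [Finset.sum_const, smul_eq_mul, Finset.card_univ]
  exact h3 (Module.finrank K (idemPart K (π (dblNil K i))) *
    Module.finrank K (idemPart K (π (dblNil K j))))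

end PreprojectiveDimension

/-! ### Cartan matrices and the boundedness of dimension vectors. -/

section Cartan

/-- A positive vector on which the Cartan matrix of a graph is positive bounds the solutions of
`q(d) ≤ ∑ d i`, where `q` is the quadratic form of the graph. -/
theorem sum_le_of_quadratic_form_le {V : Type*} [Fintype V] {n : V → V → ℕ} {y : V → ℝ}
    (hy : ∀ i, 0 < y i) (hn : ∀ i, 1 ≤ 2 * y i - ∑ j, ((n i j : ℝ) + n j i) * y j) {d : V → ℕ}
    (hd : ∑ i, d i ^ 2 ≤ ∑ i, ∑ j, n i j * (d i * d j) + ∑ i, d i) :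
    (∑ i, d i : ℝ) ≤ 2 * ∑ i, y i := by
  have hd' : ∑ i, (d i : ℝ) ^ 2 ≤ ∑ i, ∑ j, (n i j : ℝ) * (d i * d j) + ∑ i, (d i : ℝ) := by
    exact_mod_cast hd
  -- The weighted arithmetic–geometric mean inequality, from the square of `d i * y j - d j * y i`.
  have h1 : ∀ i j, (n i j : ℝ) * (d i * d j) ≤
      (d i : ℝ) ^ 2 / (2 * y i) * (n i j * y j) + (d j : ℝ) ^ 2 / (2 * y j) * (n i j * y i) := by
    intro i j
    have h2 : (d i : ℝ) * d j ≤
        (d i : ℝ) ^ 2 / (2 * y i) * y j + (d j : ℝ) ^ 2 / (2 * y j) * y i := by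
      have hi := hy i
      have hj := hy j
      have h3 : (d i : ℝ) ^ 2 / (2 * y i) * y j + (d j : ℝ) ^ 2 / (2 * y j) * y i -
          d i * d j = (d i * y j - d j * y i) ^ 2 / (2 * y i * y j) := by
        field_simp
        ring
      have h4 : 0 ≤ (d i * y j - d j * y i) ^ 2 / (2 * y i * y j) := by positivity
      linarith
    calc (n i j : ℝ) * (d i * d j) ≤ n i j *
        ((d i : ℝ) ^ 2 / (2 * y i) * y j + (d j : ℝ) ^ 2 / (2 * y j) * y i) :=
          mul_le_mul_of_nonneg_left h2 (Nat.cast_nonneg _)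
      _ = _ := by ring
  have h2 : ∑ i, ∑ j, (n i j : ℝ) * (d i * d j) ≤
      ∑ i, (d i : ℝ) ^ 2 / (2 * y i) * ∑ j, ((n i j : ℝ) + n j i) * y j := by
    refine (Finset.sum_le_sum fun i _ => Finset.sum_le_sum fun j _ => h1 i j).trans (le_of_eq ?_)
    simp only [Finset.sum_add_distrib, Finset.mul_sum, add_mul, mul_add]
    congr 1
    exact Finset.sum_comm
  -- After `hn`, the remaining defect is the square `(d i - 2 * y i) ^ 2 / (2 * y i)`; summing
  -- cancels the quadratic terms and leaves a linear inequality in `d`.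
  have h3 : ∀ i, (d i : ℝ) ^ 2 / (2 * y i) * ∑ j, ((n i j : ℝ) + n j i) * y j ≤
      (d i : ℝ) ^ 2 - (2 * d i - 2 * y i) := by
    intro i
    have hi := hy i
    have h4 : ∑ j, ((n i j : ℝ) + n j i) * y j ≤ 2 * y i - 1 := by linarith [hn i]
    refine (mul_le_mul_of_nonneg_left h4 (by positivity)).trans ?_
    have h5 : (d i : ℝ) ^ 2 - (2 * d i - 2 * y i) - (d i : ℝ) ^ 2 / (2 * y i) * (2 * y i - 1) =
        (d i - 2 * y i) ^ 2 / (2 * y i) := by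
      field_simp
      ring
    have h6 : 0 ≤ (d i - 2 * y i) ^ 2 / (2 * y i) := by positivity
    linarith
  have h4 := h2.trans (Finset.sum_le_sum fun i _ => h3 i)
  rw [Finset.sum_sub_distrib, Finset.sum_sub_distrib, ← Finset.mul_sum, ← Finset.mul_sum] at h4
  linarith

theorem Fin.sum_univ_ite_val_eq {n : ℕ} (m : ℕ) (c : ℤ) :
    ∑ j : Fin n, (if (j : ℕ) = m then c else 0) = if m < n then c else 0 := by
  rw [Fin.sum_univ_eq_sum_range (fun j => if j = m then c else 0) n]
  simp

/-- The vector is defined on all of `ℕ` so that both neighbours of `i` can be written down; the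
conditions record whether they are vertices. -/
theorem CartanMatrix.sum_A_mul (n : ℕ) (y : ℕ → ℤ) (i : Fin n) :
    ∑ j : Fin n, CartanMatrix.A n i j * y j = 2 * y i +
      (if (i : ℕ) + 1 < n then -y (i + 1) else 0) + if 0 < (i : ℕ) then -y (i - 1) else 0 := by
  have h1 : ∀ j : Fin n, CartanMatrix.A n i j * y j =
      (if (j : ℕ) = i then 2 * y i else 0) + (if (j : ℕ) = i + 1 then -y (i + 1) else 0) +
      (if (j : ℕ) = i - 1 then (if 0 < (i : ℕ) then -y (i - 1) else 0) else 0) := by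
    intro j
    simp only [CartanMatrix.A, Matrix.of_apply, Fin.ext_iff]
    grind
  have h2 := i.2
  have h3 : (i : ℕ) - 1 < n := by omega
  simp only [h1, Finset.sum_add_distrib, Fin.sum_univ_ite_val_eq, if_pos h2, if_pos h3]

theorem CartanMatrix.exists_pos_A (n : ℕ) :
    ∃ y : Fin n → ℤ, (∀ i, 0 < y i) ∧ ∀ i, 1 ≤ ∑ j, CartanMatrix.A n i j * y j := by
  -- The coordinates of the sum of the positive roots, on which the Cartan matrix takes the value
  -- `2` everywhere. The polynomial vanishes at `k = -1` and `k = n`, so the two ends need no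
  -- correction.
  refine ⟨fun i => (fun k : ℕ => ((k : ℤ) + 1) * (n - k)) i, fun i => ?_, fun i => ?_⟩
  · have := i.2
    exact mul_pos (by omega) (by omega)
  rw [CartanMatrix.sum_A_mul]
  obtain ⟨i, hi⟩ := i
  have h1 : (if i + 1 < n then -((((i + 1 : ℕ) : ℤ) + 1) * (n - (i + 1 : ℕ))) else 0) =
      -(((i : ℤ) + 2) * (n - i - 1)) := by
    split_ifs with h
    · push_cast
      ring
    · obtain rfl : n = i + 1 := by omega
      push_cast
      ring
  have h2 : (if 0 < i then -((((i - 1 : ℕ) : ℤ) + 1) * (n - (i - 1 : ℕ))) else 0) =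
      -((i : ℤ) * (n - i + 1)) := by
    split_ifs with h
    · push_cast [Nat.cast_sub h]
      ring
    · obtain rfl : i = 0 := by omega
      simp
  simp only [h1, h2]
  linarith

theorem CartanMatrix.sum_D_mul (n : ℕ) (hn : 4 ≤ n) (y : ℕ → ℤ) (i : Fin n) :
    ∑ j : Fin n, CartanMatrix.D n i j * y j = 2 * y i +
      (if (i : ℕ) + 3 < n then -y (i + 1) else 0) +
      (if 0 < (i : ℕ) ∧ (i : ℕ) + 2 < n then -y (i - 1) else 0) +
      (if (i : ℕ) + 3 = n then -y (n - 2) - y (n - 1) else 0) +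
      (if n < (i : ℕ) + 3 then -y (n - 3) else 0) := by
  have h1 : ∀ j : Fin n, CartanMatrix.D n i j * y j =
      (if (j : ℕ) = i then 2 * y i else 0) +
      (if (j : ℕ) = i + 1 then (if (i : ℕ) + 3 < n then -y (i + 1) else 0) else 0) +
      (if (j : ℕ) = i - 1 then
        (if 0 < (i : ℕ) ∧ (i : ℕ) + 2 < n then -y (i - 1) else 0) else 0) +
      ((if (j : ℕ) = n - 2 then (if (i : ℕ) + 3 = n then -y (n - 2) else 0) else 0) +
        (if (j : ℕ) = n - 1 then (if (i : ℕ) + 3 = n then -y (n - 1) else 0) else 0)) +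
      (if (j : ℕ) = n - 3 then (if n < (i : ℕ) + 3 then -y (n - 3) else 0) else 0) := by
    intro j
    have hi := i.2
    have hj := j.2
    simp only [CartanMatrix.D, Matrix.of_apply, Fin.ext_iff]
    grind (splits := 20)
  simp only [h1, Finset.sum_add_distrib, Fin.sum_univ_ite_val_eq]
  have h2 := i.2
  grind

theorem CartanMatrix.exists_pos_D (n : ℕ) (hn : 4 ≤ n) :
    ∃ y : Fin n → ℤ, (∀ i, 0 < y i) ∧ ∀ i, 1 ≤ ∑ j, CartanMatrix.D n i j * y j := by
  obtain ⟨m, rfl⟩ := Nat.exists_eq_add_of_le' hn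
  -- Twice the sum of the positive roots for `n = m + 4`; doubling avoids the fraction `n (n - 1) /
  -- 2` at the two end vertices of the fork.
  refine ⟨fun i => (fun k : ℕ => if k < m + 2 then 2 * ((k : ℤ) + 1) * (2 * m + 6 - k) else
    ((m : ℤ) + 4) * (m + 3)) i, fun i => ?_, fun i => ?_⟩
  · dsimp only
    split_ifs with h
    · exact mul_pos (by omega) (by omega)
    · positivity
  rw [CartanMatrix.sum_D_mul _ hn]
  obtain ⟨i, hi⟩ := i
  dsimp only
  -- The vertices of the chain, the branch vertex, and the two vertices attached to it at the fork.
  obtain h | h | h : i < m + 1 ∨ i = m + 1 ∨ m + 1 < i := by omega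
  · rw [if_pos (by omega), if_pos (by omega), if_pos (by omega), if_neg (by omega : ¬ i + 3 = m + 4),
      if_neg (by omega : ¬ m + 4 < i + 3)]
    have h2 : (if 0 < i ∧ i + 2 < m + 4 then -(if i - 1 < m + 2 then
        2 * (((i - 1 : ℕ) : ℤ) + 1) * (2 * m + 6 - (i - 1 : ℕ)) else ((m : ℤ) + 4) * (m + 3)) else 0)
        = -(2 * (i : ℤ) * (2 * m + 7 - i)) := by
      obtain rfl | h0 := Nat.eq_zero_or_pos i
      · simp
      · rw [if_pos (by omega), if_pos (by omega)]
        push_cast [Nat.cast_sub h0]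
        ring
    rw [h2]
    push_cast
    linarith
  · subst h
    simp
    linarith
  · rw [if_neg (by omega), if_neg (by omega), if_neg (by omega), if_neg (by omega),
      if_pos (by omega), if_pos (by omega)]
    simp
    linarith

theorem CartanMatrix.exists_pos_E₆ :
    ∃ y : Fin 6 → ℤ, (∀ i, 0 < y i) ∧ ∀ i, 1 ≤ ∑ j, CartanMatrix.E₆ i j * y j := by
  -- The coordinates of the sum of the positive roots; likewise in types `E₇` and `E₈`.
  refine ⟨![16, 22, 30, 42, 30, 16], by decide, by decide⟩

theorem CartanMatrix.exists_pos_E₇ :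
    ∃ y : Fin 7 → ℤ, (∀ i, 0 < y i) ∧ ∀ i, 1 ≤ ∑ j, CartanMatrix.E₇ i j * y j := by
  refine ⟨![34, 49, 66, 96, 75, 52, 27], by decide, by decide⟩

theorem CartanMatrix.exists_pos_E₈ :
    ∃ y : Fin 8 → ℤ, (∀ i, 0 < y i) ∧ ∀ i, 1 ≤ ∑ j, CartanMatrix.E₈ i j * y j := by
  refine ⟨![92, 136, 182, 270, 220, 168, 114, 58], by decide, by decide⟩

end Cartan

/-! ### Truncations of homogeneous quotients of path algebras. -/

namespace PathAlgebra

section Truncation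

variable {K : Type u} [Field K] {W : Type v} [Quiver.{w} W]

/-- The projection of the path algebra to its homogeneous part of degree `m`. -/
def degProj (m : ℕ) : PathAlgebra K W →ₗ[K] PathAlgebra K W :=
  linearExt fun p => if p.2.2.length = m then ofPath K p.2.2 else 0

theorem degProj_ofPath (m : ℕ) {i j : W} (p : Quiver.Path i j) :
    degProj m (ofPath K p) = if p.length = m then ofPath K p else 0 :=
  linearExt_ofPath _ p

theorem degProj_ofPath_mul (m : ℕ) {i j : W} (p : Quiver.Path i j) (x : PathAlgebra K W) :
    degProj m (ofPath K p * x) =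
      if p.length ≤ m then ofPath K p * degProj (m - p.length) x else 0 := by
  induction x using induction_path with
  | zero => simp only [map_zero, mul_zero, ite_self]
  | add x y hx hy =>
    simp only [map_add, mul_add, hx, hy]
    split_ifs
    · rfl
    · rw [add_zero]
  | smul c k l q =>
    simp only [map_smul, mul_smul_comm, degProj_ofPath]
    by_cases h : j = k
    · subst h
      rw [ofPath_mul_ofPath, degProj_ofPath, Quiver.Path.length_comp]
      by_cases hm : p.length ≤ m
      · by_cases hq : q.length = m - p.length
        · rw [if_pos (by omega), if_pos hm, if_pos hq, ofPath_mul_ofPath]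
        · rw [if_neg (by omega), if_pos hm, if_neg hq, mul_zero, smul_zero]
      · rw [if_neg (by omega), if_neg hm, smul_zero]
    · rw [ofPath_mul_ofPath_of_ne _ _ h, map_zero, smul_zero, mul_ite, mul_zero,
        ofPath_mul_ofPath_of_ne _ _ h, ite_self, smul_zero, ite_self]

theorem degProj_mul_ofPath (m : ℕ) {k l : W} (x : PathAlgebra K W) (q : Quiver.Path k l) :
    degProj m (x * ofPath K q) =
      if q.length ≤ m then degProj (m - q.length) x * ofPath K q else 0 := by
  induction x using induction_path with
  | zero => simp only [map_zero, zero_mul, ite_self]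
  | add x y hx hy =>
    simp only [map_add, add_mul, hx, hy]
    split_ifs
    · rfl
    · rw [add_zero]
  | smul c i j p =>
    simp only [map_smul, smul_mul_assoc, degProj_ofPath]
    by_cases h : j = k
    · subst h
      rw [ofPath_mul_ofPath, degProj_ofPath, Quiver.Path.length_comp]
      by_cases hm : q.length ≤ m
      · by_cases hp : p.length = m - q.length
        · rw [if_pos (by omega), if_pos hm, if_pos hp, ofPath_mul_ofPath]
        · rw [if_neg (by omega), if_pos hm, if_neg hp, zero_mul, smul_zero]
      · rw [if_neg (by omega), if_neg hm, smul_zero]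
    · rw [ofPath_mul_ofPath_of_ne _ _ h, map_zero, smul_zero, ite_mul, zero_mul,
        ofPath_mul_ofPath_of_ne _ _ h, ite_self, smul_zero, ite_self]

theorem degProj_of_mem_pathsGE {m n : ℕ} (h : m < n) {x : PathAlgebra K W}
    (hx : x ∈ pathsGE K W n) : degProj m x = 0 := by
  induction hx using Submodule.span_induction with
  | zero => exact map_zero _
  | add x y _ _ hx hy => rw [map_add, hx, hy, add_zero]
  | smul c x _ hx => rw [map_smul, hx, smul_zero]
  | mem x hx =>
    obtain ⟨i, j, p, hp, rfl⟩ := hx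
    rw [degProj_ofPath, if_neg (by omega)]

theorem degProj_ofArrow_mul_ofArrow (m : ℕ) {i j k l : W} (a : i ⟶ j) (b : k ⟶ l) :
    degProj m (ofArrow K a * ofArrow K b) =
      if m = 2 then ofArrow K a * ofArrow K b else 0 := by
  rw [ofArrow, ofArrow, degProj_ofPath_mul, degProj_ofPath, Quiver.Path.length_toPath,
    Quiver.Path.length_toPath]
  by_cases h : m = 2
  · subst h
    simp
  · rw [if_neg h, if_neg (by omega : ¬ 1 = m - 1), mul_zero, ite_self]

variable [Fintype W]

/-- Multiplication by a path only shifts the degree, so homogeneity passes from the generators to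
the ideal. -/
theorem degProj_mem_span {R : Set (PathAlgebra K W)}
    (h : ∀ x ∈ R, ∀ m, degProj m x ∈ TwoSidedIdeal.span R) {x : PathAlgebra K W}
    (hx : x ∈ TwoSidedIdeal.span R) (m : ℕ) : degProj m x ∈ TwoSidedIdeal.span R := by
  induction hx using TwoSidedIdeal.span_induction generalizing m with
  | mem x hx => exact h x hx m
  | zero => rw [map_zero]; exact zero_mem _
  | add x y _ _ hx hy => rw [map_add]; exact add_mem (hx m) (hy m)
  | neg x _ hx => rw [map_neg]; exact neg_mem (hx m)
  | left_absorb a x _ hx =>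
    induction a using induction_path with
    | zero => rw [zero_mul, map_zero]; exact zero_mem _
    | add a b ha hb => rw [add_mul, map_add]; exact add_mem ha hb
    | smul c i j p =>
      rw [smul_mul_assoc, map_smul, degProj_ofPath_mul]
      refine smul_mem_ideal _ c ?_
      split_ifs
      · exact TwoSidedIdeal.mul_mem_left _ _ _ (hx _)
      · exact zero_mem _
  | right_absorb b x _ hx =>
    induction b using induction_path with
    | zero => rw [mul_zero, map_zero]; exact zero_mem _
    | add a b ha hb => rw [mul_add, map_add]; exact add_mem ha hb
    | smul c i j p =>
      rw [mul_smul_comm, map_smul, degProj_mul_ofPath]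
      refine smul_mem_ideal _ c ?_
      split_ifs
      · exact TwoSidedIdeal.mul_mem_right _ _ _ (hx _)
      · exact zero_mem _

/-- The ideal generated by a set and by all paths of length at least `n`. -/
def truncation (R : Set (PathAlgebra K W)) (n : ℕ) : TwoSidedIdeal (PathAlgebra K W) :=
  TwoSidedIdeal.span
    (R ∪ {y | ∃ (i j : W) (p : Quiver.Path i j), n ≤ p.length ∧ y = ofPath K p})

theorem ofPath_mem_truncation (R : Set (PathAlgebra K W)) {n : ℕ} {i j : W}
    (p : Quiver.Path i j) (hp : n ≤ p.length) : ofPath K p ∈ truncation R n :=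
  TwoSidedIdeal.subset_span (Or.inr ⟨i, j, p, hp, rfl⟩)

theorem truncation_succ_le (R : Set (PathAlgebra K W)) (n : ℕ) :
    truncation R (n + 1) ≤ truncation R n := by
  refine TwoSidedIdeal.span_mono (Set.union_subset_union_right R ?_)
  rintro _ ⟨i, j, p, hp, rfl⟩
  exact ⟨i, j, p, by omega, rfl⟩

theorem exists_sub_mem_pathsGE {R : Set (PathAlgebra K W)} {n : ℕ} {x : PathAlgebra K W}
    (hx : x ∈ truncation R n) : ∃ z ∈ TwoSidedIdeal.span R, x - z ∈ pathsGE K W n := by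
  have htop : ∀ a : PathAlgebra K W, a ∈ pathsGE K W 0 := by
    intro a
    induction a using induction_path with
    | zero => exact zero_mem _
    | add a b ha hb => exact add_mem ha hb
    | smul c i j p => exact Submodule.smul_mem _ c (ofPath_mem_pathsGE p (Nat.zero_le _))
  induction hx using TwoSidedIdeal.span_induction with
  | mem x hx =>
    obtain hx | ⟨i, j, p, hp, rfl⟩ := hx
    · exact ⟨x, TwoSidedIdeal.subset_span hx, by rw [sub_self]; exact zero_mem _⟩
    · exact ⟨0, zero_mem _, by rw [sub_zero]; exact ofPath_mem_pathsGE p hp⟩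
  | zero => exact ⟨0, zero_mem _, by rw [sub_zero]; exact zero_mem _⟩
  | add x y _ _ hx hy =>
    obtain ⟨z, hz, hz'⟩ := hx
    obtain ⟨t, ht, ht'⟩ := hy
    exact ⟨z + t, add_mem hz ht, by rw [add_sub_add_comm]; exact add_mem hz' ht'⟩
  | neg x _ hx =>
    obtain ⟨z, hz, hz'⟩ := hx
    exact ⟨-z, neg_mem hz, by rw [← neg_sub']; exact neg_mem hz'⟩
  | left_absorb a x _ hx =>
    obtain ⟨z, hz, hz'⟩ := hx
    refine ⟨a * z, TwoSidedIdeal.mul_mem_left _ _ _ hz, ?_⟩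
    rw [← mul_sub]
    simpa using mul_mem_pathsGE (htop a) hz'
  | right_absorb b x _ hx =>
    obtain ⟨z, hz, hz'⟩ := hx
    refine ⟨z * b, TwoSidedIdeal.mul_mem_right _ _ _ hz, ?_⟩
    rw [← sub_mul]
    simpa using mul_mem_pathsGE hz' (htop b)

/-- Modulo the ideal of `R` the path is a combination of strictly longer paths; comparing the parts
in its own degree leaves it in the ideal. -/
theorem ofPath_mem_of_mem_truncation {R : Set (PathAlgebra K W)}
    (hR : ∀ x ∈ R, ∀ m, degProj m x ∈ TwoSidedIdeal.span R) {i j : W} (p : Quiver.Path i j)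
    (hp : ofPath K p ∈ truncation R (p.length + 1)) : ofPath K p ∈ TwoSidedIdeal.span R := by
  obtain ⟨z, hz, h⟩ := exists_sub_mem_pathsGE hp
  have h1 := degProj_of_mem_pathsGE (Nat.lt_succ_self p.length) h
  rw [map_sub, degProj_ofPath, if_pos rfl, sub_eq_zero] at h1
  rw [h1]
  exact degProj_mem_span hR hz _

theorem ofPath_mem_of_forall_length_eq {J : TwoSidedIdeal (PathAlgebra K W)} {n : ℕ}
    (h : ∀ (i j : W) (p : Quiver.Path i j), p.length = n → ofPath K p ∈ J) {i j : W}
    (p : Quiver.Path i j) (hp : n ≤ p.length) : ofPath K p ∈ J := by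
  induction p with
  | nil => exact h _ _ _ (Nat.le_zero.1 hp).symm
  | cons p e ih =>
    obtain hp | hp := hp.eq_or_lt
    · exact h _ _ _ hp.symm
    · have h1 : ofPath K (p.cons e) = ofPath K p * ofPath K e.toPath :=
        (ofPath_mul_ofPath p e.toPath).symm
      rw [h1]
      exact J.mul_mem_right _ _ (ih (Nat.lt_succ_iff.1 hp))

/-- If the truncations of a homogeneous quotient of a path algebra have bounded dimension, then
all long paths vanish in the quotient. -/
theorem exists_forall_ofPath_mem_of_finrank_le [∀ i j : W, Finite (i ⟶ j)]
    {R : Set (PathAlgebra K W)} (hR : ∀ x ∈ R, ∀ m, degProj m x ∈ TwoSidedIdeal.span R) {D : ℕ}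
    (hD : ∀ n, Module.finrank K (truncation R n).ringCon.Quotient ≤ D) :
    ∃ n, ∀ (i j : W) (p : Quiver.Path i j), n ≤ p.length →
      ofPath K p ∈ TwoSidedIdeal.span R := by
  by_contra! hcon
  have hfin : ∀ n, FiniteDimensional K (truncation R n).ringCon.Quotient := fun n =>
    finite_quotient _ fun i j p => ofPath_mem_truncation R p
  -- If two consecutive truncations had the same dimension, the projection between them would be
  -- injective. Paths of length `n` would then vanish already in the larger one, hence lie in the
  -- ideal by homogeneity, and so would all longer paths, against `hcon`.
  have hstep : ∀ n, Module.finrank K (truncation R n).ringCon.Quotient <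
      Module.finrank K (truncation R (n + 1)).ringCon.Quotient := by
    intro n
    let F : (truncation R (n + 1)).ringCon.Quotient →ₐ[K] (truncation R n).ringCon.Quotient :=
      RingCon.liftₐ _ (RingCon.mkₐ K (truncation R n).ringCon) fun x y hxy =>
        (RingCon.eq _).2 (TwoSidedIdeal.ringCon_le_iff.1 (truncation_succ_le R n) hxy)
    have hF : Function.Surjective F.toLinearMap := by
      intro y
      obtain ⟨x, rfl⟩ := (truncation R n).ringCon.mk'_surjective y
      exact ⟨(truncation R (n + 1)).ringCon.mk' x, rfl⟩
    refine lt_of_le_of_ne (LinearMap.finrank_le_finrank_of_surjective hF) fun heq => ?_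
    have hinj := (LinearMap.injective_iff_surjective_of_finrank_eq_finrank heq.symm).2 hF
    have hmem : ∀ (i j : W) (p : Quiver.Path i j), p.length = n →
        ofPath K p ∈ TwoSidedIdeal.span R := by
      intro i j p hp
      refine ofPath_mem_of_mem_truncation hR p ?_
      rw [hp, ← quotient_coe_eq_zero]
      refine hinj (Eq.trans ?_ (map_zero _).symm)
      exact (quotient_coe_eq_zero _).2 (ofPath_mem_truncation R p hp.ge)
    obtain ⟨i, j, p, hp, hp'⟩ := hcon n
    exact hp' (ofPath_mem_of_forall_length_eq hmem p hp)
  have hle : ∀ n, n ≤ Module.finrank K (truncation R n).ringCon.Quotient := by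
    intro n
    induction n with
    | zero => exact Nat.zero_le _
    | succ n ih => exact Nat.succ_le_of_lt (ih.trans_lt (hstep n))
  exact absurd ((hle (D + 1)).trans (hD (D + 1))) (by omega)

end Truncation

end PathAlgebra

/-! ### Preprojective algebras of Dynkin quivers. -/

section Dynkin

open PathAlgebra

variable {K : Type u} [Field K] {V : Type v} [Quiver.{w} V] [∀ i j : V, Fintype (i ⟶ j)]

theorem IsDynkin.HasCartan.exists_pos [Fintype V] {n : ℕ} {C : Matrix (Fin n) (Fin n) ℤ}
    (hC : IsDynkin.HasCartan V n C)
    (h : ∃ y : Fin n → ℤ, (∀ i, 0 < y i) ∧ ∀ i, 1 ≤ ∑ j, C i j * y j) :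
    ∃ y : V → ℝ, (∀ i, 0 < y i) ∧ ∀ i, 1 ≤ 2 * y i -
      ∑ j, ((Fintype.card (i ⟶ j) : ℝ) + Fintype.card (j ⟶ i)) * y j := by
  obtain ⟨e, he⟩ := hC
  obtain ⟨y, hy, hy'⟩ := h
  refine ⟨fun i => (y (e.symm i) : ℝ), fun i => Int.cast_pos.2 (hy _), fun i => ?_⟩
  obtain ⟨i, rfl⟩ := e.surjective i
  have h1 : ∑ j, C i j * y j = 2 * y i -
      ∑ j, ((Fintype.card (e i ⟶ e j) : ℤ) + Fintype.card (e j ⟶ e i)) * y j := by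
    have h2 : 2 * y i = ∑ j, (if i = j then 2 else 0) * y j := by simp
    rw [h2, ← Finset.sum_sub_distrib]
    refine Finset.sum_congr rfl fun j _ => ?_
    rw [he]
    ring
  have h3 := hy' i
  rw [h1] at h3
  rw [← e.sum_comp]
  simp only [Equiv.symm_apply_apply]
  exact_mod_cast h3

theorem IsDynkin.exists_pos [Fintype V] (hV : IsDynkin V) :
    ∃ y : V → ℝ, (∀ i, 0 < y i) ∧ ∀ i, 1 ≤ 2 * y i -
      ∑ j, ((Fintype.card (i ⟶ j) : ℝ) + Fintype.card (j ⟶ i)) * y j := by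
  obtain ⟨n, -, h⟩ | ⟨n, hn, h⟩ | h | h | h := hV
  · exact h.exists_pos (CartanMatrix.exists_pos_A n)
  · exact h.exists_pos (CartanMatrix.exists_pos_D n hn)
  · exact h.exists_pos CartanMatrix.exists_pos_E₆
  · exact h.exists_pos CartanMatrix.exists_pos_E₇
  · exact h.exists_pos CartanMatrix.exists_pos_E₈

variable [Fintype V]

theorem degProj_preprojectiveRelation (m : ℕ) :
    degProj m (preprojectiveRelation K V) = if m = 2 then preprojectiveRelation K V else 0 := by
  have h1 : ∀ {i j : V} (a : i ⟶ j),
      degProj m (dblArrow K a * dblArrowStar K a - dblArrowStar K a * dblArrow K a) =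
        if m = 2 then dblArrow K a * dblArrowStar K a - dblArrowStar K a * dblArrow K a else 0 := by
    intro i j a
    have h2 : degProj m (dblArrow K a * dblArrowStar K a) =
        if m = 2 then dblArrow K a * dblArrowStar K a else 0 :=
      degProj_ofArrow_mul_ofArrow m _ _
    have h3 : degProj m (dblArrowStar K a * dblArrow K a) =
        if m = 2 then dblArrowStar K a * dblArrow K a else 0 :=
      degProj_ofArrow_mul_ofArrow m _ _
    rw [map_sub, h2, h3]
    split_ifs
    · rfl
    · rw [sub_zero]
  simp only [preprojectiveRelation, map_sum, h1]
  split_ifs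
  · rfl
  · simp only [Finset.sum_const_zero]

/-- Each truncation is a finite-dimensional quotient of the preprojective algebra, so
`exists_dimension_vector` and `sum_le_of_quadratic_form_le` bound its dimension by `2 * ∑ i, y i`,
independently of `n`. -/
theorem exists_ofPath_mem_preprojective (hV : IsDynkin V) :
    ∃ n, ∀ (i j : Quiver.Symmetrify V) (p : Quiver.Path i j), n ≤ p.length →
      ofPath K p ∈ TwoSidedIdeal.span {preprojectiveRelation K V} := by
  obtain ⟨y, hy, hy'⟩ := hV.exists_pos
  refine exists_forall_ofPath_mem_of_finrank_le (D := ⌊2 * ∑ i, y i⌋₊) ?_ fun n => ?_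
  · rintro x rfl m
    rw [degProj_preprojectiveRelation]
    split_ifs
    · exact TwoSidedIdeal.subset_span rfl
    · exact zero_mem _
  · have : FiniteDimensional K (truncation {preprojectiveRelation K V} n).ringCon.Quotient :=
      finite_quotient _ fun i j p => ofPath_mem_truncation _ p
    obtain ⟨d, hd, hd'⟩ := exists_dimension_vector
      (RingCon.mkₐ K (truncation {preprojectiveRelation K V} n).ringCon)
      (RingCon.mk'_surjective _)
      ((quotient_coe_eq_zero _).2 (TwoSidedIdeal.subset_span (Or.inl rfl)))
    refine hd.trans (Nat.le_floor ?_)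
    rw [Nat.cast_sum]
    exact sum_le_of_quadratic_form_le hy hy' hd'

/-- Reversal fixes each `a a^*` and each `a^* a`, hence the relation, which is a combination of
paths of length two. -/
theorem preprojective_sign_decomposition (hV : IsDynkin V)
    {P : ModuleCat.{max u v w} (PreprojectiveAlgebra K V)ᵐᵒᵖ} (hP : FGProj P)
    (hP' : Indecomposable P) :
    (∃ f : TwoSilt.minus P ≃ TwoSilt.plus P, ∀ S T, S.1 ≤ T.1 ↔ (f T).1 ≤ (f S).1) ∧
      Cardinal.mk (TwoSilt (PreprojectiveAlgebra K V)) = 2 * Cardinal.mk (TwoSilt.minus P) := by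
  refine PathAlgebra.sign_decomposition (K := K) (W := Quiver.Symmetrify V) ?_ ?_
    (exists_ofPath_mem_preprojective hV) hP hP'
  · intro x hx
    refine pathStar_mem_span ?_ hx
    rintro x rfl
    refine TwoSidedIdeal.subset_span ?_
    simp only [preprojectiveRelation, map_sum, map_sub, pathStar_mul, pathStar_dblArrow,
      pathStar_dblArrowStar]
    rfl
  · intro x hx v
    refine nilCoeff_of_mem_span ?_ hx v
    rintro x rfl v
    refine nilCoeff_of_mem_pathsGE one_le_two ?_ v
    exact sum_mem fun i _ => sum_mem fun j _ => sum_mem fun a _ =>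
      sub_mem (dblArrow_mul_dblArrowStar_mem a a) (dblArrowStar_mul_dblArrow_mem a a)

end Dynkin

end

theorem theorem2p5 {K : Type u} [Field K] [IsAlgClosed K] {V : Type v} [Fintype V]
    [Quiver.{w} V] [∀ i j : V, Fintype (i ⟶ j)] :
    (IsDynkin V →
      ∀ P : ModuleCat.{max u v w} (PreprojectiveAlgebra K V)ᵐᵒᵖ,
        Module.Finite (PreprojectiveAlgebra K V)ᵐᵒᵖ P →
        Module.Projective (PreprojectiveAlgebra K V)ᵐᵒᵖ P →
        Indecomposable P →
        (∃ f : TwoSilt.minus P ≃ TwoSilt.plus P,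
          ∀ S T, S.1 ≤ T.1 ↔ (f T).1 ≤ (f S).1) ∧
        Cardinal.mk (TwoSilt (PreprojectiveAlgebra K V)) = 2 * Cardinal.mk (TwoSilt.minus P)) ∧
    (∀ I : TwoSidedIdeal (PathAlgebra K V), IsAdmissible I →
      ∀ P : ModuleCat.{max u v w} (DualExtensionAlgebra I)ᵐᵒᵖ,
        Module.Finite (DualExtensionAlgebra I)ᵐᵒᵖ P →
        Module.Projective (DualExtensionAlgebra I)ᵐᵒᵖ P →
        Indecomposable P →
        (∃ f : TwoSilt.minus P ≃ TwoSilt.plus P,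
          ∀ S T, S.1 ≤ T.1 ↔ (f T).1 ≤ (f S).1) ∧
        Cardinal.mk (TwoSilt (DualExtensionAlgebra I)) = 2 * Cardinal.mk (TwoSilt.minus P)) := by
  exact ⟨fun hV P h1 h2 h3 => preprojective_sign_decomposition hV ⟨h1, h2⟩ h3,
    fun I hI P h1 h2 h3 => dualExtension_sign_decomposition hI ⟨h1, h2⟩ h3⟩
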